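/- Let $p$ be an odd prime, $F=\mathbb{Q}(\zeta)$ with $\zeta$ a primitive $p$-th root of unity, $\mathbb{O}$ its ring of integers, $\mathbb{P}=(1-\zeta)\subset\mathbb{O}$, and $\rho:\mathbb{O}\to\mathbb{F}_p$ the reduction modulo $\mathbb{P}$. For $1\le l\le p-1$ let $\sigma_l:F\to\mathbb{C}$ be the embedding with $\zeta\mapsto e^{2\pi i l/p}$. Put $r=(p-1)/2$ and let $k=\mathbb{Q}(\zeta+\zeta^{-1})$, with ring of integers $\mathcal{O}_k$. The form $\langle x,y\rangle=\sum_{i=1}^n\mathrm{Tr}_{F/\mathbb{Q}}(x_i\bar y_i/p)$ makes $\mathbb{P}^n$ an even lattice of rank $n(p-1)$ with dual lattice $\mathbb{O}^n$. Let $V_n=V_{\mathbb{P}^n}$ be its lattice vertex operator algebra, of central charge $c=n(p-1)$. For $w\in\mathbb{F}_p^n=\mathbb{O}^n/\mathbb{P}^n$ let $V_{\mathbb{P}^n+w}=S(\mathfrak{h}\otimes t^{-1}\mathbb{C}[t^{-1}])\otimes\mathbb{C}[\mathbb{P}^n+w]$, where $\mathfrak{h}=\mathbb{P}^n\otimes\mathbb{C}$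 and $\mathbb{P}^n+w=\rho^{-1}(w)\subset\mathbb{O}^n$, be the corresponding irreducible $V_n$-module. For a code $C\subset\mathbb{F}_p^n$ let $M_C=\bigoplus_{w\in C}V_{\mathbb{P}^n+w}$, and let $L_0=\omega_1$ be the action on $M_C$ of the mode of the conformal vector $\omega$ of $V_n$. The partition function of $M_C$, normalized by a power of the Dedekind $\eta$-function, is $$Z(M_C)(\tau)=\eta(\tau)^{n(p-1)}\,\mathrm{tr}_{M_C}\,q^{L_0-c/24},\qquad q=e^{2\pi i\tau},\ \mathrm{Im}\,\tau>0 .$$ The refined partition function $\tilde Z$ is the additive map from the representation group of $V_n$ (the free abelian group on the classes $[V_{\mathbb{P}^n+w}]$) to functions on $\mathbb{H}^r$ ($\mathbb{H}$ the upper half-plane) given by $$\tilde Z(V_{\mathbb{P}^n+w})(z)=\sum_{x\in\mathbb{P}^n+w}\exp\Big(2\pi i\sum_{l=1}^{r}z_l\sum_{i=1}^n\sigma_l(x_i\bar x_i)/p\Big),$$ so that $\tilde Z(M_C)=\sum_{w\in C}\tilde Z(V_{\mathbb{P}^n+w})$. Suppose that $C\subset\mathbb{F}_p^n$ is a linear code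 with $C=C^\perp$ for the standard inner product. Then: 1. The trace of $q^{L_0}$ on $M_C$ is well defined ($M_C$ is the direct sum of the eigenspaces of $L_0$, these are finite-dimensional, and the trace converges absolutely for $|q|<1$), and $Z(M_C)$ is a modular form of weight $n(p-1)/2$ for the full modular group $SL_2(\mathbb{Z})$ (in particular holomorphic at the cusp). 2. If $p=5$, the theta series defining $\tilde Z(M_C)$ converge absolutely on $\mathbb{H}^2$, and $\tilde Z(M_C)$ is a symmetric Hilbert modular form of parallel weight $n$ for $SL_2(\mathcal{O}_k)$, $k=\mathbb{Q}(\sqrt5)$: it is holomorphic on $\mathbb{H}^2$, invariant under the permutation of coordinates induced by $\mathrm{Gal}(k/\mathbb{Q})$, and $$\tilde Z(M_C)\Big(\tfrac{\sigma_l(a)z_l+\sigma_l(b)}{\sigma_l(c)z_l+\sigma_l(d)}\Big)_{l=1,2}=\tilde Z(M_C)(z)\prod_{l=1}^{2}(\sigma_l(c)z_l+\sigma_l(d))^n$$ for all $\begin{pmatrix}a&b\\c&d\end{pmatrix}\in SL_2(\mathcal{O}_k)$. -/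

import Mathlib

open scoped DirectSum

namespace EisensteinVOA

noncomputable section

/-! ### The cyclotomic field, its embeddings, and reduction modulo the prime above `p` -/

section Cyclotomic

variable (p : ℕ) [Fact p.Prime]

/-- The number field `F = ℚ(ζ)`. -/
abbrev F : Type := CyclotomicField p ℚ

instance isCyclotomicExtensionF : IsCyclotomicExtension {p} ℚ (F p) :=
  CyclotomicField.isCyclotomicExtension p ℚ

/-- The primitive `p`-th root of unity `ζ ∈ F`. -/
def zeta : F p := IsCyclotomicExtension.zeta p ℚ (F p)

theorem zeta_spec : IsPrimitiveRoot (zeta p) p :=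
  IsCyclotomicExtension.zeta_spec p ℚ (F p)

/-- The ring of integers `𝕆` of `F`. -/
abbrev O : Type := NumberField.RingOfIntegers (F p)

/-- `ζ` as an element of `𝕆`. -/
def zetaInt : O p := (zeta_spec p).toInteger

/-- The totally real subfield `k = ℚ(ζ + ζ⁻¹)` of `F`. -/
abbrev k : IntermediateField ℚ (F p) :=
  IntermediateField.adjoin ℚ {zeta p + (zeta p)⁻¹}

/-- The ring of integers of `k`. -/
abbrev Ok : Type := NumberField.RingOfIntegers (k p)

theorem exp_mem (l : Fin (p - 1)) :
    Complex.exp (2 * Real.pi * Complex.I * (((l : ℕ) + 1 : ℕ) / (p : ℂ))) ∈ primitiveRoots p ℂ := by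
  have hp := (Fact.out : p.Prime)
  rw [mem_primitiveRoots hp.pos]
  refine Complex.isPrimitiveRoot_exp_of_coprime _ _ hp.ne_zero ?_
  have h := l.2
  exact (Nat.coprime_of_lt_prime (by omega) (by omega) hp).symm

/-- The embeddings of `F` into `ℂ`: the one with index `l` is `σ_r` for `r = l + 1`,
`1 ≤ r ≤ p - 1`, i.e. it sends `ζ` to `exp (2πi r / p)`. -/
def sigma (l : Fin (p - 1)) : F p →ₐ[ℚ] ℂ :=
  ((zeta_spec p).embeddingsEquivPrimitiveRoots ℂ
    (Polynomial.cyclotomic.irreducible_rat (Fact.out : p.Prime).pos)).symm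
    ⟨_, exp_mem p l⟩

theorem sigma_zeta (l : Fin (p - 1)) :
    sigma p l (zeta p) =
      Complex.exp (2 * Real.pi * Complex.I * (((l : ℕ) + 1 : ℕ) / (p : ℂ))) := by
  have h := (zeta_spec p).embeddingsEquivPrimitiveRoots_apply_coe (C := ℂ)
    (Polynomial.cyclotomic.irreducible_rat (Fact.out : p.Prime).pos) (sigma p l)
  rw [← h, sigma, Equiv.apply_symm_apply]

/-- The embedding `σ_r`, `r = l + 1`, for `1 ≤ r ≤ (p - 1) / 2`; these represent the embeddings of
`F` up to complex conjugation and restrict to the distinct real embeddings of `k`. -/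
def sigmaHalf (l : Fin ((p - 1) / 2)) : F p →ₐ[ℚ] ℂ :=
  sigma p (Fin.castLE (Nat.div_le_self _ _) l)

theorem aeval_one_minpoly :
    Polynomial.aeval (1 : ZMod p) (minpoly ℤ (zeta_spec p).integralPowerBasis.gen) = 0 := by
  have hp := (Fact.out : p.Prime)
  have h : minpoly ℤ (zeta_spec p).toInteger = Polynomial.cyclotomic p ℤ := by
    rw [← NumberField.RingOfIntegers.minpoly_coe]
    exact (Polynomial.cyclotomic_eq_minpoly (zeta_spec p) hp.pos).symm
  rw [IsPrimitiveRoot.integralPowerBasis_gen, h,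
    Polynomial.aeval_def, Polynomial.eval₂_eq_eval_map, Polynomial.map_cyclotomic,
    Polynomial.eval_one_cyclotomic_prime]
  simp

/-- The reduction map `ρ : 𝕆 → 𝔽_p`, `∑ aᵢ ζ^i ↦ ∑ aᵢ`, as the ring homomorphism with `ζ ↦ 1`. -/
def rho : O p →+* ZMod p :=
  ((zeta_spec p).integralPowerBasis.lift (1 : ZMod p) (aeval_one_minpoly p) : O p →ₐ[ℤ] ZMod p)

theorem rho_zeta : rho p (zetaInt p) = 1 := by
  have h := (zeta_spec p).integralPowerBasis.lift_gen (1 : ZMod p) (aeval_one_minpoly p)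
  rw [IsPrimitiveRoot.integralPowerBasis_gen] at h
  exact h

/-- The kernel of `ρ` is the principal ideal `ℙ` generated by `1 - ζ`. -/
theorem ker_rho : RingHom.ker (rho p) = Ideal.span {1 - zetaInt p} := by
  have hprime : Prime (1 - zetaInt p) := by
    have h := (zeta_spec p).zeta_sub_one_prime'
    rw [← neg_sub]
    exact h.neg
  have hmax : (Ideal.span {1 - zetaInt p}).IsMaximal := by
    refine Ideal.IsPrime.isMaximal ((Ideal.span_singleton_prime hprime.ne_zero).2 hprime) ?_
    simpa using hprime.ne_zero
  refine (hmax.eq_of_le (RingHom.ker_ne_top _) ?_).symm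
  rw [Ideal.span_singleton_le_iff_mem, RingHom.mem_ker, map_sub, map_one, rho_zeta, sub_self]

end Cyclotomic

/-! ### Codes -/

/-- A linear code `C ⊂ 𝔽_p^n` is self-dual if it equals its orthogonal complement with respect to
the standard inner product. -/
def IsSelfDual {p n : ℕ} (C : Submodule (ZMod p) (Fin n → ZMod p)) : Prop :=
  ∀ v, v ∈ C ↔ ∀ c ∈ C, v ⬝ᵥ c = 0

/-! ### The lattice `ℙ^n`, its dual `𝕆^n`, and the cosets `ℙ^n + w` -/

section Lattice

variable {p : ℕ} [Fact p.Prime] {n : ℕ}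

/-- The coset `ℙ^n + w = ρ⁻¹(w) ⊂ 𝕆^n` of a word `w`. In particular `Coset 0` is the lattice
`ℙ^n`. -/
abbrev Coset (w : Fin n → ZMod p) : Type := {x : Fin n → O p // (fun i => rho p (x i)) = w}

/-- The origin of the lattice `ℙ^n`. -/
def origin : Coset (0 : Fin n → ZMod p) := ⟨0, by funext i; simp⟩

/-- Translation of a coset `ℙ^n + w` by an element of `ℙ^n`. -/
def shift {w : Fin n → ZMod p} (α : Coset (0 : Fin n → ZMod p)) (x : Coset w) : Coset w :=
  ⟨α.1 + x.1, by
    funext i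
    have h1 := congrFun α.2 i
    have h2 := congrFun x.2 i
    simp only [Pi.zero_apply] at h1
    simp [h1, h2]⟩

/-- Index set of the basis of `𝔥 = ℙ^n ⊗ ℂ` dual to the coordinates `σ_r(x_i)`. -/
abbrev Idx (p n : ℕ) : Type := Fin n × Fin (p - 1)

/-- The map `F^n ⊃ 𝕆^n → 𝔥 = ℂ^{n(p-1)}`, `x ↦ (σ_r(x_i))_{i,r}`. -/
def emb (x : Fin n → O p) : Idx p n → ℂ := fun a => sigma p a.2 (x a.1 : F p)

/-- The complex bilinear form on `𝔥` extending `⟨x, y⟩ = ∑ᵢ Tr(xᵢ ȳᵢ / p)`; here the index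
`Fin.rev l` stands for `σ_{p-r}`, the complex conjugate of `σ_r`, `r = l + 1`
(see `form_emb`). -/
def form (u v : Idx p n → ℂ) : ℂ := ∑ a : Idx p n, u a * v (a.1, Fin.rev a.2) / (p : ℂ)

theorem sigma_rev (l : Fin (p - 1)) (x : F p) :
    sigma p (Fin.rev l) x = (starRingEnd ℂ) (sigma p l x) := by
  have hp := (Fact.out : p.Prime)
  have key : sigma p (Fin.rev l) =
      ((Complex.conjAe.toAlgHom.restrictScalars ℚ).comp (sigma p l) : F p →ₐ[ℚ] ℂ) := by
    refine ((zeta_spec p).powerBasis ℚ).algHom_ext ?_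
    rw [IsPrimitiveRoot.powerBasis_gen]
    show sigma p (Fin.rev l) (zeta p) = (starRingEnd ℂ) (sigma p l (zeta p))
    rw [sigma_zeta, sigma_zeta, ← Complex.exp_conj, Complex.exp_eq_exp_iff_exists_int]
    refine ⟨1, ?_⟩
    have h0 : (p : ℂ) ≠ 0 := by exact_mod_cast hp.ne_zero
    have h1 : (((Fin.rev l : Fin (p - 1)) : ℕ) + 1 : ℕ) + ((l : ℕ) + 1) = p := by
      have := l.2
      rw [Fin.val_rev]
      omega
    have h2 : ((((Fin.rev l : Fin (p - 1)) : ℕ) + 1 : ℕ) : ℂ) = p - (((l : ℕ) + 1 : ℕ) : ℂ) := by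
      rw [eq_sub_iff_add_eq]
      exact_mod_cast h1
    rw [h2]
    simp only [map_mul, map_div₀, Complex.conj_ofReal, Complex.conj_I, map_natCast, map_ofNat]
    field_simp
    push_cast
    ring
  rw [key]
  rfl

/-- On the lattice the form is `⟨x, y⟩ = ∑ᵢ Tr(xᵢ ȳᵢ / p)`. -/
theorem form_emb (x y : Fin n → O p) :
    form (emb x) (emb y) =
      ∑ i, ∑ l, sigma p l (x i : F p) * (starRingEnd ℂ) (sigma p l (y i : F p)) / (p : ℂ) := by
  simp only [form, emb, Fintype.sum_prod_type, sigma_rev]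

/-- The integer `⟨α, x⟩`. It is only used for `α ∈ ℙ^n` and `x ∈ 𝕆^n = (ℙ^n)^∨`, where the value of
the form is an integer, so that the rounding is exact. -/
def intForm (α x : Fin n → O p) : ℤ := ⌊(form (emb α) (emb x)).re⌋

/-- The bilinear `±1`-valued cocycle `ε(α, x) = (-1)^{∑ᵢ Tr(αᵢ x̄ᵢ / (1 - ζ))}` for `α ∈ ℙ^n` and
`x ∈ 𝕆^n`. On `ℙ^n` it satisfies `ε(α, β) ε(β, α) = (-1)^{⟨α, β⟩}` and
`ε(α, α) = (-1)^{⟨α, α⟩ / 2}`. -/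
def eps (α x : Fin n → O p) : ℂ :=
  Complex.exp (Real.pi * Complex.I *
    ∑ i, ∑ l, sigma p l (α i : F p) * (starRingEnd ℂ) (sigma p l (x i : F p)) /
      (1 - sigma p l (zeta p)))

end Lattice

/-! ### The lattice modules `V_{ℙ^n + w}` and their vertex operators -/

section Vertex

variable {p : ℕ} [Fact p.Prime] {n : ℕ} {w : Fin n → ZMod p}

/-- The symmetric algebra of `𝔥 ⊗ t⁻¹ℂ[t⁻¹]`; the variable `X (a, m)` is `v_a ⊗ t^{-m-1}`, where
`v_a` is the standard basis of `𝔥`. -/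
abbrev Fock (p n : ℕ) : Type := MvPolynomial (Idx p n × ℕ) ℂ

/-- The space `V_{ℙ^n + w} = S ⊗ ℂ[ℙ^n + w]`, where `S` is the symmetric algebra above;
`Finsupp.single x Q` is `Q ⊗ e^x`. The underlying space of the Eisenstein vertex algebra
`V_n = V_{ℙ^n}` is `V 0`. -/
abbrev V (w : Fin n → ZMod p) : Type := Coset w →₀ Fock p n

/-- The action of `u ⊗ t^m`, `u ∈ 𝔥`, of the Heisenberg algebra on `V_{ℙ^n + w}` at level `1`: a
creation operator for `m < 0`, multiplication by `⟨u, x⟩` on `S ⊗ e^x` for `m = 0`, and the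
derivation with `v ⊗ t^{-m} ↦ m ⟨u, v⟩` for `m > 0`. -/
def heis (u : Idx p n → ℂ) : ℤ → Module.End ℂ (V w)
  | .ofNat 0 => Finsupp.lsum ℂ fun x => form u (emb x.1) • Finsupp.lsingle x
  | .ofNat (m + 1) => Finsupp.mapRange.linearMap
      (((m : ℂ) + 1) • ∑ a : Idx p n, form u (Pi.single a 1) •
        (MvPolynomial.pderiv (R := ℂ) (a, m)).toLinearMap)
  | .negSucc m => Finsupp.mapRange.linearMap
      (LinearMap.mulLeft ℂ (∑ a : Idx p n, u a • MvPolynomial.X (a, m)))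

/-- The linear operator with prescribed values on the basis vectors `X^s ⊗ e^x`. -/
def onBasis (f : Coset w → (Idx p n × ℕ →₀ ℕ) → V w) : Module.End ℂ (V w) :=
  Finsupp.lsum ℂ fun x => (MvPolynomial.basisMonomials (Idx p n × ℕ) ℂ).constr ℂ (f x)

/-- The sum of a sequence of operators only finitely many of which are nonzero on any given
vector. -/
def locSum (T : ℕ → Module.End ℂ (V w)) : Module.End ℂ (V w) :=
  onBasis fun x s => ∑ᶠ j, T j (Finsupp.single x (MvPolynomial.monomial s 1))

/-- The coefficient of `z^j` in `exp g(z)`, for a power series `g` in `z` without constant term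
whose coefficients are (commuting) operators. -/
def expCoeff (g : PowerSeries (Module.End ℂ (V w))) (j : ℕ) : Module.End ℂ (V w) :=
  ∑ i ∈ Finset.range (j + 1), ((Nat.factorial i : ℂ)⁻¹) • PowerSeries.coeff j (g ^ i)

/-- The mode `(e^α)_m`, i.e. the coefficient of `z^{-m-1}` in
`Y(e^α, z) = exp(∑_{j>0} α_{(-j)} z^j / j) exp(-∑_{j>0} α_{(j)} z^{-j} / j) e^α z^α`,
where `e^α z^α` sends `Q ⊗ e^x` to `ε(α, x) z^{⟨α, x⟩} Q ⊗ e^{α + x}`. -/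
def expMode (α : Coset (0 : Fin n → ZMod p)) (m : ℤ) : Module.End ℂ (V w) :=
  onBasis fun x s =>
    ∑ᶠ (ij : ℕ × ℕ) (_ : (ij.1 : ℤ) - ij.2 + intForm α.1 x.1 = -m - 1),
      expCoeff (PowerSeries.mk fun j => ((j : ℂ)⁻¹) • heis (emb α.1) (-(j : ℤ))) ij.1
        (expCoeff (PowerSeries.mk fun j => (-(j : ℂ)⁻¹) • heis (emb α.1) (j : ℤ)) ij.2
          (eps α.1 x.1 • Finsupp.single (shift α x) (MvPolynomial.monomial s 1)))

/-- The modes of `h₁ ⋯ h_r ⊗ e^α`, where each `h = v_a ⊗ t^{-k-1}` is given as `(a, k)`. They are the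
modes of the normally ordered product `:(∂^k v_a(z) / k!) Y(h₂ ⋯ h_r ⊗ e^α, z):`, in which the
creation operators `v_a ⊗ t^{-1-i}`, `i ≥ 0`, stand on the left and the operators `v_a ⊗ t^i`,
`i ≥ 0`, on the right. -/
def wordMode : List (Idx p n × ℕ) → Coset (0 : Fin n → ZMod p) → ℤ → Module.End ℂ (V w)
  | [], α, m => expMode α m
  | (a, k) :: h, α, m => locSum fun j =>
      ((Nat.choose (k + j) k : ℂ)) •
        (heis (Pi.single a 1) (-(k : ℤ) - 1 - j) * wordMode h α (m + j) +
          (-1 : ℂ) ^ k • (wordMode h α (m - k - 1 - j) * heis (Pi.single a 1) (j : ℤ)))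

/-- The state-field correspondence `Y(v, z) = ∑_m v_m z^{-m-1}` of `V_n` on the module
`V_{ℙ^n + w}`: the mode `v_m`, for `v ∈ V_n`. For `w = 0` this is the state-field correspondence of
`V_n` itself. -/
def mode (w : Fin n → ZMod p) (m : ℤ) : V (0 : Fin n → ZMod p) →ₗ[ℂ] Module.End ℂ (V w) :=
  Finsupp.lsum ℂ fun α => (MvPolynomial.basisMonomials (Idx p n × ℕ) ℂ).constr ℂ fun s =>
    wordMode (Finsupp.toMultiset s).toList α m

/-- The vacuum vector of `V_n`. -/
def vacuum : V (0 : Fin n → ZMod p) := Finsupp.single origin 1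

/-- The conformal vector `ω = ½ ∑_a (v_a)_{(-1)} (v^a)_{(-1)} 𝟙`, where `v^a` is the basis of `𝔥`
dual to `v_a` (see `form_dual`). -/
def omega : V (0 : Fin n → ZMod p) :=
  (1 / 2 : ℂ) • ∑ a : Idx p n,
    heis (Pi.single a 1) (-1) (heis (Pi.single (a.1, Fin.rev a.2) (p : ℂ)) (-1) vacuum)

theorem form_dual (a b : Idx p n) :
    form (Pi.single a 1) (Pi.single (b.1, Fin.rev b.2) (p : ℂ)) = if a = b then 1 else 0 := by
  have h0 : (p : ℂ) ≠ 0 := by exact_mod_cast (Fact.out : p.Prime).ne_zero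
  unfold form
  rw [Finset.sum_eq_single a]
  · by_cases h : a = b
    · subst h
      simp [h0]
    · have h' : (a.1, Fin.rev a.2) ≠ (b.1, Fin.rev b.2) := by
        intro e
        apply h
        simpa [Prod.ext_iff] using e
      simp [h, Pi.single_eq_of_ne h']
  · intro c _ hc
    simp [Pi.single_eq_of_ne hc]
  · simp

end Vertex

/-! ### The module `M_C` and its partition functions -/

section Partition

/-- For an operator `L₀` on a vector space `M`, the trace of `q^{L₀}` makes sense: `M` is the sum of
the eigenspaces `M_μ` of `L₀`, these are finite-dimensional, and `∑ dim(M_μ) q^μ` converges absolutely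
for `q = e^{2πiτ}`, `τ` in the upper half-plane. -/
def HasPartitionFunction (M : Type*) [AddCommGroup M] [Module ℂ M] (L₀ : Module.End ℂ M) : Prop :=
  (⨆ μ : ℂ, L₀.eigenspace μ) = ⊤ ∧ (∀ μ : ℂ, FiniteDimensional ℂ (L₀.eigenspace μ)) ∧
    ∀ τ : UpperHalfPlane, Summable fun μ : ℂ =>
      (Module.finrank ℂ (L₀.eigenspace μ) : ℂ) * Complex.exp (2 * Real.pi * Complex.I * τ * μ)

/-- The partition function `tr_M q^{L₀ - c/24} = ∑_μ dim(M_μ) q^{μ - c/24}`, `q = e^{2πiτ}`. -/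
def partitionFunction (M : Type*) [AddCommGroup M] [Module ℂ M] (L₀ : Module.End ℂ M) (c : ℂ)
    (τ : UpperHalfPlane) : ℂ :=
  ∑' μ : ℂ, (Module.finrank ℂ (L₀.eigenspace μ) : ℂ) *
    Complex.exp (2 * Real.pi * Complex.I * τ * (μ - c / 24))

variable {p : ℕ} [Fact p.Prime] {n : ℕ}

/-- The `V_n`-module `M_C = ⨁_{w ∈ C} V_{ℙ^n + w}`. -/
abbrev M (C : Submodule (ZMod p) (Fin n → ZMod p)) : Type := ⨁ w : C, V (w : Fin n → ZMod p)

/-- The action of the modes of `V_n` on `M_C`. -/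
def modeM (C : Submodule (ZMod p) (Fin n → ZMod p)) (m : ℤ) (v : V (0 : Fin n → ZMod p)) :
    Module.End ℂ (M C) :=
  DirectSum.lmap fun w : C => mode (w : Fin n → ZMod p) m v

/-- The operator `L₀ = ω_1` on `M_C`. -/
def L0 (C : Submodule (ZMod p) (Fin n → ZMod p)) : Module.End ℂ (M C) := modeM C 1 omega

/-- The central charge `n(p-1)` of `V_n`, the rank of the lattice `ℙ^n`. -/
def centralCharge (p n : ℕ) : ℂ := ((n * (p - 1) : ℕ) : ℂ)

/-- The partition function of `M_C`, normalized by the factor `η^{n(p-1)}`. -/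
def Z (C : Submodule (ZMod p) (Fin n → ZMod p)) (τ : UpperHalfPlane) : ℂ :=
  ModularForm.eta (τ : ℂ) ^ (n * (p - 1)) * partitionFunction (M C) (L0 C) (centralCharge p n) τ

/-- The product `ℍ^r` of `r = (p-1)/2` upper half-planes. -/
def Hr (p : ℕ) : Set (Fin ((p - 1) / 2) → ℂ) := {z | ∀ l, 0 < (z l).im}

/-- The summand `exp(2πi Tr_k(z x x̄ / p))` of the theta series, where
`Tr_k(z x x̄ / p) = ∑ᵢ ∑_l z_l σ_l(xᵢ x̄ᵢ) / p`. -/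
def thetaTerm (z : Fin ((p - 1) / 2) → ℂ) (x : Fin n → O p) : ℂ :=
  Complex.exp (2 * Real.pi * Complex.I * ∑ i, ∑ l, z l *
    (sigmaHalf p l (x i : F p) * (starRingEnd ℂ) (sigmaHalf p l (x i : F p))) / (p : ℂ))

/-- The refined theta series `θ_{w}(z) = ∑_{x ∈ ℙ^n + w} exp(2πi Tr_k(z x x̄ / p))`. -/
def theta (w : Fin n → ZMod p) (z : Fin ((p - 1) / 2) → ℂ) : ℂ :=
  ∑' x : Coset w, thetaTerm z x.1

/-- The representation group of `V_n`: the free abelian group on the classes of the irreducible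
modules `V_{ℙ^n + w}`, `w ∈ 𝔽_p^n`. -/
abbrev Rep (p n : ℕ) : Type := (Fin n → ZMod p) →₀ ℤ

/-- The class of `M_C = ⨁_{w ∈ C} V_{ℙ^n + w}` in the representation group. -/
def classM (C : Submodule (ZMod p) (Fin n → ZMod p)) : Rep p n :=
  ∑ᶠ w : C, Finsupp.single (w : Fin n → ZMod p) 1

/-- The refined partition function: the additive map from the representation group to functions of
`r` variables with `V_{ℙ^n + w} ↦ θ_{w}`. -/
def refinedZ : Rep p n →ₗ[ℤ] ((Fin ((p - 1) / 2) → ℂ) → ℂ) :=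
  Finsupp.linearCombination ℤ theta

/-- The action of `A ∈ SL₂(𝒪_k)` on `ℍ^r` through the `r` real embeddings `σ_l` of `k`. -/
def moeb (A : Matrix.SpecialLinearGroup (Fin 2) (Ok p)) (z : Fin ((p - 1) / 2) → ℂ) :
    Fin ((p - 1) / 2) → ℂ := fun l =>
  (sigmaHalf p l ((A 0 0 : k p) : F p) * z l + sigmaHalf p l ((A 0 1 : k p) : F p)) /
    (sigmaHalf p l ((A 1 0 : k p) : F p) * z l + sigmaHalf p l ((A 1 1 : k p) : F p))

variable (p) in
/-- `f` is a Hilbert modular form of (parallel) weight `m` for the full group `SL₂(𝒪_k)`: it is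
holomorphic on `ℍ^r` and `f(Az) = f(z) ∏_l (σ_l(c) z_l + σ_l(d))^m`. (For `r > 1` holomorphy at the
cusps is automatic.) -/
def IsHilbertModularForm (m : ℕ) (f : (Fin ((p - 1) / 2) → ℂ) → ℂ) : Prop :=
  DifferentiableOn ℂ f (Hr p) ∧
    ∀ A : Matrix.SpecialLinearGroup (Fin 2) (Ok p), ∀ z ∈ Hr p,
      f (moeb A z) = f z * ∏ l,
        (sigmaHalf p l ((A 1 0 : k p) : F p) * z l + sigmaHalf p l ((A 1 1 : k p) : F p)) ^ m

variable (p) in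
/-- `f` is symmetric: invariant under the permutations of the coordinates of `ℍ^r` induced by the
Galois group of `k`. -/
def IsSymmetric (f : (Fin ((p - 1) / 2) → ℂ) → ℂ) : Prop :=
  ∀ (g : k p ≃ₐ[ℚ] k p) (π : Equiv.Perm (Fin ((p - 1) / 2))),
    (∀ l (x : k p), sigmaHalf p (π l) (x : F p) = sigmaHalf p l ((g x : k p) : F p)) →
      ∀ z ∈ Hr p, f (z ∘ π) = f z

end Partition

end

end EisensteinVOA

/-!
Let `L = ρ⁻¹(C) ⊂ 𝕆^n` be the preimage of the code, with theta function
`Θ(z) = ∑_{x ∈ L} exp(2πi ∑_l z_l Q_l(x))`, `Q_l(x) = ∑ᵢ |σ_l(xᵢ)|² / p` (`codeTheta`, `quadForm`).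
Both partition functions are values of `Θ`, and its modularity is the inversion formula for theta
functions of self-dual lattices.

*From characters to theta functions.* The conformal vector is quadratic in the Heisenberg
operators, so `L₀` is diagonal in the basis `X^s ⊗ e^x` of `M_C`, with eigenvalue
`⟨x, x⟩ / 2 + ∑ (m + 1) s(a, m)` (`mode_omega_basisVec`). Summing over `s` gives the product
`∏ (1 - q^m)^{-n(p-1)}`, which cancels against the power of `η` together with `q^{-c/24}`; what
remains is `Θ(τ, …, τ)` (`hasPartitionFunction_and_Z`). The refined partition function is `Θ` itself,
split along the cosets of `ℙ^n` (`refinedZ_classM`).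

*Translations.* If `C ⊂ C^⊥`, then for `b ∈ 𝒪_k` and `x ∈ L` the number `∑_l σ_l(b) Q_l(x)` is an
integer: its double is `⟨b x, x⟩`, which is an integer because
`∑_l σ_l(x) σ_l(y)‾ ≡ -ρ(x) ρ(y)` modulo `p` (`exists_int_trForm`), and `p` times it is an algebraic
integer, `p` being odd (`exists_int_halfTrace`). Hence `Θ(z + b) = Θ(z)` (`codeTheta_add`).

*Inversion.* The real coordinates `(Re + Im)(σ_l(xᵢ)) / √p` turn the form `⟨x, y⟩` into the standard
scalar product (`embR_dotProduct`), and `Q_l` into half the sum of the squares of the two coordinates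
belonging to `σ_l` and its conjugate. For `C = C^⊥` the lattice `L` becomes a self-dual lattice in
Euclidean space (`realLattice_selfDual`), and each term of `Θ(z)` a Gaussian with parameter `-i z_l`
on these two coordinates. Poisson summation, reduced to `ℤ^N` by the choice of a basis
(`tsum_int_eq_tsum_fourier`, `tsum_gauss_of_selfDual`), gives
`Θ(-1/z) = ∏_l (-i z_l)^n Θ(z)` (`codeTheta_inv`).

*The full modular group.* On the diagonal, `τ ↦ τ + 1` acts trivially and `τ ↦ -1/τ` with the
multiplier `c = (-i)^{n(p-1)/2}`. The relation `(ST)^3 = -1` and `Θ(i, …, i) > 0` force `c = 1`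
(`neg_I_pow_eq_one`). This gives modularity under generators of `SL₂(ℤ)`, and termwise domination
gives holomorphy and boundedness at the cusp.

*The case `p = 5`.* The ring `𝒪_k` contains `ℤ[ζ + ζ⁻¹]`, and rounding the coordinates of a quotient
with respect to `1, ζ + ζ⁻¹` is a Euclidean division with respect to the norm (`absNorm5_euclidean`).
So `SL₂(𝒪_k)` is generated by inversion and translations (`eq_top_of_euclidean`), and `Θ` transforms
correctly under all of it. The symmetry comes from the automorphism `ζ ↦ ζ²` of `F`, which preserves
`L` since `ρ` is invariant under it, and exchanges `Q_1` and `Q_2` (`quadForm_frobInt`).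
-/

namespace EisensteinVOA

/-! ### Poisson summation and the theta inversion formula for self-dual lattices -/

section Poisson

set_option linter.unusedSectionVars false

open MeasureTheory

variable {ι : Type*} [Fintype ι]

theorem exp_neg_mul_sq_le {c t : ℝ} (hc : 0 < c) (ht : 0 < t) (n : ℕ) :
    Real.exp (-c * t ^ 2) ≤ (n.factorial / c ^ n) * t⁻¹ ^ (2 * n) := by
  have h := Real.pow_div_factorial_le_exp (x := c * t ^ 2) (by positivity) n
  rw [neg_mul, Real.exp_neg]
  refine (inv_anti₀ (by positivity) h).trans (le_of_eq ?_)
  rw [mul_pow, ← pow_mul, inv_div, inv_pow]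
  field_simp

/-- Gaussians are summable over lattices. -/
theorem summable_exp_neg_norm_sq {E : Type*} [NormedAddCommGroup E] [NormedSpace ℝ E]
    [FiniteDimensional ℝ E] (L : Submodule ℤ E) [DiscreteTopology L] {c : ℝ} (hc : 0 < c) :
    Summable fun x : L => Real.exp (-c * ‖x‖ ^ 2) := by
  set n := Module.finrank ℤ L + 1
  have h1 : Summable fun x : L => (n.factorial / c ^ n) * ‖x‖⁻¹ ^ (2 * n) :=
    (ZLattice.summable_norm_pow_inv L (2 * n) (by omega)).mul_left _
  refine Summable.of_norm_bounded_eventually h1 ?_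
  refine (Set.finite_singleton (0 : L)).subset fun x hx => ?_
  by_contra h0
  refine hx ?_
  simp only [Set.mem_ofPred_eq]
  rw [Real.norm_of_nonneg (Real.exp_nonneg _)]
  exact exp_neg_mul_sq_le hc (norm_pos_iff.2 h0) n

theorem norm_sq_le_sum_sq (x : ι → ℝ) : ‖x‖ ^ 2 ≤ ∑ j, x j ^ 2 := by
  have h0 : 0 ≤ ∑ j, x j ^ 2 := Finset.sum_nonneg fun j _ => sq_nonneg _
  rw [← Real.sq_sqrt h0]
  refine pow_le_pow_left₀ (norm_nonneg _) ?_ 2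
  refine (pi_norm_le_iff_of_nonneg (Real.sqrt_nonneg _)).2 fun j => ?_
  rw [Real.norm_eq_abs]
  refine Real.abs_le_sqrt ?_
  exact Finset.single_le_sum (f := fun j => x j ^ 2) (fun j _ => sq_nonneg _) (Finset.mem_univ j)

theorem summable_exp_neg_sum_sq (L : Submodule ℤ (ι → ℝ)) [DiscreteTopology L] {c : ℝ}
    (hc : 0 < c) : Summable fun x : L => Real.exp (-c * ∑ j, (x : ι → ℝ) j ^ 2) := by
  refine Summable.of_nonneg_of_le (fun _ => Real.exp_nonneg _) (fun x => ?_)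
    (summable_exp_neg_norm_sq L hc)
  rw [Real.exp_le_exp]
  have := norm_sq_le_sum_sq (x : ι → ℝ)
  have h2 : ‖x‖ = ‖(x : ι → ℝ)‖ := rfl
  rw [h2]
  nlinarith

/-- The integer points of `ℝ^ι`, as an enumeration of the standard lattice. -/
noncomputable def intEquiv (ι : Type*) [Fintype ι] :
    (ι → ℤ) ≃ Submodule.span ℤ (Set.range (Pi.basisFun ℝ ι)) :=
  ((Pi.basisFun ℝ ι).restrictScalars ℤ).equivFun.symm.toEquiv

theorem coe_intEquiv (m : ι → ℤ) (j : ι) : (intEquiv ι m : ι → ℝ) j = m j := by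
  classical
  simp [intEquiv, Module.Basis.equivFun_symm_apply, Pi.single_apply]

theorem summable_int_exp_neg_sum_sq {c : ℝ} (hc : 0 < c) :
    Summable fun m : ι → ℤ => Real.exp (-c * ∑ j, (m j : ℝ) ^ 2) := by
  have h := (intEquiv ι).summable_iff.2
    (summable_exp_neg_sum_sq (Submodule.span ℤ (Set.range (Pi.basisFun ℝ ι))) hc)
  simpa [Function.comp_def, coe_intEquiv] using h

/-- The sum of the integer translates of `g`. -/
noncomputable def periodize (g : (ι → ℝ) → ℂ) (t : ι → ℝ) : ℂ :=
  ∑' m : ι → ℤ, g (t + fun j => (m j : ℝ))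

variable {g : (ι → ℝ) → ℂ} {K c : ℝ}

theorem norm_translate_le (hc : 0 < c) (hg : ∀ t, ‖g t‖ ≤ K * Real.exp (-c * ∑ j, t j ^ 2))
    (R : ℝ) {t : ι → ℝ} (ht : ∑ j, t j ^ 2 ≤ R) (m : ι → ℤ) :
    ‖g (t + fun j => (m j : ℝ))‖ ≤
      K * Real.exp (c * R) * Real.exp (-(c / 2) * ∑ j, (m j : ℝ) ^ 2) := by
  have hK : 0 ≤ K := by
    have := (norm_nonneg _).trans (hg 0)
    exact nonneg_of_mul_nonneg_left this (Real.exp_pos _)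
  refine (hg _).trans ?_
  rw [mul_assoc, ← Real.exp_add]
  refine mul_le_mul_of_nonneg_left (Real.exp_le_exp.2 ?_) hK
  have h1 : ∑ j, (m j : ℝ) ^ 2 ≤ 2 * ∑ j, (t j + m j) ^ 2 + 2 * ∑ j, t j ^ 2 := by
    rw [Finset.mul_sum, Finset.mul_sum, ← Finset.sum_add_distrib]
    refine Finset.sum_le_sum fun j _ => ?_
    nlinarith [sq_nonneg (2 * t j + m j)]
  simp only [Pi.add_apply]
  nlinarith

theorem continuous_periodize (hc : 0 < c) (hcont : Continuous g)
    (hg : ∀ t, ‖g t‖ ≤ K * Real.exp (-c * ∑ j, t j ^ 2)) : Continuous (periodize g) := by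
  refine continuous_iff_continuousAt.2 fun t₀ => ?_
  set U : Set (ι → ℝ) := {t | ∑ j, t j ^ 2 < ∑ j, t₀ j ^ 2 + 1}
  have hU : IsOpen U := isOpen_lt (by fun_prop) (by fun_prop)
  have h : ContinuousOn (periodize g) U := by
    refine continuousOn_tsum
      (u := fun m : ι → ℤ => K * Real.exp (c * (∑ j, t₀ j ^ 2 + 1)) *
        Real.exp (-(c / 2) * ∑ j, (m j : ℝ) ^ 2))
      (fun m => by fun_prop) ?_ ?_
    · exact (summable_int_exp_neg_sum_sq (by positivity)).mul_left _
    · exact fun m t ht => norm_translate_le hc hg _ (le_of_lt ht) m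
  exact h.continuousAt (hU.mem_nhds (by simp [U]))

theorem periodize_add_int (g : (ι → ℝ) → ℂ) (t : ι → ℝ) (k : ι → ℤ) :
    periodize g (t + fun j => (k j : ℝ)) = periodize g t := by
  unfold periodize
  rw [← (Equiv.addLeft k).tsum_eq (fun m : ι → ℤ => g (t + fun j => (m j : ℝ)))]
  refine tsum_congr fun m => ?_
  congr 1
  ext j
  simp [add_assoc]

theorem isOpenQuotientMap_toTorus :
    IsOpenQuotientMap (fun (t : ι → ℝ) (j : ι) => (t j : UnitAddCircle)) :=
  IsOpenQuotientMap.piMap fun _ => QuotientAddGroup.isOpenQuotientMap_mk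

/-- The periodization of a continuous function of Gaussian decay descends to the torus. -/
theorem exists_periodize_lift (hc : 0 < c) (hcont : Continuous g)
    (hg : ∀ t, ‖g t‖ ≤ K * Real.exp (-c * ∑ j, t j ^ 2)) :
    ∃ G : C(UnitAddTorus ι, ℂ), ∀ t : ι → ℝ, G (fun j => (t j : UnitAddCircle)) = periodize g t := by
  have hq : IsOpenQuotientMap (fun (t : ι → ℝ) (j : ι) => (t j : UnitAddCircle)) :=
    isOpenQuotientMap_toTorus
  have hf : Function.FactorsThrough (periodize g)
      (fun (t : ι → ℝ) (j : ι) => (t j : UnitAddCircle)) := by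
    intro s t hst
    have h1 : ∀ j, ∃ k : ℤ, s j = t j + k := fun j => by
      have h : (s j : UnitAddCircle) = (t j : UnitAddCircle) := congrFun hst j
      rw [eq_comm, QuotientAddGroup.eq, AddSubgroup.mem_zmultiples_iff] at h
      obtain ⟨k, hk⟩ := h
      refine ⟨k, ?_⟩
      simp only [zsmul_eq_mul, mul_one] at hk
      rw [hk]
      ring
    choose k hk using h1
    have : s = t + fun j => (k j : ℝ) := funext hk
    rw [this, periodize_add_int]
  choose s hs using hq.surjective
  refine ⟨⟨fun u => periodize g (s u), ?_⟩, fun t => hf (hs _)⟩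
  rw [← hq.isQuotientMap.continuous_iff.symm]
  exact (continuous_periodize hc hcont hg).congr fun t => (hf (hs _)).symm

theorem integrable_of_gaussian_bound (hc : 0 < c) (hcont : Continuous g)
    (hg : ∀ t, ‖g t‖ ≤ K * Real.exp (-c * ∑ j, t j ^ 2)) : Integrable g := by
  have h := GaussianFourier.integrable_cexp_neg_sum_mul_add (ι := ι) (b := fun _ => (c : ℂ))
    (fun _ => by simpa using hc) 0
  refine (h.norm.const_mul K).mono' hcont.aestronglyMeasurable (ae_of_all _ fun t => ?_)
  refine (hg t).trans (le_of_eq ?_)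
  rw [Complex.norm_exp]
  congr 2
  simp only [← Finset.mul_sum, Pi.zero_apply, zero_mul, Finset.sum_const_zero, add_zero]
  rw [← Complex.ofReal_re (-c * ∑ j, t j ^ 2)]
  push_cast
  rw [neg_mul]

/-- Unfolding: the integer translates of the unit cube tile `ℝ^ι`. -/
theorem setIntegral_periodize (hc : 0 < c) (hcont : Continuous g)
    (hg : ∀ t, ‖g t‖ ≤ K * Real.exp (-c * ∑ j, t j ^ 2)) :
    ∫ t in {t : ι → ℝ | ∀ j, t j ∈ Set.Ioc (0 : ℝ) (0 + 1)}, periodize g t = ∫ t, g t := by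
  set D := ZSpan.fundamentalDomain (Pi.basisFun ℝ ι)
  have hD : D = Set.univ.pi fun _ : ι => Set.Ico (0 : ℝ) 1 := ZSpan.fundamentalDomain_pi_basisFun
  -- The integral over the torus uses the cube open on the left, the fundamental domain of `ℤ^ι` in
  -- Mathlib is open on the right.
  have hset : ({t : ι → ℝ | ∀ j, t j ∈ Set.Ioc (0 : ℝ) (0 + 1)} : Set (ι → ℝ)) =ᵐ[volume] D := by
    have h1 : {t : ι → ℝ | ∀ j, t j ∈ Set.Ioc (0 : ℝ) (0 + 1)} =
        Set.univ.pi fun _ : ι => Set.Ioc (0 : ℝ) 1 := by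
      ext t; simp
    rw [h1, hD]
    exact (Measure.univ_pi_Ioc_ae_eq_Icc (f := fun _ : ι => (0 : ℝ)) (g := fun _ => 1)).trans
      (Measure.univ_pi_Ico_ae_eq_Icc (f := fun _ : ι => (0 : ℝ)) (g := fun _ => 1)).symm
  have hvol : volume D = 1 := by
    rw [hD, Real.volume_pi_Ico]; simp
  have hint := integrable_of_gaussian_bound hc hcont hg
  have hF := ZSpan.isAddFundamentalDomain' (Pi.basisFun ℝ ι) (volume : Measure (ι → ℝ))
  have : Countable (Submodule.span ℤ (Set.range (Pi.basisFun ℝ ι))).toAddSubgroup :=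
    (intEquiv ι).surjective.countable
  rw [setIntegral_congr_set hset, hF.integral_eq_tsum'' g hint]
  refine Eq.trans ?_ ((intEquiv ι).tsum_eq fun x => ∫ t in D, g ((x : ι → ℝ) + t))
  have hv : ∀ (m : ι → ℤ) (t : ι → ℝ), (intEquiv ι m : ι → ℝ) + t = t + fun j => (m j : ℝ) := by
    intro m t
    ext j
    simp [coe_intEquiv, add_comm]
  simp only [hv]
  have hint' : ∀ m : ι → ℤ, Integrable (fun t : ι → ℝ => g (t + fun j => (m j : ℝ))) :=
    fun m => hint.comp_add_right _
  refine (integral_tsum_of_summable_integral_norm (fun m => (hint' m).restrict) ?_).symm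
  refine Summable.of_nonneg_of_le (fun m => integral_nonneg fun t => norm_nonneg _) (fun m => ?_)
    ((summable_int_exp_neg_sum_sq (ι := ι) (half_pos hc)).mul_left
      (K * Real.exp (c * (Fintype.card ι : ℝ))))
  have h2 : ∀ t ∈ D, ‖‖g (t + fun j => (m j : ℝ))‖‖ ≤ K * Real.exp (c * (Fintype.card ι : ℝ)) *
      Real.exp (-(c / 2) * ∑ j, (m j : ℝ) ^ 2) := by
    intro t ht
    rw [norm_norm]
    refine norm_translate_le hc hg _ ?_ m
    rw [hD] at ht
    calc ∑ j, t j ^ 2 ≤ ∑ _j : ι, (1 : ℝ) := Finset.sum_le_sum fun j _ => by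
          have := ht j (Set.mem_univ _)
          nlinarith [this.1, this.2]
      _ = Fintype.card ι := by simp
  have h3 := norm_setIntegral_le_of_norm_le_const (μ := volume) (by rw [hvol]; simp) h2
  rw [measureReal_def, hvol] at h3
  simpa using (le_abs_self _).trans h3

/-- Poisson summation over `ℤ^ι` for a continuous function of Gaussian decay. The Fourier series of
the periodization is evaluated at the origin of the torus. -/
theorem tsum_int_eq_tsum_fourier (hc : 0 < c) (hcont : Continuous g)
    (hg : ∀ t, ‖g t‖ ≤ K * Real.exp (-c * ∑ j, t j ^ 2))
    (hsum : Summable fun k : ι → ℤ =>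
      ∫ t : ι → ℝ, Complex.exp (-(2 * Real.pi * Complex.I * (∑ j, k j * t j : ℝ))) * g t) :
    ∑' m : ι → ℤ, g (fun j => (m j : ℝ)) =
      ∑' k : ι → ℤ, ∫ t : ι → ℝ,
        Complex.exp (-(2 * Real.pi * Complex.I * (∑ j, k j * t j : ℝ))) * g t := by
  obtain ⟨G, hG⟩ := exists_periodize_lift hc hcont hg
  have hmono : ∀ (k : ι → ℤ) (t : ι → ℝ),
      UnitAddTorus.mFourier (-k) (fun j => (t j : UnitAddCircle)) =
        Complex.exp (-(2 * Real.pi * Complex.I * (∑ j, k j * t j : ℝ))) := by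
    intro k t
    simp only [UnitAddTorus.mFourier, ContinuousMap.coe_mk, fourier_coe_apply]
    rw [← Complex.exp_sum]
    congr 1
    rw [Complex.ofReal_sum, Finset.mul_sum, ← Finset.sum_neg_distrib]
    refine Finset.sum_congr rfl fun j _ => ?_
    simp
    ring
  have hcoeff : ∀ k : ι → ℤ, UnitAddTorus.mFourierCoeff G k =
      ∫ t : ι → ℝ, Complex.exp (-(2 * Real.pi * Complex.I * (∑ j, k j * t j : ℝ))) * g t := by
    intro k
    rw [UnitAddTorus.mFourierCoeff_eq_integral G k 0,
      ← setIntegral_periodize (g := fun t : ι → ℝ =>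
        Complex.exp (-(2 * Real.pi * Complex.I * (∑ j, k j * t j : ℝ))) * g t) (K := K) hc
        (by fun_prop) ?_]
    · refine integral_congr_ae (ae_of_all _ fun t => ?_)
      simp only [hG, smul_eq_mul, hmono]
      unfold periodize
      rw [← tsum_mul_left]
      refine tsum_congr fun m => ?_
      congr 1
      refine Complex.exp_eq_exp_iff_exists_int.2 ⟨∑ j, k j * m j, ?_⟩
      push_cast [Pi.add_apply, mul_add, Finset.sum_add_distrib]
      ring
    · intro t
      rw [norm_mul]
      have : ‖Complex.exp (-(2 * Real.pi * Complex.I * (∑ j, k j * t j : ℝ)))‖ = 1 := by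
        have h : -(2 * Real.pi * Complex.I * (∑ j, k j * t j : ℝ)) =
            ((-(2 * Real.pi * ∑ j, (k j : ℝ) * t j) : ℝ) : ℂ) * Complex.I := by
          push_cast; ring
        rw [h, Complex.norm_exp_ofReal_mul_I]
      rw [this, one_mul]
      exact hg t
  have hs : Summable (UnitAddTorus.mFourierCoeff G) := by
    rw [show UnitAddTorus.mFourierCoeff G = _ from funext hcoeff]
    exact hsum
  have h := (UnitAddTorus.hasSum_mFourier_series_apply_of_summable hs
    (fun _ => ((0 : ℝ) : UnitAddCircle))).tsum_eq
  rw [hG] at h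
  have h0 : periodize g (fun _ => 0) = ∑' m : ι → ℤ, g (fun j => (m j : ℝ)) := by
    unfold periodize
    refine tsum_congr fun m => ?_
    congr 1
    ext j
    simp
  rw [← h0, ← h]
  refine tsum_congr fun k => ?_
  have h1 := hmono (-k) 0
  simp only [neg_neg, Pi.zero_apply, Complex.ofReal_zero, mul_zero, Finset.sum_const_zero,
    neg_zero, Complex.exp_zero] at h1
  rw [hcoeff, h1, smul_eq_mul, mul_one]

end Poisson

/-! ### Theta inversion for self-dual lattices -/

section LatticeTheta

set_option linter.unusedSectionVars false

open MeasureTheory Matrix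

variable {ι : Type*} [Fintype ι]

theorem exists_pos_le_re (b : ι → ℂ) (hb : ∀ j, 0 < (b j).re) : ∃ β > (0 : ℝ), ∀ j, β ≤ (b j).re := by
  rcases isEmpty_or_nonempty ι with h | h
  · exact ⟨1, one_pos, fun j => isEmptyElim j⟩
  · obtain ⟨j₀, hj₀⟩ := Finite.exists_min fun j => (b j).re
    exact ⟨_, hb j₀, hj₀⟩

/-- The Gaussian `exp(-π ∑ b_j x_j²)` with complex parameters `b_j`. -/
noncomputable def gauss (b : ι → ℂ) (x : ι → ℝ) : ℂ :=
  Complex.exp (-Real.pi * ∑ j, b j * (x j : ℂ) ^ 2)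

theorem norm_gauss (b : ι → ℂ) (x : ι → ℝ) :
    ‖gauss b x‖ = Real.exp (-Real.pi * ∑ j, (b j).re * x j ^ 2) := by
  rw [gauss, Complex.norm_exp, ← Complex.ofReal_neg, Complex.re_ofReal_mul, Complex.re_sum]
  congr 2
  refine Finset.sum_congr rfl fun j _ => ?_
  rw [← Complex.ofReal_pow, mul_comm, Complex.re_ofReal_mul, mul_comm]

theorem norm_gauss_le {b : ι → ℂ} {β : ℝ} (hβ : ∀ j, β ≤ (b j).re) (x : ι → ℝ) :
    ‖gauss b x‖ ≤ Real.exp (-(Real.pi * β) * ∑ j, x j ^ 2) := by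
  rw [norm_gauss, Real.exp_le_exp, neg_mul, neg_mul, neg_le_neg_iff, mul_assoc]
  refine mul_le_mul_of_nonneg_left ?_ Real.pi_pos.le
  rw [Finset.mul_sum]
  exact Finset.sum_le_sum fun j _ => mul_le_mul_of_nonneg_right (hβ j) (sq_nonneg _)

theorem summable_gauss (L : Submodule ℤ (ι → ℝ)) [DiscreteTopology L] {b : ι → ℂ}
    (hb : ∀ j, 0 < (b j).re) : Summable fun x : L => gauss b (x : ι → ℝ) := by
  obtain ⟨β, hβ, h⟩ := exists_pos_le_re b hb
  exact Summable.of_norm_bounded (summable_exp_neg_sum_sq L (c := Real.pi * β) (by positivity))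
    fun x => norm_gauss_le h _

variable [DecidableEq ι]

theorem gauss_mulVec_le {A : Matrix ι ι ℝ} (hA : IsUnit A.det) {b : ι → ℂ}
    (hb : ∀ j, 0 < (b j).re) :
    ∃ c > (0 : ℝ), ∀ t, ‖gauss b (A *ᵥ t)‖ ≤ 1 * Real.exp (-c * ∑ j, t j ^ 2) := by
  obtain ⟨β, hβ, h⟩ := exists_pos_le_re b hb
  set N : ℝ := ∑ i, ∑ j, A⁻¹ i j ^ 2
  have hN : 0 ≤ N := Finset.sum_nonneg fun i _ => Finset.sum_nonneg fun j _ => sq_nonneg _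
  refine ⟨Real.pi * β / (N + 1), by positivity, fun t => (norm_gauss_le h _).trans ?_⟩
  rw [one_mul, Real.exp_le_exp, neg_mul, neg_mul, neg_le_neg_iff, div_mul_eq_mul_div,
    div_le_iff₀ (show (0 : ℝ) < N + 1 by positivity), mul_assoc (Real.pi * β)]
  refine mul_le_mul_of_nonneg_left ?_ (mul_pos Real.pi_pos hβ).le
  have h1 : A⁻¹ *ᵥ (A *ᵥ t) = t := by
    rw [mulVec_mulVec, nonsing_inv_mul _ hA, one_mulVec]
  have h2 : ∑ i, t i ^ 2 ≤ N * ∑ j, (A *ᵥ t) j ^ 2 := by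
    rw [Finset.sum_mul]
    refine Finset.sum_le_sum fun i _ => ?_
    conv_lhs => rw [← h1]
    exact Finset.sum_mul_sq_le_sq_mul_sq _ _ _
  have h3 : 0 ≤ ∑ j, (A *ᵥ t) j ^ 2 := Finset.sum_nonneg fun j _ => sq_nonneg _
  nlinarith

theorem integral_fourier_gauss_mulVec {A : Matrix ι ι ℝ} (hA : IsUnit A.det) {b : ι → ℂ}
    (hb : ∀ j, 0 < (b j).re) (k : ι → ℤ) :
    ∫ t : ι → ℝ, Complex.exp (-(2 * Real.pi * Complex.I * (∑ j, k j * t j : ℝ))) *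
        gauss b (A *ᵥ t) =
      |A.det|⁻¹ * ((∏ j, (1 / b j) ^ (1 / 2 : ℂ)) *
        gauss (fun j => 1 / b j) ((fun i => (k i : ℝ)) ᵥ* A⁻¹)) := by
  set ξ : ι → ℝ := (fun i => (k i : ℝ)) ᵥ* A⁻¹
  set f : (ι → ℝ) → ℂ := fun x => Complex.exp (-∑ j, (Real.pi * b j) * (x j : ℂ) ^ 2 +
    ∑ j, (-2 * Real.pi * Complex.I * ξ j) * x j)
  have h1 : ∀ t : ι → ℝ, Complex.exp (-(2 * Real.pi * Complex.I * (∑ j, k j * t j : ℝ))) *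
      gauss b (A *ᵥ t) = f (A *ᵥ t) := by
    intro t
    have h2 : (∑ j, k j * t j : ℝ) = ξ ⬝ᵥ (A *ᵥ t) := by
      rw [dotProduct_mulVec, vecMul_vecMul, nonsing_inv_mul _ hA, vecMul_one]
      rfl
    rw [gauss, ← Complex.exp_add, h2]
    congr 1
    simp only [dotProduct, Complex.ofReal_sum, Complex.ofReal_mul, Finset.mul_sum]
    rw [add_comm, ← Finset.sum_neg_distrib, ← Finset.sum_neg_distrib]
    congr 1 <;> refine Finset.sum_congr rfl fun j _ => by ring
  simp only [h1]
  have h3 : ∫ t : ι → ℝ, f (A *ᵥ t) = |A.det|⁻¹ * ∫ x, f x := by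
    have hm := Real.map_matrix_volume_pi_eq_smul_volume_pi (M := A) hA.ne_zero
    have hmeas : AEMeasurable (toLin' A) (volume : Measure (ι → ℝ)) :=
      (toLin' A).continuous_of_finiteDimensional.measurable.aemeasurable
    have hf : Continuous f := by fun_prop
    have := integral_map hmeas (f := f) hf.aestronglyMeasurable
    rw [hm, integral_smul_measure] at this
    simp only [toLin'_apply] at this
    rw [← this, ENNReal.toReal_ofReal (abs_nonneg _), abs_inv, Complex.real_smul]
  rw [h3, GaussianFourier.integral_cexp_neg_sum_mul_add
    (fun j => by simpa using mul_pos Real.pi_pos (hb j)), Finset.prod_mul_distrib, gauss,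
    Finset.mul_sum, Complex.exp_sum]
  have hpi : (Real.pi : ℂ) ≠ 0 := by exact_mod_cast Real.pi_ne_zero
  have h0 : ∀ j, b j ≠ 0 := fun j h0 => by have := hb j; simp [h0] at this
  have h4 : ∀ j, (Real.pi : ℂ) / (Real.pi * b j) = 1 / b j := fun j => by
    have := h0 j
    field_simp
  have h5 : ∀ j, (-2 * Real.pi * Complex.I * ξ j) ^ 2 / (4 * (Real.pi * b j)) =
      -Real.pi * (1 / b j * (ξ j : ℂ) ^ 2) := fun j => by
    have := h0 j
    field_simp
    rw [Complex.I_sq]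
    ring
  simp only [h4, h5]

/-- Integer matrices `AᵀA` and `A⁻¹A⁻ᵀ` force `|det A| = 1`. -/
theorem abs_det_eq_one {A : Matrix ι ι ℝ} (hA : IsUnit A.det)
    (h1 : ∀ i j, ∃ m : ℤ, (Aᵀ * A) i j = m) (h2 : ∀ i j, ∃ m : ℤ, (A⁻¹ * A⁻¹ᵀ) i j = m) :
    |A.det| = 1 := by
  have key : ∀ B : Matrix ι ι ℝ, (∀ i j, ∃ m : ℤ, B i j = m) → ∃ m : ℤ, B.det = m := by
    intro B hB
    choose m hm using hB
    refine ⟨(Matrix.of m).det, ?_⟩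
    have : B = (Int.castRingHom ℝ).mapMatrix (Matrix.of m) := by
      ext i j
      simp [hm]
    rw [this, ← RingHom.map_det]
    rfl
  obtain ⟨m, hm⟩ := key _ h1
  obtain ⟨m', hm'⟩ := key _ h2
  rw [det_mul, det_transpose] at hm hm'
  rw [det_nonsing_inv, Ring.inverse_eq_inv'] at hm'
  have h0 := hA.ne_zero
  have hmm : m * m' = 1 := by
    have : (m : ℝ) * m' = 1 := by
      rw [← hm, ← hm']
      field_simp
    exact_mod_cast this
  have hpos : 0 ≤ m := by
    have : (0 : ℝ) ≤ m := by rw [← hm]; exact mul_self_nonneg _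
    exact_mod_cast this
  have hm1 : m = 1 := by
    rcases Int.eq_one_or_neg_one_of_mul_eq_one hmm with h | h <;> omega
  rw [hm1, Int.cast_one, ← abs_mul_abs_self] at hm
  nlinarith [abs_nonneg A.det]

/-- The theta inversion formula for a lattice that is self-dual for the dot product. -/
theorem tsum_gauss_of_selfDual (L : Submodule ℤ (ι → ℝ)) [DiscreteTopology L] [IsZLattice ℝ L]
    (hL : ∀ y, y ∈ L ↔ ∀ x ∈ L, ∃ m : ℤ, x ⬝ᵥ y = m) {b : ι → ℂ} (hb : ∀ j, 0 < (b j).re) :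
    ∑' x : L, gauss b (x : ι → ℝ) =
      (∏ j, (1 / b j) ^ (1 / 2 : ℂ)) * ∑' x : L, gauss (fun j => 1 / b j) (x : ι → ℝ) := by
  have : Module.Free ℤ L := ZLattice.module_free ℝ L
  have : Module.Finite ℤ L := ZLattice.module_finite ℝ L
  let e : Module.Basis ι ℤ L := IsZLattice.basis L
  let E : Module.Basis ι ℝ (ι → ℝ) := e.ofZLatticeBasis ℝ L
  have hE : ∀ i, E i = (e i : ι → ℝ) := e.ofZLatticeBasis_apply ℝ L
  set A : Matrix ι ι ℝ := (Pi.basisFun ℝ ι).toMatrix E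
  have hAe : ∀ j i, A j i = (e i : ι → ℝ) j := by
    intro j i
    simp [A, Module.Basis.toMatrix_apply, hE]
  have hA : IsUnit A.det := by
    have : Invertible A := (Pi.basisFun ℝ ι).invertibleToMatrix E
    exact A.isUnit_det_of_invertible
  have hAt : ∀ k : ι → ℤ, A *ᵥ (fun i => (k i : ℝ)) = (e.equivFun.symm k : ι → ℝ) := by
    intro k
    ext j
    simp [mulVec, dotProduct, hAe, Module.Basis.equivFun_symm_apply, mul_comm]
  have hrow : ∀ i, A⁻¹ i ∈ L := by
    intro i
    rw [hL]
    intro x hx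
    obtain ⟨k, hk⟩ := e.equivFun.symm.surjective ⟨x, hx⟩
    refine ⟨k i, ?_⟩
    have : x = A *ᵥ (fun i => (k i : ℝ)) := by rw [hAt, hk]
    rw [this, dotProduct_comm]
    have h3 : A⁻¹ *ᵥ (A *ᵥ (fun i => (k i : ℝ))) = fun i => (k i : ℝ) := by
      rw [mulVec_mulVec, nonsing_inv_mul _ hA, one_mulVec]
    exact congrFun h3 i
  -- the Gram matrices of `e` and of its dual basis are both integral
  have hdet : |A.det| = 1 := by
    refine abs_det_eq_one hA (fun i j => ?_) (fun i j => ?_)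
    · obtain ⟨m, hm⟩ := (hL _).1 (e j).2 _ (e i).2
      refine ⟨m, ?_⟩
      rw [← hm]
      simp [mul_apply, dotProduct, hAe]
    · obtain ⟨m, hm⟩ := (hL _).1 (hrow j) _ (hrow i)
      exact ⟨m, hm⟩
  -- the dual basis of `e` enumerates the dual lattice, which is `L` itself
  let D : (ι → ℤ) ≃ L := Equiv.ofBijective
    (fun k => ⟨(fun i => (k i : ℝ)) ᵥ* A⁻¹, by
      rw [vecMul_eq_sum]
      exact L.sum_mem fun i _ => by
        rw [show (k i : ℝ) • A⁻¹ i = k i • A⁻¹ i from Int.cast_smul_eq_zsmul ℝ (k i) (A⁻¹ i)]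
        exact L.smul_mem _ (hrow i)⟩) (by
    constructor
    · intro k k' h
      have h1 : (fun i => (k i : ℝ)) ᵥ* A⁻¹ = (fun i => (k' i : ℝ)) ᵥ* A⁻¹ := congrArg Subtype.val h
      have h2 := congrArg (· ᵥ* A) h1
      simp only [vecMul_vecMul, nonsing_inv_mul _ hA, vecMul_one] at h2
      ext i
      exact_mod_cast congrFun h2 i
    · rintro ⟨y, hy⟩
      choose k hk using fun i => (hL y).1 hy _ (e i).2
      refine ⟨k, Subtype.ext ?_⟩
      have h1 : (fun i => (k i : ℝ)) = y ᵥ* A := by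
        ext i
        rw [← hk i, dotProduct_comm]
        simp [vecMul, dotProduct, hAe]
      simp only [h1, vecMul_vecMul, mul_nonsing_inv _ hA, vecMul_one])
  have hD : ∀ k, (D k : ι → ℝ) = (fun i => (k i : ℝ)) ᵥ* A⁻¹ := fun k => rfl
  have hb' : ∀ j, 0 < (1 / b j).re := by
    intro j
    have h0 : b j ≠ 0 := fun h0 => by have := hb j; simp [h0] at this
    rw [one_div, Complex.inv_re]
    exact div_pos (hb j) (Complex.normSq_pos.2 h0)
  obtain ⟨c, hc, hbound⟩ := gauss_mulVec_le hA hb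
  have hint := integral_fourier_gauss_mulVec hA hb
  simp only [hdet, inv_one, Complex.ofReal_one, one_mul, ← hD] at hint
  have hP := tsum_int_eq_tsum_fourier hc (g := fun t => gauss b (A *ᵥ t))
    (by unfold gauss; simp only [mulVec, dotProduct]; fun_prop) hbound (by
      simp only [hint]
      exact (D.summable_iff.2 (summable_gauss L hb')).mul_left _)
  simp only [hint, hAt] at hP
  rw [tsum_mul_left, D.tsum_eq (fun x : L => gauss (fun j => 1 / b j) (x : ι → ℝ))] at hP
  rw [← hP, ← e.equivFun.symm.toEquiv.tsum_eq]
  rfl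

end LatticeTheta

/-! ### The trace form on `𝕆` and its reduction modulo `ℙ` -/

section TraceForm

variable {p : ℕ} [Fact p.Prime] {n : ℕ}

noncomputable section

/-- The trace form `Tr_{F/ℚ}(x ȳ)` on `𝕆`, as a sum over the embeddings. -/
def trForm (x y : O p) : ℂ :=
  ∑ l, sigma p l (x : F p) * (starRingEnd ℂ) (sigma p l (y : F p))

theorem trForm_add_left (x x' y : O p) : trForm (x + x') y = trForm x y + trForm x' y := by
  simp [trForm, add_mul, Finset.sum_add_distrib]

theorem trForm_add_right (x y y' : O p) : trForm x (y + y') = trForm x y + trForm x y' := by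
  simp [trForm, mul_add, Finset.sum_add_distrib]

theorem trForm_zsmul_left (k : ℤ) (x y : O p) : trForm (k • x) y = k * trForm x y := by
  simp [trForm, Finset.mul_sum, mul_assoc]

theorem trForm_zsmul_right (k : ℤ) (x y : O p) : trForm x (k • y) = k * trForm x y := by
  simp [trForm, Finset.mul_sum, mul_left_comm]

theorem trForm_sub_left (x x' y : O p) : trForm (x - x') y = trForm x y - trForm x' y := by
  simp [trForm, sub_mul, Finset.sum_sub_distrib]

theorem coe_zetaInt : ((zetaInt p : O p) : F p) = zeta p := rfl

theorem sigma_zeta_eq_pow (l : Fin (p - 1)) :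
    sigma p l (zeta p) = Complex.exp (2 * Real.pi * Complex.I / p) ^ ((l : ℕ) + 1) := by
  rw [sigma_zeta, ← Complex.exp_nat_mul]
  congr 1
  push_cast
  ring

theorem sum_fin_pow (u : ℂ) (hu : u ^ p = 1) :
    ∑ l : Fin (p - 1), u ^ ((l : ℕ) + 1) = if u = 1 then (p : ℂ) - 1 else -1 := by
  have hp := (Fact.out : p.Prime).one_lt
  rw [Fin.sum_univ_eq_sum_range (fun l => u ^ (l + 1)) (p - 1)]
  have h : ∑ l ∈ Finset.range p, u ^ l = ∑ l ∈ Finset.range (p - 1), u ^ (l + 1) + 1 := by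
    conv_lhs => rw [← Nat.sub_add_cancel hp.le, Finset.sum_range_succ', pow_zero]
  split_ifs with h1
  · subst h1
    simp only [one_pow, Finset.sum_const, Finset.card_range, nsmul_eq_mul, mul_one] at h ⊢
    rw [h]; ring
  · have := mul_geom_sum u p
    rw [hu, sub_self] at this
    have h2 := (mul_eq_zero.1 this).resolve_left (sub_ne_zero.2 h1)
    rw [h] at h2
    linear_combination h2

theorem trForm_zeta_pow (i j : ℕ) :
    trForm (zetaInt p ^ i) (zetaInt p ^ j) =
      if i ≡ j [MOD p] then (p : ℂ) - 1 else -1 := by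
  have hp := (Fact.out : p.Prime)
  set w := Complex.exp (2 * Real.pi * Complex.I / p) with hw
  have hprim : IsPrimitiveRoot w p := Complex.isPrimitiveRoot_exp p hp.ne_zero
  have hconj : (starRingEnd ℂ) w = w⁻¹ := by
    rw [← Complex.inv_eq_conj]
    exact hprim.norm'_eq_one hp.ne_zero
  have h0 : w ≠ 0 := hprim.ne_zero hp.ne_zero
  have h1 : ∀ l : Fin (p - 1), sigma p l ((zetaInt p ^ i : O p) : F p) *
      (starRingEnd ℂ) (sigma p l ((zetaInt p ^ j : O p) : F p)) =
        (w ^ i * w⁻¹ ^ j) ^ ((l : ℕ) + 1) := by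
    intro l
    simp only [map_pow]
    rw [← NumberField.RingOfIntegers.coe_eq_algebraMap, coe_zetaInt, sigma_zeta_eq_pow, ← hw,
      map_pow, hconj]
    ring
  have h2 : (w ^ i * w⁻¹ ^ j) ^ p = 1 := by
    rw [mul_pow, ← pow_mul, ← pow_mul, mul_comm i, mul_comm j, pow_mul, pow_mul, inv_pow w p,
      hprim.pow_eq_one]
    simp
  have h3 : w ^ i * w⁻¹ ^ j = 1 ↔ i ≡ j [MOD p] := by
    rw [inv_pow, mul_inv_eq_one₀ (pow_ne_zero _ h0), ← (hprim.isUnit hp.ne_zero).unit_spec,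
      ← Units.val_pow_eq_pow_val, ← Units.val_pow_eq_pow_val, Units.val_inj, pow_eq_pow_iff_modEq,
      ← (hprim.isUnit_unit hp.ne_zero).eq_orderOf]
  unfold trForm
  simp only [h1]
  rw [sum_fin_pow _ h2]
  simp only [h3]

theorem span_zeta_pow :
    Submodule.span ℤ (Set.range fun j : Fin (p - 1) => zetaInt p ^ (j : ℕ)) = ⊤ := by
  have hp := (Fact.out : p.Prime)
  have hdim : (zeta_spec p).integralPowerBasis.dim = p - 1 := by
    rw [IsPrimitiveRoot.integralPowerBasis_dim, Nat.totient_prime hp]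
  rw [eq_top_iff, ← (zeta_spec p).integralPowerBasis.basis.span_eq]
  refine Submodule.span_mono ?_
  rintro _ ⟨j, rfl⟩
  refine ⟨Fin.cast hdim j, ?_⟩
  rw [PowerBasis.basis_eq_pow, IsPrimitiveRoot.integralPowerBasis_gen]
  rfl

/-- The trace form is integral, and modulo `p` it is minus the product of the reductions. -/
theorem exists_int_trForm (x y : O p) :
    ∃ m : ℤ, trForm x y = m ∧ (m : ZMod p) = -(rho p x * rho p y) := by
  have hx : x ∈ Submodule.span ℤ (Set.range fun j : Fin (p - 1) => zetaInt p ^ (j : ℕ)) := by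
    rw [span_zeta_pow]; trivial
  have hy : y ∈ Submodule.span ℤ (Set.range fun j : Fin (p - 1) => zetaInt p ^ (j : ℕ)) := by
    rw [span_zeta_pow]; trivial
  induction hx using Submodule.span_induction with
  | mem x hx =>
    obtain ⟨i, rfl⟩ := hx
    induction hy using Submodule.span_induction with
    | mem y hy =>
      obtain ⟨j, rfl⟩ := hy
      simp only [trForm_zeta_pow, map_pow, rho_zeta, one_pow, mul_one]
      split_ifs
      · exact ⟨p - 1, by push_cast; ring, by push_cast; simp⟩
      · exact ⟨-1, by push_cast; ring, by push_cast; simp⟩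
    | zero => exact ⟨0, by simp [trForm], by simp⟩
    | add y y' _ _ h h' =>
      obtain ⟨m, hm, hm'⟩ := h
      obtain ⟨k, hk, hk'⟩ := h'
      refine ⟨m + k, ?_, ?_⟩
      · rw [trForm_add_right, hm, hk]; push_cast; ring
      · push_cast; rw [hm', hk', map_add]; ring
    | smul c y _ h =>
      obtain ⟨m, hm, hm'⟩ := h
      refine ⟨c * m, ?_, ?_⟩
      · rw [trForm_zsmul_right, hm]; push_cast; ring
      · push_cast; rw [hm', zsmul_eq_mul, map_mul, map_intCast]; ring
  | zero => exact ⟨0, by simp [trForm], by simp⟩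
  | add x x' _ _ h h' =>
    obtain ⟨m, hm, hm'⟩ := h
    obtain ⟨k, hk, hk'⟩ := h'
    refine ⟨m + k, ?_, ?_⟩
    · rw [trForm_add_left, hm, hk]; push_cast; ring
    · push_cast; rw [hm', hk', map_add]; ring
  | smul c x _ h =>
    obtain ⟨m, hm, hm'⟩ := h
    refine ⟨c * m, ?_, ?_⟩
    · rw [trForm_zsmul_left, hm]; push_cast; ring
    · push_cast; rw [hm', zsmul_eq_mul, map_mul, map_intCast]; ring

theorem form_emb_eq_sum_trForm (x y : Fin n → O p) :
    form (emb x) (emb y) = (∑ i, trForm (x i) (y i)) / p := by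
  rw [form_emb, Finset.sum_div]
  refine Finset.sum_congr rfl fun i _ => ?_
  rw [trForm, Finset.sum_div]

theorem exists_int_form (x y : Fin n → O p) :
    ∃ m : ℤ, form (emb x) (emb y) = m / p ∧
      (m : ZMod p) = -((fun i => rho p (x i)) ⬝ᵥ (fun i => rho p (y i))) := by
  choose m hm hm' using fun i => exists_int_trForm (x i) (y i)
  refine ⟨∑ i, m i, ?_, ?_⟩
  · rw [form_emb_eq_sum_trForm]
    push_cast
    simp only [hm]
  · push_cast
    simp only [hm', dotProduct, Finset.sum_neg_distrib]

/-- The form is integral on a pair of vectors of `𝕆^n` exactly when their reductions modulo `ℙ` are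
orthogonal. -/
theorem exists_int_form_iff (x y : Fin n → O p) :
    (∃ m : ℤ, form (emb x) (emb y) = m) ↔
      (fun i => rho p (x i)) ⬝ᵥ (fun i => rho p (y i)) = 0 := by
  have h0 : (p : ℂ) ≠ 0 := by exact_mod_cast (Fact.out : p.Prime).ne_zero
  obtain ⟨m, hm, hm'⟩ := exists_int_form x y
  rw [← neg_eq_zero, ← hm', ZMod.intCast_zmod_eq_zero_iff_dvd, hm]
  constructor
  · rintro ⟨k, hk⟩
    rw [div_eq_iff h0] at hk
    refine ⟨k, ?_⟩
    have : ((m : ℤ) : ℂ) = ((p * k : ℤ) : ℂ) := by rw [hk]; push_cast; ring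
    exact_mod_cast this
  · rintro ⟨k, rfl⟩
    refine ⟨k, ?_⟩
    push_cast
    field_simp

/-! ### The lattice `ρ⁻¹(C)` in Euclidean space -/

/-- Real coordinates on `𝕆^n` in which the form `⟨x, y⟩` is the dot product. The coordinates
`(Re + Im)(σ_l(x_i)) / √p`, one for each embedding, do this because the mixed terms
`Re σ_l(x) Im σ_l(y)` cancel between `l` and its conjugate. -/
def embR : (Fin n → O p) →ₗ[ℤ] (Idx p n → ℝ) where
  toFun x a := ((sigma p a.2 (x a.1 : F p)).re + (sigma p a.2 (x a.1 : F p)).im) / Real.sqrt p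
  map_add' x y := by
    ext a
    simp
    ring
  map_smul' k x := by
    ext a
    simp
    ring

theorem embR_apply (x : Fin n → O p) (a : Idx p n) : embR x a =
    ((sigma p a.2 (x a.1 : F p)).re + (sigma p a.2 (x a.1 : F p)).im) / Real.sqrt p := rfl

theorem embR_mul_embR (x y : Fin n → O p) (a : Idx p n) : embR x a * embR y a =
    ((sigma p a.2 (x a.1 : F p)).re + (sigma p a.2 (x a.1 : F p)).im) *
      ((sigma p a.2 (y a.1 : F p)).re + (sigma p a.2 (y a.1 : F p)).im) / p := by
  rw [embR_apply, embR_apply, div_mul_div_comm, Real.mul_self_sqrt (Nat.cast_nonneg p)]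

theorem sum_eq_zero_of_rev_neg {R : Type*} [AddCommGroup R] [IsAddTorsionFree R] {N : ℕ}
    (g : Fin N → R) (hg : ∀ l, g (Fin.rev l) = -g l) : ∑ l, g l = 0 := by
  have h := Equiv.sum_comp Fin.revPerm g
  simp only [Fin.revPerm_apply, hg, Finset.sum_neg_distrib] at h
  exact self_eq_neg.1 h.symm

theorem embR_dotProduct (x y : Fin n → O p) :
    ((embR x ⬝ᵥ embR y : ℝ) : ℂ) = form (emb x) (emb y) := by
  rw [form_emb, dotProduct, Fintype.sum_prod_type, Complex.ofReal_sum]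
  refine Finset.sum_congr rfl fun i _ => ?_
  rw [Complex.ofReal_sum, ← sub_eq_zero, ← Finset.sum_sub_distrib]
  refine sum_eq_zero_of_rev_neg _ fun l => ?_
  simp only [embR_mul_embR, sigma_rev, Complex.conj_conj]
  refine Complex.ext ?_ ?_ <;>
  simp <;> ring

end

end TraceForm

section CodeLattice

variable {p : ℕ} [Fact p.Prime] {n : ℕ}

noncomputable section

open Matrix

/-- The lattice `ρ⁻¹(C) ⊂ 𝕆^n` of a code `C`. -/
def codeLattice (C : Submodule (ZMod p) (Fin n → ZMod p)) : Submodule ℤ (Fin n → O p) where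
  carrier := {x | (fun i => rho p (x i)) ∈ C}
  add_mem' {x y} hx hy := by
    have := C.add_mem hx hy
    simpa [Pi.add_def] using this
  zero_mem' := by
    have := C.zero_mem
    simpa [Pi.zero_def] using this
  smul_mem' k x hx := by
    have := C.smul_mem (k : ZMod p) hx
    simpa [Pi.smul_def] using this

theorem mem_codeLattice {C : Submodule (ZMod p) (Fin n → ZMod p)} {x : Fin n → O p} :
    x ∈ codeLattice C ↔ (fun i => rho p (x i)) ∈ C := Iff.rfl

theorem smul_mem_codeLattice {C : Submodule (ZMod p) (Fin n → ZMod p)} {x : Fin n → O p}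
    (b : O p) (hx : x ∈ codeLattice C) : (fun i => b * x i) ∈ codeLattice C := by
  have := C.smul_mem (rho p b) hx
  simpa [mem_codeLattice, Pi.smul_def] using this

/-- The image of `ρ⁻¹(C)` in Euclidean space. -/
def realLattice (C : Submodule (ZMod p) (Fin n → ZMod p)) : Submodule ℤ (Idx p n → ℝ) :=
  (codeLattice C).map embR

/-- The `ℤ`-basis of `𝕆^n` formed by `ζ^j`, `0 ≤ j < p - 1`, in each coordinate. -/
def powVec (a : Idx p n) : Fin n → O p := Pi.single a.1 (zetaInt p ^ (a.2 : ℕ))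

/-- The basis of `ℙ^n` formed by `ζ^j - ζ⁻¹`, `0 ≤ j < p - 1`, in each coordinate. With respect to the
form it is dual to the basis of `𝕆^n` formed by `ζ^j`. -/
def dualVec (a : Idx p n) : Fin n → O p :=
  Pi.single a.1 (zetaInt p ^ (a.2 : ℕ) - zetaInt p ^ (p - 1))

theorem rho_dualVec (a : Idx p n) (i : Fin n) : rho p (dualVec a i) = 0 := by
  unfold dualVec
  by_cases h : i = a.1
  · subst h
    simp [rho_zeta]
  · simp [Pi.single_eq_of_ne h]

theorem trForm_dual (i j : Fin (p - 1)) :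
    trForm (zetaInt p ^ (i : ℕ) - zetaInt p ^ (p - 1)) (zetaInt p ^ (j : ℕ)) =
      if i = j then (p : ℂ) else 0 := by
  have hi := i.2
  have hj := j.2
  rw [trForm_sub_left, trForm_zeta_pow, trForm_zeta_pow]
  have h1 : ¬ (p - 1 ≡ (j : ℕ) [MOD p]) := by
    rw [Nat.ModEq, Nat.mod_eq_of_lt (by omega), Nat.mod_eq_of_lt (by omega)]
    omega
  have h2 : (i : ℕ) ≡ (j : ℕ) [MOD p] ↔ i = j := by
    rw [Nat.ModEq, Nat.mod_eq_of_lt (by omega), Nat.mod_eq_of_lt (by omega), Fin.ext_iff]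
  simp only [h1, h2, if_false]
  split_ifs <;> ring

theorem embR_dualVec_dotProduct (a b : Idx p n) :
    embR (dualVec a) ⬝ᵥ embR (powVec b) = if a = b then 1 else 0 := by
  have h0 : (p : ℂ) ≠ 0 := by exact_mod_cast (Fact.out : p.Prime).ne_zero
  have h : ((embR (dualVec a) ⬝ᵥ embR (powVec b) : ℝ) : ℂ) = if a = b then 1 else 0 := by
    rw [embR_dotProduct, form_emb_eq_sum_trForm, Finset.sum_eq_single a.1]
    · simp only [dualVec, powVec, Pi.single_eq_same]
      by_cases h : a.1 = b.1
      · rw [h, Pi.single_eq_same, trForm_dual]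
        simp only [Prod.ext_iff, h, true_and]
        split_ifs <;> simp [h0]
      · rw [Pi.single_eq_of_ne h]
        simp [trForm, Prod.ext_iff, h]
    · intro i _ hi
      simp [trForm, dualVec, Pi.single_eq_of_ne hi]
    · simp
  split_ifs at h ⊢ <;> exact_mod_cast h

/-- The matrix whose columns are the images of the vectors `powVec` in Euclidean space. -/
def powMat (p n : ℕ) [Fact p.Prime] : Matrix (Idx p n) (Idx p n) ℝ :=
  of fun a b => embR (powVec b) a

/-- The matrix whose rows are the images of the vectors `dualVec` in Euclidean space. -/
def dualMat (p n : ℕ) [Fact p.Prime] : Matrix (Idx p n) (Idx p n) ℝ :=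
  of fun a => embR (dualVec a)

theorem dualMat_mul_powMat : dualMat p n * powMat p n = 1 := by
  ext a b
  rw [one_apply, ← embR_dualVec_dotProduct]
  rfl

theorem powMat_mul_dualMat : powMat p n * dualMat p n = 1 :=
  mul_eq_one_comm.1 dualMat_mul_powMat

/-- The real basis of Euclidean space formed by the `ℤ`-basis of `𝕆^n`. -/
def powBasis (p n : ℕ) [Fact p.Prime] : Module.Basis (Idx p n) ℝ (Idx p n → ℝ) :=
  (Pi.basisFun ℝ (Idx p n)).map (LinearEquiv.ofLinearMap (toLin' (powMat p n)) (toLin' (dualMat p n))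
    (by rw [← toLin'_mul, powMat_mul_dualMat, toLin'_one])
    (by rw [← toLin'_mul, dualMat_mul_powMat, toLin'_one]))

theorem powBasis_apply (a : Idx p n) : powBasis p n a = embR (powVec a) := by
  simp only [powBasis, Module.Basis.map_apply, Pi.basisFun_apply, LinearEquiv.coe_ofLinearMap,
    toLin'_apply, mulVec_single_one]
  rfl

theorem eq_sum_dotProduct_smul (y : Idx p n → ℝ) :
    y = ∑ a, (embR (dualVec a) ⬝ᵥ y) • embR (powVec a) := by
  have h : y = powMat p n *ᵥ (dualMat p n *ᵥ y) := by
    rw [mulVec_mulVec, powMat_mul_dualMat, one_mulVec]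
  conv_lhs => rw [h]
  ext b
  simp only [mulVec, dotProduct, Finset.sum_apply, Pi.smul_apply, smul_eq_mul]
  exact Finset.sum_congr rfl fun a _ => mul_comm _ _

/-- A real vector that pairs integrally with `ℙ^n` lies in `𝕆^n`. -/
theorem exists_embR_eq {y : Idx p n → ℝ} (hy : ∀ a, ∃ m : ℤ, embR (dualVec a) ⬝ᵥ y = m) :
    ∃ x : Fin n → O p, embR x = y := by
  choose m hm using hy
  refine ⟨∑ a, m a • powVec a, ?_⟩
  rw [map_sum, eq_sum_dotProduct_smul y]
  refine Finset.sum_congr rfl fun a _ => ?_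
  rw [map_zsmul, hm, Int.cast_smul_eq_zsmul]

theorem embR_injective : Function.Injective (embR : (Fin n → O p) →ₗ[ℤ] (Idx p n → ℝ)) := by
  have hp := (Fact.out : p.Prime)
  refine (injective_iff_map_eq_zero _).2 fun x hx => ?_
  ext i
  have h : form (emb x) (emb x) = 0 := by
    rw [← embR_dotProduct, hx]
    simp
  rw [form_emb] at h
  have h1 : ∑ i, ∑ l, ‖sigma p l (x i : F p)‖ ^ 2 / (p : ℝ) = 0 := by
    have : ((∑ i, ∑ l, ‖sigma p l (x i : F p)‖ ^ 2 / (p : ℝ) : ℝ) : ℂ) = 0 := by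
      rw [← h]
      push_cast
      simp only [Complex.mul_conj']
    exact_mod_cast this
  have hp0 : (0 : ℝ) < p := by exact_mod_cast hp.pos
  rw [Finset.sum_eq_zero_iff_of_nonneg fun i _ => Finset.sum_nonneg fun l _ => by positivity] at h1
  have h2 := h1 i (Finset.mem_univ i)
  rw [Finset.sum_eq_zero_iff_of_nonneg fun l _ => by positivity] at h2
  have h3 := h2 ⟨0, by have := hp.one_lt; omega⟩ (Finset.mem_univ _)
  have h4 : sigma p ⟨0, by have := hp.one_lt; omega⟩ (x i : F p) = 0 := by
    rcases div_eq_zero_iff.1 h3 with h | h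
    · simpa using h
    · exact absurd h hp0.ne'
  simpa using h4

variable (C : Submodule (ZMod p) (Fin n → ZMod p))

/-- The lattice is contained in the `ℤ`-span of a real basis, the image of `𝕆^n`. -/
instance discreteTopology_realLattice : DiscreteTopology (realLattice C) := by
  have h : (realLattice C : Set (Idx p n → ℝ)) ⊆
      (Submodule.span ℤ (Set.range (powBasis p n)) : Set (Idx p n → ℝ)) := by
    rintro _ ⟨x, -, rfl⟩
    have hx : embR x = ∑ a, (embR (dualVec a) ⬝ᵥ embR x) • embR (powVec a) :=
      eq_sum_dotProduct_smul _
    rw [hx]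
    refine Submodule.sum_mem _ fun a _ => ?_
    obtain ⟨m, hm⟩ := (exists_int_form_iff (dualVec a) x).2 (by
      simp [rho_dualVec, dotProduct])
    rw [← embR_dotProduct] at hm
    have hm' : embR (dualVec a) ⬝ᵥ embR x = (m : ℝ) := by exact_mod_cast hm
    rw [hm', Int.cast_smul_eq_zsmul]
    exact Submodule.smul_mem _ _ (Submodule.subset_span ⟨a, powBasis_apply a⟩)
  exact DiscreteTopology.of_subset
    (inferInstanceAs (DiscreteTopology (Submodule.span ℤ (Set.range (powBasis p n))))) h

/-- The lattice has full rank, because it contains `p 𝕆^n`. -/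
instance isZLattice_realLattice : IsZLattice ℝ (realLattice C) where
  span_top := by
    have hp0 : (p : ℝ) ≠ 0 := by exact_mod_cast (Fact.out : p.Prime).ne_zero
    rw [eq_top_iff, ← (powBasis p n).span_eq, Submodule.span_le]
    rintro _ ⟨a, rfl⟩
    have h : powBasis p n a = (p : ℝ)⁻¹ • embR ((p : ℤ) • powVec a) := by
      rw [map_zsmul, ← Int.cast_smul_eq_zsmul ℝ, smul_smul, powBasis_apply]
      simp [hp0]
    rw [h]
    refine Submodule.smul_mem _ _ (Submodule.subset_span ⟨_, ?_, rfl⟩)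
    change (fun i => rho p (((p : ℤ) • powVec a) i)) ∈ C
    convert! C.zero_mem
    simp

/-- The lattice of a self-dual code is self-dual. A vector that pairs integrally with it pairs
integrally with `ℙ^n`, hence lies in `𝕆^n`, and its reduction is orthogonal to `C`. -/
theorem realLattice_selfDual (hC : IsSelfDual C) (y : Idx p n → ℝ) :
    y ∈ realLattice C ↔ ∀ x ∈ realLattice C, ∃ m : ℤ, x ⬝ᵥ y = m := by
  have key : ∀ x y : Fin n → O p, (∃ m : ℤ, embR x ⬝ᵥ embR y = m) ↔
      (fun i => rho p (x i)) ⬝ᵥ (fun i => rho p (y i)) = 0 := by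
    intro x y
    rw [← exists_int_form_iff]
    refine exists_congr fun m => ?_
    rw [← embR_dotProduct]
    norm_cast
  constructor
  · rintro ⟨y, hy, rfl⟩ _ ⟨x, hx, rfl⟩
    rw [key]
    exact (hC _).1 hx _ hy
  · intro h
    obtain ⟨y, rfl⟩ := exists_embR_eq fun a => h _ ⟨dualVec a, by
      change (fun i => rho p (dualVec a i)) ∈ C
      simp only [rho_dualVec]
      exact C.zero_mem, rfl⟩
    refine ⟨y, (hC _).2 fun c hc => ?_, rfl⟩
    have hx : ∀ i, ∃ x : O p, rho p x = c i := fun i => ⟨((c i).val : O p), by simp⟩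
    choose x hx using hx
    have hxc : (fun i => rho p (x i)) = c := funext hx
    rw [dotProduct_comm, ← hxc, ← key]
    exact h _ ⟨x, by change (fun i => rho p (x i)) ∈ C; rwa [hxc], rfl⟩

/-- The lattice `ρ⁻¹(C)` and its Euclidean image. -/
def realLatticeEquiv : codeLattice C ≃ realLattice C :=
  ((codeLattice C).equivMapOfInjective embR embR_injective).toEquiv

theorem coe_realLatticeEquiv (x : codeLattice C) :
    (realLatticeEquiv C x : Idx p n → ℝ) = embR x.1 := rfl

end

end CodeLattice

/-! ### The theta function of a code in `r = (p - 1) / 2` variables -/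

section CodeTheta

set_option linter.unusedSectionVars false

variable {p : ℕ} [Fact p.Prime] {n : ℕ}

noncomputable section

/-- For odd `p` the embeddings of `F` are the `σ_l`, `l < (p - 1) / 2`, and their conjugates. -/
def halfEquiv (hp : p ≠ 2) : Fin ((p - 1) / 2) ⊕ Fin ((p - 1) / 2) ≃ Fin (p - 1) :=
  Equiv.ofBijective
    (Sum.elim (Fin.castLE (Nat.div_le_self _ _))
      (fun l => Fin.rev (Fin.castLE (Nat.div_le_self _ _) l))) (by
    have hodd := (Fact.out : p.Prime).eq_two_or_odd'.resolve_left hp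
    obtain ⟨r, hr⟩ := hodd
    have hr' : (p - 1) / 2 = r := by omega
    rw [Fintype.bijective_iff_injective_and_card]
    constructor
    · rintro (a | a) (b | b) h <;> have ha := a.2 <;> have hb := b.2 <;>
        simp only [Sum.elim_inl, Sum.elim_inr, Fin.ext_iff, Fin.val_rev, Fin.val_castLE] at h
      · rw [Fin.ext h]
      · omega
      · omega
      · congr 1
        apply Fin.ext
        omega
    · simp only [Fintype.card_sum, Fintype.card_fin]
      omega)

theorem halfEquiv_inl (hp : p ≠ 2) (l : Fin ((p - 1) / 2)) :
    halfEquiv hp (Sum.inl l) = Fin.castLE (Nat.div_le_self _ _) l := rfl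

theorem halfEquiv_inr (hp : p ≠ 2) (l : Fin ((p - 1) / 2)) :
    halfEquiv hp (Sum.inr l) = Fin.rev (Fin.castLE (Nat.div_le_self _ _) l) := rfl

theorem sum_half {R : Type*} [AddCommMonoid R] (hp : p ≠ 2) (g : Fin (p - 1) → R) :
    ∑ l, g l = ∑ l : Fin ((p - 1) / 2), (g (Fin.castLE (Nat.div_le_self _ _) l) +
      g (Fin.rev (Fin.castLE (Nat.div_le_self _ _) l))) := by
  rw [← (halfEquiv hp).sum_comp, Fintype.sum_sum_type, Finset.sum_add_distrib]
  rfl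

/-- The Gaussian parameters `-i z_l`, one for each embedding of `F` over the `l`-th place. -/
def gaussParam (hp : p ≠ 2) (z : Fin ((p - 1) / 2) → ℂ) (a : Idx p n) : ℂ :=
  -Complex.I * Sum.elim z z ((halfEquiv hp).symm a.2)

theorem gaussParam_re_pos (hp : p ≠ 2) {z : Fin ((p - 1) / 2) → ℂ} (hz : z ∈ Hr p)
    (a : Idx p n) : 0 < (gaussParam hp z a).re := by
  unfold gaussParam
  cases (halfEquiv hp).symm a.2 <;> simpa using hz _

/-- The quadratic form `∑ᵢ |σ_l(xᵢ)|² / p` attached to the `l`-th place. -/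
def quadForm (x : Fin n → O p) (l : Fin ((p - 1) / 2)) : ℝ :=
  (∑ i, ‖sigmaHalf p l (x i : F p)‖ ^ 2) / p

theorem quadForm_nonneg (x : Fin n → O p) (l : Fin ((p - 1) / 2)) : 0 ≤ quadForm x l :=
  div_nonneg (Finset.sum_nonneg fun _ _ => sq_nonneg _) (Nat.cast_nonneg p)

theorem thetaTerm_eq_exp (z : Fin ((p - 1) / 2) → ℂ) (x : Fin n → O p) :
    thetaTerm z x = Complex.exp (2 * Real.pi * Complex.I * ∑ l, z l * quadForm x l) := by
  unfold thetaTerm quadForm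
  rw [Finset.sum_comm]
  congr 2
  refine Finset.sum_congr rfl fun l _ => ?_
  rw [← Finset.sum_div, ← Finset.mul_sum, mul_div_assoc]
  push_cast
  simp only [Complex.mul_conj']

theorem embR_sq_add_sq_rev (x : Fin n → O p) (i : Fin n) (l : Fin (p - 1)) :
    embR x (i, l) ^ 2 + embR x (i, Fin.rev l) ^ 2 = 2 * ‖sigma p l (x i : F p)‖ ^ 2 / p := by
  rw [sq, sq, embR_mul_embR, embR_mul_embR, ← Complex.normSq_eq_norm_sq, Complex.normSq_apply]
  simp only [sigma_rev, Complex.conj_re, Complex.conj_im]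
  ring

/-- The two coordinates of `embR` belonging to `σ_l` and its conjugate carry the same Gaussian
parameter, and their squares add up to `2 |σ_l(xᵢ)|² / p`. -/
theorem thetaTerm_eq_gauss (hp : p ≠ 2) (z : Fin ((p - 1) / 2) → ℂ) (x : Fin n → O p) :
    thetaTerm z x = gauss (gaussParam hp z) (embR x) := by
  rw [thetaTerm_eq_exp, gauss]
  congr 1
  have h1 : ∑ a : Idx p n, gaussParam hp z a * (embR x a : ℂ) ^ 2 =
      -Complex.I * ∑ l, z l * (2 * quadForm x l) := by
    rw [Fintype.sum_prod_type_right, sum_half hp, Finset.mul_sum]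
    refine Finset.sum_congr rfl fun l _ => ?_
    rw [← Finset.sum_add_distrib]
    have h2 : ∀ i : Fin n, gaussParam hp z (i, Fin.castLE (Nat.div_le_self _ _) l) =
        -Complex.I * z l := fun i => by
      rw [gaussParam, ← halfEquiv_inl hp, Equiv.symm_apply_apply, Sum.elim_inl]
    have h3 : ∀ i : Fin n, gaussParam hp z (i, Fin.rev (Fin.castLE (Nat.div_le_self _ _) l)) =
        -Complex.I * z l := fun i => by
      rw [gaussParam, ← halfEquiv_inr hp, Equiv.symm_apply_apply, Sum.elim_inr]
    simp only [h2, h3, ← mul_add]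
    rw [← Finset.mul_sum, mul_assoc]
    congr 2
    rw [quadForm]
    push_cast
    rw [Finset.sum_div, Finset.mul_sum]
    refine Finset.sum_congr rfl fun i _ => ?_
    have := embR_sq_add_sq_rev x i (Fin.castLE (Nat.div_le_self _ _) l)
    rw [← mul_div_assoc]
    exact_mod_cast this
  rw [h1, Finset.mul_sum, Finset.mul_sum, Finset.mul_sum]
  exact Finset.sum_congr rfl fun l _ => by ring

theorem sum_embR_sq (hp : p ≠ 2) (x : Fin n → O p) :
    ∑ a, embR x a ^ 2 = 2 * ∑ l, quadForm x l := by
  rw [Fintype.sum_prod_type_right, sum_half hp, Finset.mul_sum]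
  refine Finset.sum_congr rfl fun l _ => ?_
  rw [← Finset.sum_add_distrib, quadForm, Finset.sum_div, Finset.mul_sum]
  refine Finset.sum_congr rfl fun i _ => ?_
  rw [embR_sq_add_sq_rev, mul_div_assoc]
  rfl

variable (C : Submodule (ZMod p) (Fin n → ZMod p))

/-- The theta function of the lattice `ρ⁻¹(C)`. -/
def codeTheta (z : Fin ((p - 1) / 2) → ℂ) : ℂ := ∑' x : codeLattice C, thetaTerm z x.1

theorem summable_thetaTerm (hp : p ≠ 2) {z : Fin ((p - 1) / 2) → ℂ} (hz : z ∈ Hr p) :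
    Summable fun x : codeLattice C => thetaTerm z x.1 := by
  simp only [thetaTerm_eq_gauss hp, ← coe_realLatticeEquiv]
  exact (realLatticeEquiv C).summable_iff.2
    (summable_gauss (realLattice C) (gaussParam_re_pos hp hz))

/-- The words of `C` partition `ρ⁻¹(C)` into cosets of `ℙ^n`. -/
def cosetEquiv : (Σ w : C, Coset (w : Fin n → ZMod p)) ≃ codeLattice C where
  toFun x := ⟨x.2.1, by rw [mem_codeLattice, x.2.2]; exact x.1.2⟩
  invFun x := ⟨⟨_, x.2⟩, x.1, rfl⟩
  left_inv := by
    rintro ⟨⟨w, hw⟩, x, hx⟩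
    have hx' : (fun i => rho p (x i)) = w := hx
    subst hx'
    rfl
  right_inv x := rfl

theorem summable_thetaTerm_sigma (hp : p ≠ 2) {z : Fin ((p - 1) / 2) → ℂ} (hz : z ∈ Hr p) :
    Summable fun y : Σ w : C, Coset (w : Fin n → ZMod p) => thetaTerm z y.2.1 :=
  (cosetEquiv C).summable_iff.2 (summable_thetaTerm C hp hz)

theorem summable_thetaTerm_coset (hp : p ≠ 2) {z : Fin ((p - 1) / 2) → ℂ} (hz : z ∈ Hr p)
    {w : Fin n → ZMod p} (hw : w ∈ C) : Summable fun x : Coset w => thetaTerm z x.1 :=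
  (summable_thetaTerm_sigma C hp hz).sigma_factor ⟨w, hw⟩

/-- The refined partition function of `M_C` is the theta function of `ρ⁻¹(C)`. -/
theorem refinedZ_classM (hp : p ≠ 2) {z : Fin ((p - 1) / 2) → ℂ} (hz : z ∈ Hr p) :
    refinedZ (classM C) z = codeTheta C z := by
  have := Fintype.ofFinite C
  have h : codeTheta C z = ∑' y : Σ w : C, Coset (w : Fin n → ZMod p), thetaTerm z y.2.1 :=
    ((cosetEquiv C).tsum_eq fun x : codeLattice C => thetaTerm z x.1).symm
  rw [h, (summable_thetaTerm_sigma C hp hz).tsum_sigma, tsum_fintype, classM,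
    finsum_eq_sum_of_fintype, map_sum, Finset.sum_apply]
  refine Finset.sum_congr rfl fun w _ => ?_
  rw [refinedZ, Finsupp.linearCombination_single, one_smul]
  rfl

variable {C}

/-- The theta inversion formula for a self-dual code. -/
theorem codeTheta_inv (hp : p ≠ 2) (hC : IsSelfDual C) {z : Fin ((p - 1) / 2) → ℂ}
    (hz : z ∈ Hr p) :
    codeTheta C (fun l => -1 / z l) = (∏ l, (-Complex.I * z l) ^ n) * codeTheta C z := by
  have h0 : ∀ l, z l ≠ 0 := fun l h0 => by have := hz l; simp [h0] at this
  have hg : ∀ z, codeTheta C z =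
      ∑' x : realLattice C, gauss (gaussParam hp z) (x : Idx p n → ℝ) := by
    intro z
    rw [← (realLatticeEquiv C).tsum_eq]
    simp only [codeTheta, thetaTerm_eq_gauss hp, coe_realLatticeEquiv]
  have hinv : (gaussParam hp fun l => -1 / z l : Idx p n → ℂ) =
      fun a => 1 / gaussParam hp z a := by
    ext a
    unfold gaussParam
    cases (halfEquiv hp).symm a.2 <;>
    · simp only [Sum.elim_inl, Sum.elim_inr]
      rename_i l
      have := h0 l
      field_simp
      rw [Complex.I_sq]
  -- Each place has two embeddings above it, so that the square roots combine in pairs.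
  have hprod : ∏ a : Idx p n, (1 / gaussParam hp z a) ^ (1 / 2 : ℂ) =
      (∏ l, (-Complex.I * z l) ^ n)⁻¹ := by
    rw [Fintype.prod_prod_type_right, ← (halfEquiv hp).prod_comp, Fintype.prod_sum_type,
      ← Finset.prod_mul_distrib, ← Finset.prod_inv_distrib]
    refine Finset.prod_congr rfl fun l _ => ?_
    simp only [gaussParam, Equiv.symm_apply_apply, Sum.elim_inl, Sum.elim_inr, Finset.prod_const,
      Finset.card_univ, Fintype.card_fin]
    rw [← mul_pow, ← Complex.cpow_add _ _ (by simp [h0 l]), add_halves, Complex.cpow_one, one_div,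
      inv_pow]
  rw [hg, hg, tsum_gauss_of_selfDual (realLattice C) (realLattice_selfDual C hC)
    (gaussParam_re_pos hp hz), hprod, hinv, mul_inv_cancel_left₀]
  exact Finset.prod_ne_zero_iff.2 fun l _ => pow_ne_zero _ (by simp [h0 l])

/-- The field `k` is totally real. -/
theorem conj_sigma_k (l : Fin (p - 1)) (b : k p) :
    (starRingEnd ℂ) (sigma p l (b : F p)) = sigma p l (b : F p) := by
  have h : ((Complex.conjAe.toAlgHom.restrictScalars ℚ).comp (sigma p l)).comp (k p).val =
      (sigma p l).comp (k p).val := by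
    refine IntermediateField.adjoin_algHom_ext ℚ fun x hx => ?_
    rw [Set.mem_singleton_iff] at hx
    have h1 : (starRingEnd ℂ) (sigma p l (zeta p)) = (sigma p l (zeta p))⁻¹ := by
      rw [← Complex.inv_eq_conj]
      exact ((zeta_spec p).map_of_injective (sigma p l).injective).norm'_eq_one
        (Fact.out : p.Prime).ne_zero
    change (starRingEnd ℂ) (sigma p l x) = sigma p l x
    rw [hx]
    simp only [map_add, map_inv₀, h1, inv_inv, add_comm]
  exact DFunLike.congr_fun h b

theorem conj_sigmaHalf_k (l : Fin ((p - 1) / 2)) (b : k p) :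
    (starRingEnd ℂ) (sigmaHalf p l (b : F p)) = sigmaHalf p l (b : F p) := conj_sigma_k _ b

theorem isIntegral_sigma (l : Fin (p - 1)) (x : O p) : IsIntegral ℤ (sigma p l (x : F p)) :=
  (NumberField.RingOfIntegers.isIntegral_coe x).map ((sigma p l).restrictScalars ℤ)

/-- An algebraic integer whose double is `p` times a rational integer, `p` odd, is itself `p` times
a rational integer. -/
theorem exists_eq_mul_of_two_mul_eq (hp : p ≠ 2) {S : ℂ} (hS : IsIntegral ℤ S) {m : ℤ}
    (h : 2 * S = p * m) : ∃ m' : ℤ, S = p * m' := by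
  have hq : S = algebraMap ℚ ℂ (p * m / 2) := by
    simp only [eq_ratCast]
    push_cast
    rw [eq_div_iff two_ne_zero, ← h, mul_comm]
  rw [hq, isIntegral_algebraMap_iff (algebraMap ℚ ℂ).injective] at hS
  obtain ⟨s, hs⟩ := IsIntegrallyClosed.isIntegral_iff.1 hS
  have h2 : (p : ℤ) * m = 2 * s := by
    have : ((p : ℤ) * m : ℚ) = 2 * s := by
      simp only [eq_intCast] at hs
      rw [hs]; push_cast; ring
    exact_mod_cast this
  have hcop : IsCoprime (2 : ℤ) p := by
    rw [Int.isCoprime_iff_gcd_eq_one]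
    have := (Nat.coprime_primes Nat.prime_two (Fact.out : p.Prime)).2 (Ne.symm hp)
    exact_mod_cast this
  obtain ⟨m', rfl⟩ := hcop.dvd_of_dvd_mul_left ⟨s, h2⟩
  refine ⟨m', ?_⟩
  push_cast at h
  linear_combination h / 2

/-- `Tr_k(b x x̄ / p)` is a rational integer for `b ∈ 𝒪_k` and `x` in the lattice of a self-dual
code. -/
theorem exists_int_halfTrace (hp : p ≠ 2) (hC : IsSelfDual C) (b : Ok p) {x : Fin n → O p}
    (hx : x ∈ codeLattice C) :
    ∃ m : ℤ, ∑ l, sigmaHalf p l ((b : k p) : F p) * quadForm x l = m := by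
  have h0 : (p : ℂ) ≠ 0 := by exact_mod_cast (Fact.out : p.Prime).ne_zero
  let b' : O p := ⟨((b : k p) : F p), (NumberField.RingOfIntegers.isIntegral_coe b).map
    ((k p).val.restrictScalars ℤ)⟩
  have hb' : (b' : F p) = ((b : k p) : F p) := rfl
  set t : Fin (p - 1) → ℂ := fun l => sigma p l ((b : k p) : F p) *
    ∑ i, sigma p l (x i : F p) * (starRingEnd ℂ) (sigma p l (x i : F p))
  have ht : ∀ l, t (Fin.rev l) = t l := by
    intro l
    simp only [t, sigma_rev, conj_sigma_k, Complex.conj_conj]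
    congr 1
    exact Finset.sum_congr rfl fun i _ => mul_comm _ _
  obtain ⟨m, hm⟩ := (exists_int_form_iff (fun i => b' * x i) x).2
    ((hC _).1 (smul_mem_codeLattice b' hx) _ hx)
  have hsum : ∑ l, t l = p * m := by
    rw [form_emb_eq_sum_trForm, div_eq_iff h0] at hm
    rw [mul_comm, ← hm]
    simp only [trForm, t, Finset.mul_sum]
    rw [Finset.sum_comm]
    refine Finset.sum_congr rfl fun i _ => Finset.sum_congr rfl fun l _ => ?_
    rw [show ((b' * x i : O p) : F p) = (b' : F p) * (x i : F p) from rfl, map_mul, hb', mul_assoc]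
  rw [sum_half hp] at hsum
  simp only [ht, ← two_mul] at hsum
  rw [← Finset.mul_sum] at hsum
  have hint : IsIntegral ℤ (∑ l : Fin ((p - 1) / 2), t (Fin.castLE (Nat.div_le_self _ _) l)) := by
    refine IsIntegral.sum _ fun l _ => IsIntegral.mul ?_ (IsIntegral.sum _ fun i _ => ?_)
    · rw [← hb']
      exact isIntegral_sigma _ _
    · rw [← sigma_rev]
      exact (isIntegral_sigma _ _).mul (isIntegral_sigma _ _)
  obtain ⟨m', hm'⟩ := exists_eq_mul_of_two_mul_eq hp hint hsum
  refine ⟨m', ?_⟩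
  rw [eq_comm, ← mul_right_inj' h0, ← hm', Finset.mul_sum]
  refine Finset.sum_congr rfl fun l _ => ?_
  simp only [t, quadForm, sigmaHalf]
  push_cast
  simp only [Complex.mul_conj']
  field_simp

/-- Translation by `b ∈ 𝒪_k` leaves the theta function of a self-dual code invariant. -/
theorem codeTheta_add (hp : p ≠ 2) (hC : IsSelfDual C) (b : Ok p) (z : Fin ((p - 1) / 2) → ℂ) :
    codeTheta C (fun l => z l + sigmaHalf p l ((b : k p) : F p)) = codeTheta C z := by
  refine tsum_congr fun x => ?_
  obtain ⟨m, hm⟩ := exists_int_halfTrace hp hC b x.2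
  rw [thetaTerm_eq_exp, thetaTerm_eq_exp, Complex.exp_eq_exp_iff_exists_int]
  refine ⟨m, ?_⟩
  rw [← hm]
  simp only [add_mul, Finset.sum_add_distrib]
  ring

variable (C)

/-- The complex linear form `z ↦ 2πi ∑_l z_l Q_l(x)`, `Q_l = quadForm · l`, in the
exponent of a theta series. -/
def exponentForm (x : Fin n → O p) : (Fin ((p - 1) / 2) → ℂ) →L[ℂ] ℂ :=
  ∑ l, (2 * Real.pi * Complex.I * (quadForm x l : ℂ)) •
    ContinuousLinearMap.proj (R := ℂ) (φ := fun _ : Fin ((p - 1) / 2) => ℂ) l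

theorem exponentForm_apply (x : Fin n → O p) (z : Fin ((p - 1) / 2) → ℂ) :
    exponentForm x z = 2 * Real.pi * Complex.I * ∑ l, z l * quadForm x l := by
  simp only [exponentForm, sum_apply, _root_.smul_apply, ContinuousLinearMap.proj_apply,
    smul_eq_mul, Finset.mul_sum]
  exact Finset.sum_congr rfl fun l _ => by ring

theorem norm_exponentForm_le (x : Fin n → O p) :
    ‖exponentForm x‖ ≤ 2 * Real.pi * ∑ l, quadForm x l := by
  refine ContinuousLinearMap.opNorm_le_bound _ (mul_nonneg (by positivity)
    (Finset.sum_nonneg fun l _ => quadForm_nonneg x l)) fun z => ?_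
  rw [exponentForm_apply, norm_mul, mul_assoc _ _ ‖z‖]
  have h1 : ‖(2 * Real.pi * Complex.I : ℂ)‖ = 2 * Real.pi := by
    simp [abs_of_pos Real.pi_pos]
  rw [h1, Finset.sum_mul]
  refine mul_le_mul_of_nonneg_left ((norm_sum_le _ _).trans
    (Finset.sum_le_sum fun l _ => ?_)) (by positivity)
  rw [norm_mul, Complex.norm_real, Real.norm_of_nonneg (quadForm_nonneg x l), mul_comm]
  exact mul_le_mul_of_nonneg_left (norm_le_pi_norm z l) (quadForm_nonneg x l)

theorem norm_thetaTerm (z : Fin ((p - 1) / 2) → ℂ) (x : Fin n → O p) :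
    ‖thetaTerm z x‖ = Real.exp (-(2 * Real.pi * ∑ l, (z l).im * quadForm x l)) := by
  rw [thetaTerm_eq_exp, Complex.norm_exp]
  congr 1
  have h : (2 * Real.pi * Complex.I * ∑ l, z l * quadForm x l : ℂ) =
      Complex.I * ((2 * Real.pi : ℝ) * ∑ l, z l * quadForm x l) := by push_cast; ring
  rw [h, Complex.I_mul_re, Complex.im_ofReal_mul, Complex.im_sum]
  simp only [Complex.im_mul_ofReal]

theorem norm_thetaTerm_le {ε : ℝ} {z : Fin ((p - 1) / 2) → ℂ} (hz : ∀ l, ε ≤ (z l).im)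
    (x : Fin n → O p) : ‖thetaTerm z x‖ ≤ Real.exp (-(2 * Real.pi * ε * ∑ l, quadForm x l)) := by
  rw [norm_thetaTerm, Real.exp_le_exp, neg_le_neg_iff, mul_assoc]
  refine mul_le_mul_of_nonneg_left ?_ (by positivity)
  rw [Finset.mul_sum]
  exact Finset.sum_le_sum fun l _ => mul_le_mul_of_nonneg_right (hz l) (quadForm_nonneg x l)

theorem summable_exp_quadForm (hp : p ≠ 2) {c : ℝ} (hc : 0 < c) :
    Summable fun x : codeLattice C => Real.exp (-(c * ∑ l, quadForm x.1 l)) := by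
  have h := (realLatticeEquiv C).summable_iff.2
    (summable_exp_neg_sum_sq (realLattice C) (half_pos hc))
  refine h.congr fun x => ?_
  simp only [Function.comp_apply, coe_realLatticeEquiv, sum_embR_sq hp]
  congr 1
  ring

/-- The theta function is holomorphic: on `Im z_l > ε` the series of derivatives is dominated
termwise. -/
theorem differentiableOn_codeTheta (hp : p ≠ 2) : DifferentiableOn ℂ (codeTheta C) (Hr p) := by
  intro z₀ hz₀
  obtain ⟨β, hβ, hle⟩ := exists_pos_le_re (fun l => -Complex.I * z₀ l)
    (fun l => by simpa using hz₀ l)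
  set ε := β / 2 with hε
  have hε0 : 0 < ε := half_pos hβ
  set U : Set (Fin ((p - 1) / 2) → ℂ) := {z | ∀ l, ε < (z l).im}
  have hUeq : U = ⋂ l, {z | ε < (z l).im} := by ext z; simp [U]
  have hU : IsOpen U := by
    rw [hUeq]
    exact isOpen_iInter_of_finite fun l =>
      isOpen_lt continuous_const (Complex.continuous_im.comp (continuous_apply l))
  have hconv : Convex ℝ U := by
    rw [hUeq]
    refine convex_iInter fun l => ?_
    have : IsLinearMap ℝ fun z : Fin ((p - 1) / 2) → ℂ => (z l).im :=
      ⟨fun _ _ => by simp, fun _ _ => by simp⟩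
    exact convex_halfSpace_gt this ε
  have hzU : z₀ ∈ U := fun l => by
    have := hle l
    simp at this
    linarith
  have hd := hasFDerivAt_tsum_of_isPreconnected (𝕜 := ℂ)
    (f := fun (x : codeLattice C) z => thetaTerm z x.1)
    (f' := fun (x : codeLattice C) z => thetaTerm z x.1 • exponentForm x.1)
    (u := fun x : codeLattice C => (2 / ε) * Real.exp (-(Real.pi * ε * ∑ l, quadForm x.1 l)))
    ((summable_exp_quadForm C hp (by positivity)).mul_left _) hU hconv.isPreconnected
    (fun x z _ => ?_) (fun x z hz => ?_) hzU (summable_thetaTerm C hp hz₀) hzU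
  · exact hd.differentiableAt.differentiableWithinAt
  · have h := ((exponentForm x.1).hasFDerivAt (x := z)).cexp
    refine (h.congr_of_eventuallyEq (Filter.Eventually.of_forall fun y => ?_)).congr_fderiv ?_
    · simp only [exponentForm_apply, thetaTerm_eq_exp]
    · simp only [exponentForm_apply, thetaTerm_eq_exp]
  · rw [norm_smul]
    set Q := ∑ l, quadForm x.1 l
    have hQ : 0 ≤ Q := Finset.sum_nonneg fun l _ => quadForm_nonneg x.1 l
    refine (mul_le_mul (norm_thetaTerm_le (fun l => (hz l).le) x.1) (norm_exponentForm_le x.1)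
      (norm_nonneg _) (Real.exp_nonneg _)).trans ?_
    have h1 : Real.pi * ε * Q ≤ Real.exp (Real.pi * ε * Q) := by
      have := Real.add_one_le_exp (Real.pi * ε * Q)
      linarith
    have h2 : Real.exp (-(2 * Real.pi * ε * Q)) =
        Real.exp (-(Real.pi * ε * Q)) * (Real.exp (Real.pi * ε * Q))⁻¹ := by
      rw [← Real.exp_neg, ← Real.exp_add]
      congr 1
      ring
    -- The factor `Q` from the derivative is absorbed by half of the exponential decay.
    have h3 : 2 * Real.pi * Q = (2 / ε) * (Real.pi * ε * Q) := by field_simp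
    rw [h2, h3]
    have h4 : (Real.exp (Real.pi * ε * Q))⁻¹ * (Real.pi * ε * Q) ≤ 1 := by
      rw [inv_mul_le_iff₀ (Real.exp_pos _), mul_one]
      exact h1
    calc _ = (2 / ε) * Real.exp (-(Real.pi * ε * Q)) *
          ((Real.exp (Real.pi * ε * Q))⁻¹ * (Real.pi * ε * Q)) := by ring
      _ ≤ _ := mul_le_of_le_one_right (by positivity) h4

end

end CodeTheta

/-! ### The action of `L₀` on the lattice modules -/

section VirasoroAction

set_option linter.unusedSectionVars false

variable {p : ℕ} [Fact p.Prime] {n : ℕ} {w : Fin n → ZMod p}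

noncomputable section

/-- The index of the coordinate `σ_{p-r}(x_i)` conjugate to `σ_r(x_i)`. -/
def conjIdx (a : Idx p n) : Idx p n := (a.1, Fin.rev a.2)

theorem conjIdx_conjIdx (a : Idx p n) : conjIdx (conjIdx a) = a := by
  simp [conjIdx]

/-- The basis vector `X^s ⊗ e^x` of `V_{ℙ^n + w}`. -/
def basisVec (x : Coset w) (s : Idx p n × ℕ →₀ ℕ) : V w :=
  Finsupp.single x (MvPolynomial.monomial s 1)

theorem monomial_eq_basisMonomials (s : Idx p n × ℕ →₀ ℕ) : MvPolynomial.monomial s (1 : ℂ) =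
    MvPolynomial.basisMonomials (Idx p n × ℕ) ℂ s := by
  rw [MvPolynomial.coe_basisMonomials]

theorem onBasis_basisVec (f : Coset w → (Idx p n × ℕ →₀ ℕ) → V w) (x : Coset w)
    (s : Idx p n × ℕ →₀ ℕ) : onBasis f (basisVec x s) = f x s := by
  rw [onBasis, basisVec, Finsupp.lsum_single, monomial_eq_basisMonomials,
    Module.Basis.constr_basis]

theorem end_ext {S T : Module.End ℂ (V w)} (h : ∀ x s, S (basisVec x s) = T (basisVec x s)) :
    S = T := by
  refine Finsupp.lhom_ext' fun x => (MvPolynomial.basisMonomials (Idx p n × ℕ) ℂ).ext fun s => ?_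
  simpa [basisVec, MvPolynomial.coe_basisMonomials] using h x s

theorem form_single_left (a : Idx p n) (v : Idx p n → ℂ) :
    form (Pi.single a 1) v = v (conjIdx a) / p := by
  rw [form, Finset.sum_eq_single a]
  · simp [conjIdx]
  · intro b _ hb
    simp [Pi.single_eq_of_ne hb]
  · simp

theorem form_zero_left (v : Idx p n → ℂ) : form 0 v = 0 := by simp [form]

theorem heis_zero_left (m : ℤ) : (heis 0 m : Module.End ℂ (V w)) = 0 := by
  refine end_ext fun x s => ?_
  match m with
  | .ofNat 0 => simp [heis, form_zero_left, basisVec]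
  | .ofNat (m + 1) => simp [heis, form_zero_left, basisVec]
  | .negSucc m => simp [heis, basisVec]

theorem heis_zero (u : Idx p n → ℂ) (x : Coset w) (Q : Fock p n) :
    heis u 0 (Finsupp.single x Q) = form u (emb x.1) • Finsupp.single x Q := by
  change heis u (Int.ofNat 0) _ = _
  simp [heis]

theorem heis_succ (a : Idx p n) (m : ℕ) (x : Coset w) (Q : Fock p n) :
    heis (Pi.single a 1) ((m : ℤ) + 1) (Finsupp.single x Q) =
      Finsupp.single x ((((m : ℂ) + 1) / p) • MvPolynomial.pderiv (conjIdx a, m) Q) := by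
  change heis (Pi.single a 1) (Int.ofNat (m + 1)) _ = _
  simp only [heis, Finsupp.mapRange.linearMap_apply, Finsupp.mapRange_single]
  congr 1
  simp only [form_single_left, LinearMap.smul_apply, LinearMap.sum_apply]
  rw [Finset.sum_eq_single (conjIdx a)]
  · simp [smul_smul, div_eq_mul_inv]
  · intro b _ hb
    simp [Pi.single_eq_of_ne hb.symm]
  · simp

theorem heis_neg (u : Idx p n → ℂ) (m : ℕ) (x : Coset w) (Q : Fock p n) :
    heis u (-(m : ℤ) - 1) (Finsupp.single x Q) =
      Finsupp.single x ((∑ a, u a • MvPolynomial.X (a, m)) * Q) := by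
  have : -(m : ℤ) - 1 = Int.negSucc m := by omega
  rw [this]
  simp [heis]

theorem heis_neg_single (a : Idx p n) (c : ℂ) (m : ℕ) (x : Coset w) (Q : Fock p n) :
    heis (Pi.single a c) (-(m : ℤ) - 1) (Finsupp.single x Q) =
      Finsupp.single x (c • (MvPolynomial.X (a, m) * Q)) := by
  rw [heis_neg, Finset.sum_eq_single a]
  · simp
  · intro b _ hb
    simp [Pi.single_eq_of_ne hb]
  · simp

theorem X_mul_pderiv_monomial (i : Idx p n × ℕ) (s : Idx p n × ℕ →₀ ℕ) :
    MvPolynomial.X i * MvPolynomial.pderiv i (MvPolynomial.monomial s (1 : ℂ)) =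
      (s i : ℂ) • MvPolynomial.monomial s (1 : ℂ) := by
  rw [MvPolynomial.X_mul_pderiv_monomial, MvPolynomial.smul_monomial, ← Nat.cast_smul_eq_nsmul ℂ,
    MvPolynomial.smul_monomial]

/-- The operators `v_a ⊗ t^{-j-1}` and `v^a ⊗ t^{j+1}` compose to a number operator. -/
theorem heis_neg_heis_pos (a : Idx p n) (j : ℕ) (x : Coset w) (s : Idx p n × ℕ →₀ ℕ) :
    heis (Pi.single a 1) (-(j : ℤ) - 1)
        (heis (Pi.single (conjIdx a) 1) ((j : ℤ) + 1) (basisVec x s)) =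
      (((j : ℂ) + 1) / p * s (a, j)) • basisVec x s := by
  rw [basisVec, heis_succ, heis_neg_single, conjIdx_conjIdx, one_smul, mul_smul_comm,
    X_mul_pderiv_monomial, smul_smul, Finsupp.smul_single]

theorem expCoeff_zero (j : ℕ) :
    expCoeff (0 : PowerSeries (Module.End ℂ (V w))) j = if j = 0 then 1 else 0 := by
  rw [expCoeff, Finset.sum_eq_single 0]
  · simp [PowerSeries.coeff_one]
  · intro i _ hi
    simp [zero_pow hi]
  · simp

theorem emb_origin : emb (origin : Coset (0 : Fin n → ZMod p)).1 = 0 := by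
  funext a
  simp [emb, origin]

/-- The vertex operator of the vacuum is the identity. -/
theorem expMode_origin (m : ℤ) :
    (expMode origin m : Module.End ℂ (V w)) = if m = -1 then 1 else 0 := by
  refine end_ext fun x s => ?_
  have h1 : (PowerSeries.mk fun j : ℕ => ((j : ℂ)⁻¹) •
      (heis (emb (origin : Coset (0 : Fin n → ZMod p)).1) (-(j : ℤ)) : Module.End ℂ (V w))) = 0 := by
    ext j
    simp [emb_origin, heis_zero_left]
  have h2 : (PowerSeries.mk fun j : ℕ => (-(j : ℂ)⁻¹) •
      (heis (emb (origin : Coset (0 : Fin n → ZMod p)).1) (j : ℤ) : Module.End ℂ (V w))) = 0 := by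
    ext j
    simp [emb_origin, heis_zero_left]
  have h3 : intForm (origin : Coset (0 : Fin n → ZMod p)).1 x.1 = 0 := by
    rw [intForm, emb_origin, form_zero_left]
    simp
  have h4 : eps (origin : Coset (0 : Fin n → ZMod p)).1 x.1 = 1 := by
    simp [eps, origin]
  have h5 : shift origin x = x := by
    apply Subtype.ext
    simp [shift, origin]
  rw [expMode, onBasis_basisVec]
  simp only [h1, h2, h3, h4, h5, expCoeff_zero]
  rw [finsum_eq_single _ (0, 0)]
  · rw [finsum_eq_if]
    simp only [if_true, one_smul, Module.End.one_apply]
    by_cases hm : m = -1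
    · subst hm
      simp [basisVec]
    · rw [if_neg (by push_cast; omega), if_neg hm]
      rfl
  · rintro ⟨i, j⟩ hij
    have : i ≠ 0 ∨ j ≠ 0 := by
      by_contra! h
      exact hij (by rw [h.1, h.2])
    have h0 : ((if i = 0 then 1 else 0 : Module.End ℂ (V w))
        ((if j = 0 then 1 else 0 : Module.End ℂ (V w))
          ((1 : ℂ) • Finsupp.single x (MvPolynomial.monomial s 1)))) = 0 := by
      rcases this with h | h
      · rw [if_neg h]; rfl
      · rw [if_neg h]; simp
    simp only [h0, finsum_zero]

theorem locSum_basisVec (T : ℕ → Module.End ℂ (V w)) (x : Coset w) (s : Idx p n × ℕ →₀ ℕ) :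
    locSum T (basisVec x s) = ∑ᶠ j, T j (basisVec x s) := by
  rw [locSum, onBasis_basisVec]
  rfl

/-- The modes of the field of `v_b ⊗ t⁻¹` are the Heisenberg operators. -/
theorem wordMode_singleton (b : Idx p n) (m : ℤ) :
    (wordMode [(b, 0)] origin m : Module.End ℂ (V w)) = heis (Pi.single b 1) m := by
  refine end_ext fun x s => ?_
  rw [wordMode, locSum_basisVec]
  simp only [wordMode, expMode_origin]
  rcases le_or_gt 0 m with hm | hm
  · obtain ⟨k, rfl⟩ := Int.eq_ofNat_of_zero_le hm
    rw [finsum_eq_single _ k]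
    · rw [if_neg (by omega), if_pos (by push_cast; omega)]
      simp
    · intro j hj
      rw [if_neg (by omega), if_neg (by push_cast; omega)]
      simp
  · obtain ⟨k, hk⟩ := Int.eq_ofNat_of_zero_le (show 0 ≤ -1 - m by omega)
    have h2 : -((0 : ℕ) : ℤ) - 1 - k = m := by push_cast; omega
    rw [finsum_eq_single _ k]
    · rw [if_pos (by omega), if_neg (by push_cast; omega), h2]
      simp
    · intro j hj
      rw [if_neg (by omega), if_neg (by push_cast; omega)]
      simp

theorem exists_bound (s : Idx p n × ℕ →₀ ℕ) : ∃ N, ∀ a j, N ≤ j → s (a, j) = 0 := by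
  refine ⟨s.support.sup (fun i => i.2) + 1, fun a j hj => ?_⟩
  by_contra h
  have := Finset.le_sup (f := fun i : Idx p n × ℕ => i.2) (Finsupp.mem_support_iff.2 h)
  simp only at this
  omega

theorem finsum_smul_eq {E : Type*} [AddCommGroup E] [Module ℂ E] (c : ℕ → ℂ) (v : E) {N : ℕ}
    (hc : ∀ j, N ≤ j → c j = 0) : ∑ᶠ j, c j • v = (∑ j ∈ Finset.range N, c j) • v := by
  rw [finsum_eq_sum_of_support_subset (s := Finset.range N), Finset.sum_smul]
  intro j hj
  by_contra h
  simp only [Finset.coe_range, Set.mem_Iio, not_lt] at h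
  exact hj (by simp [hc j h])

/-- The mode `ω_1` of a summand of the conformal vector acts diagonally. -/
theorem wordMode_pair (a : Idx p n) (x : Coset w) (s : Idx p n × ℕ →₀ ℕ) {N : ℕ}
    (hN : ∀ a j, N ≤ j → s (a, j) = 0) :
    wordMode [(a, 0), (conjIdx a, 0)] origin 1 (basisVec x s) =
      (emb x.1 a * emb x.1 (conjIdx a) / p ^ 2 +
        ∑ j ∈ Finset.range N, ((j : ℂ) + 1) / p * s (a, j) +
        ∑ j ∈ Finset.range N, ((j : ℂ) + 1) / p * s (conjIdx a, j)) • basisVec x s := by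
  rw [wordMode, locSum_basisVec]
  simp only [wordMode_singleton]
  -- In the normally ordered product, the first operator contributes the oscillators of `a`, the
  -- second one the zero mode for `j = 0` and the oscillators of `conjIdx a` for `j > 0`.
  set c : ℕ → ℂ := fun j => ((j : ℂ) + 1) / p * s (a, j) +
    match j with
    | 0 => emb x.1 a * emb x.1 (conjIdx a) / p ^ 2
    | j + 1 => ((j : ℂ) + 1) / p * s (conjIdx a, j) with hc
  have hT : ∀ j : ℕ, ((Nat.choose (0 + j) 0 : ℂ) •
      (heis (Pi.single a 1) (-((0 : ℕ) : ℤ) - 1 - j) * heis (Pi.single (conjIdx a) 1) (1 + j) +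
        (-1 : ℂ) ^ 0 • (heis (Pi.single (conjIdx a) 1) (1 - ((0 : ℕ) : ℤ) - 1 - j) *
          heis (Pi.single a 1) (j : ℤ))) : Module.End ℂ (V w)) (basisVec x s) =
      c j • basisVec x s := by
    intro j
    have e1 : -((0 : ℕ) : ℤ) - 1 - j = -(j : ℤ) - 1 := by push_cast; ring
    have e2 : (1 : ℤ) + j = j + 1 := add_comm _ _
    rw [e1, e2]
    simp only [Nat.choose_zero_right, Nat.cast_one, one_smul, pow_zero, LinearMap.add_apply,
      Module.End.mul_apply, heis_neg_heis_pos, hc, add_smul]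
    congr 1
    cases j with
    | zero =>
      have e3 : (1 : ℤ) - ((0 : ℕ) : ℤ) - 1 - ((0 : ℕ) : ℤ) = 0 := by norm_num
      rw [e3, Nat.cast_zero, basisVec, heis_zero, map_smul, heis_zero, smul_smul, form_single_left,
        form_single_left, conjIdx_conjIdx]
      congr 1
      ring
    | succ j =>
      have e3 : (1 : ℤ) - ((0 : ℕ) : ℤ) - 1 - ((j + 1 : ℕ) : ℤ) = -(j : ℤ) - 1 := by
        push_cast; ring
      have := heis_neg_heis_pos (conjIdx a) j x s
      rw [conjIdx_conjIdx] at this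
      rw [e3, Nat.cast_succ, this]
  rw [finsum_congr hT, finsum_smul_eq (N := N + 1)]
  · congr 1
    simp only [hc]
    rw [Finset.sum_add_distrib, Finset.sum_range_succ, hN a N le_rfl, Finset.sum_range_succ']
    push_cast
    ring
  · intro j hj
    cases j with
    | zero => omega
    | succ j => simp [hc, hN a (j + 1) (by omega), hN (conjIdx a) j (by omega)]

/-- The summands of the conformal vector as basis vectors of `V_n`. -/
theorem vacuum_omega_term (a : Idx p n) :
    heis (Pi.single a 1) (-1) (heis (Pi.single (conjIdx a) (p : ℂ)) (-1) vacuum) =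
      (p : ℂ) • basisVec (origin : Coset (0 : Fin n → ZMod p))
        (Finsupp.single (a, 0) 1 + Finsupp.single (conjIdx a, 0) 1) := by
  have e : (-1 : ℤ) = -((0 : ℕ) : ℤ) - 1 := by norm_num
  rw [e, vacuum, heis_neg_single, heis_neg_single, basisVec, Finsupp.smul_single, one_smul, mul_one,
    mul_smul_comm, MvPolynomial.X, MvPolynomial.X, MvPolynomial.monomial_mul, mul_one]

theorem mode_basisVec (m : ℤ) (α : Coset (0 : Fin n → ZMod p)) (s : Idx p n × ℕ →₀ ℕ) :
    mode w m (basisVec α s) = wordMode (Finsupp.toMultiset s).toList α m := by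
  rw [mode, basisVec, Finsupp.lsum_single, monomial_eq_basisMonomials,
    Module.Basis.constr_basis]

/-- The order in which the two factors of a quadratic monomial are listed is unspecified. -/
theorem toList_pair {A : Type*} (i j : A) :
    (Finsupp.toMultiset (Finsupp.single i 1 + Finsupp.single j 1)).toList = [i, j] ∨
      (Finsupp.toMultiset (Finsupp.single i 1 + Finsupp.single j 1)).toList = [j, i] := by
  have h : ((Finsupp.toMultiset (Finsupp.single i 1 + Finsupp.single j 1)).toList : Multiset A) =
      ([i, j] : List A) := by
    rw [Multiset.coe_toList, map_add, Finsupp.toMultiset_single, Finsupp.toMultiset_single,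
      one_smul, one_smul]
    rfl
  exact List.perm_pair.1 (Multiset.coe_eq_coe.1 h)

/-- The degree of a monomial in the Fock space, where `v ⊗ t^{-m-1}` has degree `m + 1`. -/
def fockDegree (s : Idx p n × ℕ →₀ ℕ) : ℕ := s.sum fun i k => (i.2 + 1) * k

theorem fockDegree_eq (s : Idx p n × ℕ →₀ ℕ) {N : ℕ} (hN : ∀ a j, N ≤ j → s (a, j) = 0) :
    (fockDegree s : ℂ) = ∑ a, ∑ j ∈ Finset.range N, ((j : ℂ) + 1) * s (a, j) := by
  rw [fockDegree, Finsupp.sum_of_support_subset (s := Finset.univ ×ˢ Finset.range N),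
    Finset.sum_product]
  · push_cast
    rfl
  · rintro ⟨a, j⟩ h
    simp only [Finset.mem_product, Finset.mem_univ, Finset.mem_range, true_and]
    by_contra hj
    exact Finsupp.mem_support_iff.1 h (hN a j (by omega))
  · simp

/-- `L₀` acts on `X^s ⊗ e^x` by the scalar `⟨x, x⟩ / 2 + deg s`. -/
theorem mode_omega_basisVec (x : Coset w) (s : Idx p n × ℕ →₀ ℕ) :
    mode w 1 omega (basisVec x s) =
      (form (emb x.1) (emb x.1) / 2 + fockDegree s) • basisVec x s := by
  have h0 : (p : ℂ) ≠ 0 := by exact_mod_cast (Fact.out : p.Prime).ne_zero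
  obtain ⟨N, hN⟩ := exists_bound s
  have hpair : ∀ a : Idx p n, mode w 1 (basisVec (origin : Coset (0 : Fin n → ZMod p))
      (Finsupp.single (a, 0) 1 + Finsupp.single (conjIdx a, 0) 1)) (basisVec x s) =
      (emb x.1 a * emb x.1 (conjIdx a) / p ^ 2 +
        ∑ j ∈ Finset.range N, ((j : ℂ) + 1) / p * s (a, j) +
        ∑ j ∈ Finset.range N, ((j : ℂ) + 1) / p * s (conjIdx a, j)) • basisVec x s := by
    intro a
    rw [mode_basisVec]
    rcases toList_pair (a, 0) (conjIdx a, 0) with h | h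
    · rw [h, wordMode_pair a x s hN]
    · have := wordMode_pair (conjIdx a) x s hN
      rw [conjIdx_conjIdx] at this
      rw [h, this]
      congr 1
      ring
  have homega : (omega : V (0 : Fin n → ZMod p)) = (1 / 2 : ℂ) • ∑ a : Idx p n,
      (p : ℂ) • basisVec (origin : Coset (0 : Fin n → ZMod p))
        (Finsupp.single (a, 0) 1 + Finsupp.single (conjIdx a, 0) 1) := by
    rw [omega]
    congr 1
    exact Finset.sum_congr rfl fun a _ => vacuum_omega_term a
  rw [homega, map_smul, map_sum, LinearMap.smul_apply, LinearMap.sum_apply]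
  simp only [map_smul, LinearMap.smul_apply, hpair, smul_smul]
  rw [← Finset.sum_smul, smul_smul]
  congr 1
  have hconj : ∀ f : Idx p n → ℂ, ∑ a, f (conjIdx a) = ∑ a, f a := fun f =>
    Equiv.sum_comp (Function.Involutive.toPerm conjIdx conjIdx_conjIdx) f
  have hdeg := fockDegree_eq s hN
  have h1 : ∑ a : Idx p n, ∑ j ∈ Finset.range N, ((j : ℂ) + 1) / p * s (a, j) =
      fockDegree s / p := by
    rw [hdeg, Finset.sum_div]
    refine Finset.sum_congr rfl fun a _ => ?_
    rw [Finset.sum_div]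
    exact Finset.sum_congr rfl fun j _ => by ring
  rw [← Finset.mul_sum, Finset.sum_add_distrib, Finset.sum_add_distrib,
    hconj (fun a => ∑ j ∈ Finset.range N, ((j : ℂ) + 1) / p * s (a, j)), h1]
  have h2 : ∑ a : Idx p n, emb x.1 a * emb x.1 (conjIdx a) / (p : ℂ) ^ 2 =
      form (emb x.1) (emb x.1) / p := by
    rw [form, Finset.sum_div]
    refine Finset.sum_congr rfl fun a _ => ?_
    rw [conjIdx]
    field_simp
  rw [h2]
  field_simp
  ring

end

end VirasoroAction

/-! ### The trace of `q^{L₀}` -/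

section Generating

/-- Adding one element to a finite set of allowed supports adds one free exponent. -/
theorem exists_insert_equiv {κ : Type*} [DecidableEq κ] {S : Finset κ} {a : κ} (ha : a ∉ S) :
    ∃ e : ℕ × {s : κ →₀ ℕ // s.support ⊆ S} ≃ {s : κ →₀ ℕ // s.support ⊆ insert a S},
      ∀ t k, (e t).1 k = if k = a then t.1 else t.2.1 k :=
  ⟨{  toFun := fun t => ⟨t.2.1.update a t.1, fun k hk => by
        by_cases h : k = a
        · simp [h]
        · refine Finset.mem_insert_of_mem (t.2.2 ?_)
          rw [Finsupp.mem_support_iff] at hk ⊢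
          simpa [Finsupp.coe_update, Function.update_of_ne h] using hk⟩
      invFun := fun s => (s.1 a, ⟨s.1.erase a, fun k hk => by
        rw [Finsupp.support_erase, Finset.mem_erase] at hk
        exact (Finset.mem_insert.1 (s.2 hk.2)).resolve_left hk.1⟩)
      left_inv := by
        rintro ⟨m, s, hs⟩
        have h0 : s a = 0 := by
          by_contra h
          exact ha (hs (Finsupp.mem_support_iff.2 h))
        refine Prod.ext (by simp) (Subtype.ext ?_)
        ext k
        by_cases h : k = a
        · subst h; simp [h0]
        · simp [Finsupp.erase_ne h]
      right_inv := by
        rintro ⟨s, hs⟩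
        refine Subtype.ext ?_
        ext k
        by_cases h : k = a
        · subst h; simp
        · simp },
    fun t k => by simp [Function.update_apply]⟩

/-- The generating function of multisets on a finite set. -/
theorem hasSum_finsupp_support_subset {𝕜 κ : Type*} [RCLike 𝕜] [DecidableEq κ] {y : κ → 𝕜}
    (hy : ∀ k, ‖y k‖ < 1) (S : Finset κ) :
    HasSum (fun s : {s : κ →₀ ℕ // s.support ⊆ S} => ∏ k ∈ S, y k ^ (s.1 k))
      (∏ k ∈ S, (1 - y k)⁻¹) := by
  induction S using Finset.induction_on with
  | empty =>
    have : Unique {s : κ →₀ ℕ // s.support ⊆ ∅} :=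
      ⟨⟨⟨0, by simp⟩⟩, fun s => Subtype.ext (by simpa using s.2)⟩
    simp
  | insert a S ha ih =>
    obtain ⟨e, he⟩ := exists_insert_equiv ha
    have hg := hasSum_geometric_of_norm_lt_one (hy a)
    have hmul := hg.mul ih (summable_mul_of_summable_norm (f := fun m : ℕ => y a ^ m)
      (g := fun s : {s : κ →₀ ℕ // s.support ⊆ S} => ∏ k ∈ S, y k ^ (s.1 k))
      hg.summable.norm ih.summable.norm)
    rw [Finset.prod_insert ha, ← e.hasSum_iff]
    refine Eq.subst (motive := fun f => HasSum f _) (funext fun t => ?_) hmul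
    symm
    rw [Function.comp_apply, Finset.prod_insert ha, he, if_pos rfl]
    congr 1
    refine Finset.prod_congr rfl fun k hk => ?_
    rw [he, if_neg (ne_of_mem_of_not_mem hk ha)]

/-- The generating function `∑_s y^s = ∏_k (1 - y_k)⁻¹` of multisets. -/
theorem hasProd_finsupp {κ : Type*} {y : κ → ℂ} {R : ℝ} (hR : R < 1) (hy : ∀ k, ‖y k‖ ≤ R)
    (hsum : Summable fun k => ‖y k‖) :
    (Summable fun s : κ →₀ ℕ => ‖s.prod fun k m => y k ^ m‖) ∧
      HasProd (fun k => (1 - y k)⁻¹) (∑' s : κ →₀ ℕ, s.prod fun k m => y k ^ m) := by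
  classical
  have hy1 : ∀ k, ‖y k‖ < 1 := fun k => (hy k).trans_lt hR
  have hsummable : Summable fun s : κ →₀ ℕ => ‖s.prod fun k m => y k ^ m‖ := by
    refine summable_of_sum_le (c := Real.exp ((1 - R)⁻¹ * ∑' k, ‖y k‖))
      (fun s => norm_nonneg _) fun T => ?_
    set S := T.sup Finsupp.support
    have hTS : ∀ s ∈ T, s.support ⊆ S := fun s hs => Finset.le_sup (f := Finsupp.support) hs
    have h1 := hasSum_finsupp_support_subset (y := fun k => ‖y k‖)
      (fun k => by simpa using hy1 k) S
    calc ∑ s ∈ T, ‖s.prod fun k m => y k ^ m‖ = ∑ s ∈ T, ∏ k ∈ S, ‖y k‖ ^ (s k) := by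
          refine Finset.sum_congr rfl fun s hs => ?_
          rw [Finsupp.prod_of_support_subset _ (hTS s hs) _ (by simp), norm_prod]
          simp only [norm_pow]
      _ = ∑ s ∈ T.subtype (fun s => s.support ⊆ S), ∏ k ∈ S, ‖y k‖ ^ (s.1 k) :=
          (Finset.sum_subtype_of_mem (fun s : κ →₀ ℕ => ∏ k ∈ S, ‖y k‖ ^ (s k)) hTS).symm
      _ ≤ ∏ k ∈ S, (1 - ‖y k‖)⁻¹ :=
          sum_le_hasSum _ (fun s _ => Finset.prod_nonneg fun k _ => by positivity) h1
      _ ≤ ∏ k ∈ S, Real.exp ((1 - R)⁻¹ * ‖y k‖) := by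
          refine Finset.prod_le_prod (fun k _ => inv_nonneg.2 (sub_nonneg.2 (hy1 k).le))
            fun k _ => ?_
          have h2 : 0 < 1 - ‖y k‖ := sub_pos.2 (hy1 k)
          have h3 : (1 - ‖y k‖)⁻¹ = (1 - ‖y k‖)⁻¹ * ‖y k‖ + 1 := by field_simp; ring
          rw [h3]
          refine le_trans ?_ (Real.add_one_le_exp _)
          gcongr
          exact hy k
      _ = Real.exp ((1 - R)⁻¹ * ∑ k ∈ S, ‖y k‖) := by rw [← Real.exp_sum, Finset.mul_sum]
      _ ≤ _ := by
          have : 0 ≤ (1 - R)⁻¹ := inv_nonneg.2 (sub_nonneg.2 hR.le)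
          gcongr
          exact hsum.sum_le_tsum _ fun k _ => norm_nonneg _
  refine ⟨hsummable, ?_⟩
  have h2 : ∀ S : Finset κ, ∏ k ∈ S, (1 - y k)⁻¹ =
      ∑' s : κ →₀ ℕ, if s.support ⊆ S then s.prod fun k m => y k ^ m else 0 := by
    intro S
    rw [← (hasSum_finsupp_support_subset hy1 S).tsum_eq]
    have h3 : ∀ s : {s : κ →₀ ℕ // s.support ⊆ S}, ∏ k ∈ S, y k ^ (s.1 k) =
        if s.1.support ⊆ S then s.1.prod fun k m => y k ^ m else 0 := fun s => by
      rw [if_pos s.2, Finsupp.prod_of_support_subset _ s.2 _ (by simp)]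
    rw [tsum_congr h3]
    refine Function.Injective.tsum_eq (f := fun s : κ →₀ ℕ =>
      if s.support ⊆ S then s.prod fun k m => y k ^ m else 0) Subtype.val_injective fun s hs => ?_
    by_contra h
    refine hs (if_neg fun h' => h ⟨⟨s, h'⟩, rfl⟩)
  rw [HasProd, SummationFilter.unconditional_filter]
  simp only [h2]
  refine tendsto_tsum_of_dominated_convergence hsummable (fun s => ?_)
    (Filter.Eventually.of_forall fun S s => ?_)
  · refine tendsto_const_nhds.congr' ?_
    filter_upwards [Filter.eventually_ge_atTop s.support] with S hS
    rw [if_pos hS]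
  · split_ifs
    · exact le_rfl
    · simp

end Generating

section Trace

set_option linter.unusedSectionVars false

/-- If `T` is diagonal in a basis, with eigenvalues `λ_i` such that `∑ q^{λ_i}` converges absolutely,
then the trace of `q^T` is defined and equals that sum. Finiteness of the multiplicities follows from
convergence. -/
theorem hasPartitionFunction_of_basis {M κ : Type*} [AddCommGroup M] [Module ℂ M]
    (B : Module.Basis κ ℂ M) {T : Module.End ℂ M} {ev : κ → ℂ} (hT : ∀ i, T (B i) = ev i • B i)
    (hsum : ∀ τ : UpperHalfPlane,
      Summable fun i => Complex.exp (2 * Real.pi * Complex.I * τ * ev i)) :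
    HasPartitionFunction M T ∧ ∀ (c : ℂ) (τ : UpperHalfPlane), partitionFunction M T c τ =
      (∑' i, Complex.exp (2 * Real.pi * Complex.I * τ * ev i)) *
        Complex.exp (-(2 * Real.pi * Complex.I * τ * (c / 24))) := by
  have heig : ∀ μ, T.eigenspace μ =
      Submodule.span ℂ (Set.range fun i : {i // ev i = μ} => B i) := by
    intro μ
    have himage : (Set.range fun i : {i // ev i = μ} => B i) = B '' {i | ev i = μ} := by
      ext x
      simp
    rw [himage]
    have hrepr : ∀ (x : M) i, B.repr (T x) i = ev i * B.repr x i := by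
      intro x i
      have : (B.coord i).comp T = ev i • B.coord i := by
        refine B.ext fun j => ?_
        simp only [LinearMap.comp_apply, hT, map_smul, LinearMap.smul_apply, B.coord_apply,
          B.repr_self, smul_eq_mul]
        by_cases h : j = i
        · simp [h]
        · simp [Finsupp.single_eq_of_ne (Ne.symm h)]
      exact LinearMap.congr_fun this x
    ext x
    rw [B.mem_span_image, Module.End.mem_eigenspace_iff]
    constructor
    · intro h i hi
      have h1 := hrepr x i
      rw [h, map_smul, Finsupp.smul_apply, smul_eq_mul] at h1
      exact (mul_right_cancel₀ (Finsupp.mem_support_iff.1 hi) h1).symm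
    · intro h
      refine B.repr.injective (Finsupp.ext fun i => ?_)
      rw [hrepr, map_smul, Finsupp.smul_apply, smul_eq_mul]
      by_cases hi : B.repr x i = 0
      · simp [hi]
      · rw [show ev i = μ from h (Finsupp.mem_support_iff.2 hi)]
  have hfin : ∀ μ, Finite {i // ev i = μ} := by
    intro μ
    by_contra hinf
    -- infinitely many equal nonzero terms at `τ = i`
    rw [not_finite_iff_infinite] at hinf
    have h := (hsum UpperHalfPlane.I).comp_injective
      (Subtype.val_injective (p := fun i => ev i = μ))
    have h2 : (fun i => Complex.exp (2 * Real.pi * Complex.I *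
        (UpperHalfPlane.I : UpperHalfPlane) * ev i)) ∘ (Subtype.val : {i // ev i = μ} → κ) =
        fun _ => Complex.exp (2 * Real.pi * Complex.I *
          (UpperHalfPlane.I : UpperHalfPlane) * μ) := by
      funext i
      simp only [Function.comp_apply]
      rw [i.2]
    rw [h2] at h
    exact Complex.exp_ne_zero _ ((summable_const_iff _).1 h)
  have hdim : ∀ μ, Module.finrank ℂ (T.eigenspace μ) = Nat.card {i // ev i = μ} := by
    intro μ
    have := hfin μ
    have hf := Fintype.ofFinite {i // ev i = μ}
    rw [heig, Nat.card_eq_fintype_card]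
    exact finrank_span_eq_card
      (B.linearIndependent.comp (Subtype.val : {i // ev i = μ} → κ) Subtype.val_injective)
  have hsig : ∀ τ : UpperHalfPlane, Summable fun y : Σ μ, {i // ev i = μ} =>
      Complex.exp (2 * Real.pi * Complex.I * τ * y.1) := by
    intro τ
    have := (Equiv.sigmaFiberEquiv ev).summable_iff.2 (hsum τ)
    refine this.congr fun y => ?_
    simp only [Function.comp_apply, Equiv.sigmaFiberEquiv, Equiv.coe_fn_mk]
    rw [y.2.2]
  have hinner : ∀ (τ : UpperHalfPlane) (μ : ℂ),
      ∑' _ : {i // ev i = μ}, Complex.exp (2 * Real.pi * Complex.I * τ * μ) =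
        (Module.finrank ℂ (T.eigenspace μ) : ℂ) * Complex.exp (2 * Real.pi * Complex.I * τ * μ) := by
    intro τ μ
    rw [tsum_const, hdim, nsmul_eq_mul]
  refine ⟨⟨?_, fun μ => ?_, fun τ => ?_⟩, fun c τ => ?_⟩
  · rw [eq_top_iff, ← B.span_eq, Submodule.span_le]
    rintro _ ⟨i, rfl⟩
    exact Submodule.mem_iSup_of_mem (ev i) (Module.End.mem_eigenspace_iff.2 (hT i))
  · have := hfin μ
    rw [heig]
    exact FiniteDimensional.span_of_finite ℂ (Set.finite_range _)
  · simpa only [hinner] using (hsig τ).sigma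
  · have h1 : ∑' i, Complex.exp (2 * Real.pi * Complex.I * τ * ev i) =
        ∑' μ : ℂ, (Module.finrank ℂ (T.eigenspace μ) : ℂ) *
          Complex.exp (2 * Real.pi * Complex.I * τ * μ) := by
      simp only [← hinner]
      rw [← (hsig τ).tsum_sigma, ← (Equiv.sigmaFiberEquiv ev).tsum_eq]
      refine tsum_congr fun y => ?_
      simp only [Equiv.sigmaFiberEquiv, Equiv.coe_fn_mk]
      rw [y.2.2]
    rw [partitionFunction, h1, ← tsum_mul_right]
    refine tsum_congr fun μ => ?_
    rw [mul_assoc (Module.finrank ℂ (T.eigenspace μ) : ℂ), ← Complex.exp_add]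
    congr 2
    ring

variable {p : ℕ} [Fact p.Prime] {n : ℕ}

noncomputable section

/-- The basis `X^s ⊗ e^x` of `V_{ℙ^n + w}`. -/
def vBasis (w : Fin n → ZMod p) : Module.Basis (Σ _ : Coset w, (Idx p n × ℕ →₀ ℕ)) ℂ (V w) :=
  Finsupp.basis fun _ => MvPolynomial.basisMonomials (Idx p n × ℕ) ℂ

theorem vBasis_apply (w : Fin n → ZMod p) (i : Σ _ : Coset w, (Idx p n × ℕ →₀ ℕ)) :
    vBasis w i = basisVec i.1 i.2 := by
  rw [vBasis, Finsupp.coe_basis, MvPolynomial.coe_basisMonomials]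
  rfl

variable (C : Submodule (ZMod p) (Fin n → ZMod p))

open Classical in
/-- The basis of `M_C` formed by the vectors `X^s ⊗ e^x`. -/
def mBasis : Module.Basis (Σ w : C, Σ _ : Coset (w : Fin n → ZMod p), (Idx p n × ℕ →₀ ℕ)) ℂ (M C) :=
  DFinsupp.basis fun w : C => vBasis (w : Fin n → ZMod p)

open Classical in
theorem mBasis_apply (i : Σ w : C, Σ _ : Coset (w : Fin n → ZMod p), (Idx p n × ℕ →₀ ℕ)) :
    mBasis C i = DirectSum.lof ℂ C (fun w : C => V (w : Fin n → ZMod p)) i.1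
      (basisVec i.2.1 i.2.2) := by
  rw [mBasis, Module.Basis.apply_eq_iff]
  change (sigmaFinsuppLequivDFinsupp ℂ).symm (DFinsupp.mapRange.linearEquiv
    (fun w : C => (vBasis (w : Fin n → ZMod p)).repr) (DFinsupp.single i.1 _)) = _
  rw [DFinsupp.mapRange.linearEquiv_apply, DFinsupp.mapRange_single, ← vBasis_apply _ i.2,
    Module.Basis.repr_self, LinearEquiv.symm_apply_eq]
  exact (sigmaFinsuppEquivDFinsupp_single i 1).symm

open Classical in
theorem L0_mBasis (i : Σ w : C, Σ _ : Coset (w : Fin n → ZMod p), (Idx p n × ℕ →₀ ℕ)) :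
    L0 C (mBasis C i) =
      (form (emb i.2.1.1) (emb i.2.1.1) / 2 + fockDegree i.2.2 : ℂ) • mBasis C i := by
  rw [mBasis_apply, L0, modeM, DirectSum.lmap_lof, mode_omega_basisVec, map_smul]

/-- The eigenvalue of `L₀` on `X^s ⊗ e^x` contributes a theta term times a power of `q`. -/
theorem exp_eigenvalue (hp : p ≠ 2) (τ : ℂ) (x : Fin n → O p) (d : ℕ) :
    Complex.exp (2 * Real.pi * Complex.I * τ * (form (emb x) (emb x) / 2 + d)) =
      thetaTerm (fun _ => τ) x * Complex.exp (2 * Real.pi * Complex.I * τ) ^ d := by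
  rw [thetaTerm_eq_exp, ← Complex.exp_nat_mul, ← Complex.exp_add]
  congr 1
  have h : form (emb x) (emb x) = 2 * ∑ l, (quadForm x l : ℂ) := by
    rw [← embR_dotProduct]
    have := sum_embR_sq hp x
    simp only [sq] at this
    rw [dotProduct, this]
    push_cast
    rfl
  rw [h, ← Finset.mul_sum]
  ring

theorem norm_exp_lt_one (τ : UpperHalfPlane) :
    ‖Complex.exp (2 * Real.pi * Complex.I * τ)‖ < 1 :=
  UpperHalfPlane.norm_exp_two_pi_I_lt_one τ

/-- The character of the Fock space: `∑_s q^{deg s} = ∏_m (1 - q^{m+1})^{-n(p-1)}`. -/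
theorem fock_character {q : ℂ} (hq : ‖q‖ < 1) :
    (Summable fun s : Idx p n × ℕ →₀ ℕ => ‖q ^ fockDegree s‖) ∧
      (∑' s : Idx p n × ℕ →₀ ℕ, q ^ fockDegree s) *
        (∏' m : ℕ, (1 - q ^ (m + 1))) ^ (n * (p - 1)) = 1 := by
  have hterm : ∀ s : Idx p n × ℕ →₀ ℕ,
      (s.prod fun i k => (q ^ (i.2 + 1)) ^ k) = q ^ fockDegree s := by
    intro s
    rw [fockDegree, Finsupp.sum, ← Finset.prod_pow_eq_pow_sum]
    exact Finset.prod_congr rfl fun i _ => (pow_mul _ _ _).symm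
  have hsum : Summable fun i : Idx p n × ℕ => ‖q ^ (i.2 + 1)‖ := by
    have h1 : Summable fun m : ℕ => ‖q ^ (m + 1)‖ := by
      simp only [norm_pow]
      exact (summable_nat_add_iff 1).2 (summable_geometric_of_lt_one (norm_nonneg _) hq)
    have h2 := Summable.mul_of_nonneg (Summable.of_finite (f := fun _ : Idx p n => (1 : ℝ))) h1
      (fun _ => zero_le_one) (fun _ => norm_nonneg _)
    simpa using h2
  have hle : ∀ i : Idx p n × ℕ, ‖q ^ (i.2 + 1)‖ ≤ ‖q‖ := fun i => by
    rw [norm_pow, pow_succ]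
    exact mul_le_of_le_one_left (norm_nonneg _) (pow_le_one₀ (norm_nonneg _) hq.le)
  obtain ⟨hs, hprod⟩ := hasProd_finsupp hq hle hsum
  simp only [hterm] at hs hprod
  refine ⟨hs, ?_⟩
  have hne : ∀ i : Idx p n × ℕ, 1 - q ^ (i.2 + 1) ≠ 0 := fun i h => by
    have h1 : q ^ (i.2 + 1) = 1 := (sub_eq_zero.1 h).symm
    have h2 := (hle i).trans_lt hq
    rw [h1, norm_one] at h2
    exact lt_irrefl _ h2
  have hmult : Multipliable fun i : Idx p n × ℕ => 1 - q ^ (i.2 + 1) := by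
    have := multipliable_one_add_of_summable (f := fun i : Idx p n × ℕ => -q ^ (i.2 + 1))
      (by simpa using hsum)
    simpa [sub_eq_add_neg] using this
  have hfib := hmult.hasProd.prod_fiberwise
    (fun _ => (ModularForm.multipliable_one_sub_pow hq).hasProd)
  have hfin := hfib.unique (hasProd_fintype _)
  rw [Finset.prod_const, Finset.card_univ, Fintype.card_prod, Fintype.card_fin,
    Fintype.card_fin] at hfin
  have hone := hprod.mul hmult.hasProd
  simp only [inv_mul_cancel₀ (hne _)] at hone
  rw [← hfin]
  exact hone.unique hasProd_one

/-- The splitting of the basis of `M_C` into lattice vectors and Fock space monomials. -/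
def indexEquiv : (Σ w : C, Σ _ : Coset (w : Fin n → ZMod p), (Idx p n × ℕ →₀ ℕ)) ≃
    codeLattice C × (Idx p n × ℕ →₀ ℕ) :=
  ((Equiv.sigmaCongrRight fun _ => Equiv.sigmaEquivProd _ _).trans
    (Equiv.sigmaProdDistrib _ _).symm).trans ((cosetEquiv C).prodCongr (Equiv.refl _))

theorem const_mem_Hr (τ : UpperHalfPlane) : (fun _ => (τ : ℂ)) ∈ Hr p := fun _ => τ.im_pos

theorem eta_eq (τ : UpperHalfPlane) : ModularForm.eta (τ : ℂ) =
    Complex.exp (2 * Real.pi * Complex.I * τ / 24) *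
      ∏' m : ℕ, (1 - Complex.exp (2 * Real.pi * Complex.I * τ) ^ (m + 1)) := by
  simp only [ModularForm.eta, ModularForm.eta_q_eq_pow, Function.Periodic.qParam]
  norm_num

/-- The trace of `q^{L₀}` on `M_C` converges, and after normalization by `η^{n(p-1)}` the character
is the theta function of `ρ⁻¹(C)` on the diagonal. -/
theorem hasPartitionFunction_and_Z (hp : p ≠ 2) :
    HasPartitionFunction (M C) (L0 C) ∧
      ∀ τ : UpperHalfPlane, Z C τ = codeTheta C (fun _ => (τ : ℂ)) := by
  have hterm : ∀ (τ : UpperHalfPlane)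
      (i : Σ w : C, Σ _ : Coset (w : Fin n → ZMod p), (Idx p n × ℕ →₀ ℕ)),
      Complex.exp (2 * Real.pi * Complex.I * τ *
        (form (emb i.2.1.1) (emb i.2.1.1) / 2 + fockDegree i.2.2)) =
      (fun y : codeLattice C × (Idx p n × ℕ →₀ ℕ) => thetaTerm (fun _ => (τ : ℂ)) y.1.1 *
        Complex.exp (2 * Real.pi * Complex.I * τ) ^ fockDegree y.2) (indexEquiv C i) :=
    fun τ i => exp_eigenvalue hp τ i.2.1.1 (fockDegree i.2.2)
  have hθ := fun τ : UpperHalfPlane => (summable_thetaTerm C hp (const_mem_Hr (p := p) τ)).norm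
  have hF := fun τ : UpperHalfPlane => fock_character (p := p) (n := n) (norm_exp_lt_one τ)
  have hsum : ∀ τ : UpperHalfPlane, Summable fun i :
      Σ w : C, Σ _ : Coset (w : Fin n → ZMod p), (Idx p n × ℕ →₀ ℕ) =>
      Complex.exp (2 * Real.pi * Complex.I * τ *
        (form (emb i.2.1.1) (emb i.2.1.1) / 2 + fockDegree i.2.2)) := fun τ => by
    have h := summable_mul_of_summable_norm (hθ τ) (hF τ).1
    exact ((indexEquiv C).summable_iff.2 h).congr fun i => (hterm τ i).symm
  have h := @hasPartitionFunction_of_basis (M C) _ _ _ (mBasis C) (L0 C) _ (L0_mBasis C) hsum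
  refine ⟨h.1, fun τ => ?_⟩
  rw [Z, h.2]
  simp only [hterm]
  rw [(indexEquiv C).tsum_eq (fun y : codeLattice C × (Idx p n × ℕ →₀ ℕ) =>
      thetaTerm (fun _ => (τ : ℂ)) y.1.1 *
        Complex.exp (2 * Real.pi * Complex.I * τ) ^ fockDegree y.2),
    ← tsum_mul_tsum_of_summable_norm (hθ τ) (hF τ).1, eta_eq, mul_pow, ← Complex.exp_nat_mul]
  have hexp : Complex.exp ((n * (p - 1) : ℕ) * (2 * Real.pi * Complex.I * τ / 24)) *
      Complex.exp (-(2 * Real.pi * Complex.I * τ * (centralCharge p n / 24))) = 1 := by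
    rw [← Complex.exp_add, centralCharge, ← Complex.exp_zero]
    congr 1
    ring
  have hF2 := (hF τ).2
  rw [codeTheta]
  linear_combination (∑' x : codeLattice C, thetaTerm (fun _ => (τ : ℂ)) x.1) *
    ((∑' s : Idx p n × ℕ →₀ ℕ, Complex.exp (2 * Real.pi * Complex.I * τ) ^ fockDegree s) *
      (∏' m : ℕ, (1 - Complex.exp (2 * Real.pi * Complex.I * τ) ^ (m + 1))) ^ (n * (p - 1)) *
        hexp + hF2)

end

end Trace

/-! ### Modularity on the diagonal -/

section Diagonal

set_option linter.unusedSectionVars false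

variable {p : ℕ} [Fact p.Prime] {n : ℕ} (C : Submodule (ZMod p) (Fin n → ZMod p))

noncomputable section

open scoped MatrixGroups ModularForm Manifold
open UpperHalfPlane

/-- The restriction of the theta function of `C` to the diagonal of `ℍ^r`. -/
def diagTheta (τ : ℍ) : ℂ := codeTheta C (fun _ => (τ : ℂ))

/-- At `τ = i` all terms of the theta series are positive. -/
theorem diagTheta_I_ne_zero (hp : p ≠ 2) : diagTheta C I ≠ 0 := by
  have hterm : ∀ x : codeLattice C, thetaTerm (fun _ => ((I : ℍ) : ℂ)) x.1 =
      ((Real.exp (-(2 * Real.pi * ∑ l, quadForm x.1 l)) : ℝ) : ℂ) := by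
    intro x
    rw [thetaTerm_eq_exp, Complex.ofReal_exp]
    congr 1
    push_cast
    rw [← Finset.mul_sum]
    linear_combination (2 * Real.pi * ∑ l, (quadForm x.1 l : ℂ)) * Complex.I_mul_I
  rw [diagTheta, codeTheta]
  simp only [hterm]
  rw [← Complex.ofReal_tsum, Complex.ofReal_ne_zero]
  have hs := summable_exp_quadForm C hp (c := 2 * Real.pi) Real.two_pi_pos
  exact (hs.tsum_pos (fun _ => (Real.exp_pos _).le) 0 (Real.exp_pos _)).ne'

variable {C}

theorem diagTheta_vadd (hp : p ≠ 2) (hC : IsSelfDual C) (τ : ℍ) :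
    diagTheta C ((1 : ℝ) +ᵥ τ) = diagTheta C τ := by
  rw [diagTheta, diagTheta, ← codeTheta_add hp hC 1 (fun _ => (τ : ℂ))]
  congr 1
  funext l
  simp [add_comm]

theorem diagTheta_inv (hp : p ≠ 2) (hC : IsSelfDual C) (τ : ℍ) :
    diagTheta C (ModularGroup.S • τ) =
      (-Complex.I * τ) ^ (n * ((p - 1) / 2)) * diagTheta C τ := by
  have h := codeTheta_inv hp hC (const_mem_Hr (p := p) τ)
  rw [Finset.prod_const, Finset.card_univ, Fintype.card_fin, ← pow_mul] at h
  rw [diagTheta, diagTheta, ← h]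
  congr 1
  funext l
  rw [UpperHalfPlane.modular_S_smul, UpperHalfPlane.coe_mk]
  rw [neg_div, one_div, inv_neg]

/-- The multiplier of the theta function under `τ ↦ -1/τ` is trivial: this follows from the relation
`(ST)^3 = -1` in `SL₂(ℤ)`, because the theta function is invariant under `τ ↦ τ + 1` and is not
identically zero. -/
theorem neg_I_pow_eq_one (hp : p ≠ 2) (hC : IsSelfDual C) :
    (-Complex.I) ^ (n * ((p - 1) / 2)) = 1 := by
  set k := n * ((p - 1) / 2)
  have hST : ∀ τ : ℍ, diagTheta C (ModularGroup.S • ((1 : ℝ) +ᵥ τ)) =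
      (-Complex.I * ((1 : ℝ) +ᵥ τ : ℍ)) ^ k * diagTheta C τ := fun τ => by
    rw [diagTheta_inv hp hC, diagTheta_vadd hp hC]
  have hcoe : ∀ τ : ℍ, ((ModularGroup.S • ((1 : ℝ) +ᵥ τ) : ℍ) : ℂ) = -1 / (1 + τ) := fun τ => by
    rw [UpperHalfPlane.modular_S_smul, UpperHalfPlane.coe_mk, UpperHalfPlane.coe_vadd]
    rw [neg_div, one_div, inv_neg]
    simp
  have h0 : (Complex.I : ℂ) ≠ 0 := Complex.I_ne_zero
  have h1 : (1 + Complex.I : ℂ) ≠ 0 := fun h => by simpa using congrArg Complex.im h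
  -- The orbit of `i` under `τ ↦ -1/(τ + 1)`, which has order three.
  set τ₁ : ℍ := ModularGroup.S • ((1 : ℝ) +ᵥ (I : ℍ)) with hτ₁
  set τ₂ : ℍ := ModularGroup.S • ((1 : ℝ) +ᵥ τ₁) with hτ₂
  have e1 : (τ₁ : ℂ) = -1 / (1 + Complex.I) := by rw [hτ₁, hcoe, UpperHalfPlane.coe_I]
  have e1' : 1 + (τ₁ : ℂ) = Complex.I / (1 + Complex.I) := by
    rw [e1]
    field_simp
    ring
  have e2 : (τ₂ : ℂ) = -(1 + Complex.I) / Complex.I := by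
    rw [hτ₂, hcoe, e1']
    field_simp
  have e2' : 1 + (τ₂ : ℂ) = -1 / Complex.I := by
    rw [e2]
    field_simp
    ring
  have e3 : ModularGroup.S • ((1 : ℝ) +ᵥ τ₂) = (I : ℍ) := by
    refine UpperHalfPlane.ext ?_
    rw [hcoe, e2', UpperHalfPlane.coe_I]
    field_simp
  have h := hST τ₂
  rw [e3, hτ₂, hST τ₁, hτ₁, hST I] at h
  have hpow : ((-Complex.I * (1 + τ₂)) * (-Complex.I * (1 + τ₁)) *
      (-Complex.I * (1 + Complex.I))) ^ k = 1 := by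
    refine mul_right_cancel₀ (diagTheta_I_ne_zero C hp) ?_
    rw [one_mul]
    conv_rhs => rw [h]
    rw [mul_pow, mul_pow]
    simp only [UpperHalfPlane.coe_vadd, Complex.ofReal_one, UpperHalfPlane.coe_I, ← hτ₁, ← hτ₂]
    ring
  rw [← hpow, e1', e2']
  congr 1
  field_simp
  linear_combination (-1 : ℂ) * Complex.I_sq

theorem diagTheta_slash_S (hp : p ≠ 2) (hC : IsSelfDual C) :
    diagTheta C ∣[((n * ((p - 1) / 2) : ℕ) : ℤ)] ModularGroup.S = diagTheta C := by
  funext τ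
  rw [ModularForm.SL_slash_apply, diagTheta_inv hp hC, mul_pow, neg_I_pow_eq_one hp hC,
    ModularGroup.denom_S, zpow_neg, zpow_natCast]
  field_simp [UpperHalfPlane.ne_zero τ]

theorem diagTheta_slash_T (hp : p ≠ 2) (hC : IsSelfDual C) :
    diagTheta C ∣[((n * ((p - 1) / 2) : ℕ) : ℤ)] ModularGroup.T = diagTheta C := by
  funext τ
  rw [ModularForm.SL_slash_apply, UpperHalfPlane.modular_T_smul, diagTheta_vadd hp hC,
    ModularGroup.denom_apply, ModularGroup.coe_T]
  simp

theorem mdifferentiable_diagTheta (hp : p ≠ 2) : MDiff (diagTheta C) := by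
  rw [UpperHalfPlane.mdifferentiable_iff]
  have h : DifferentiableOn ℂ (fun τ : ℂ => codeTheta C fun _ => τ) {τ | 0 < τ.im} :=
    (differentiableOn_codeTheta C hp).comp
      (differentiable_pi.2 fun _ => differentiable_id).differentiableOn fun τ hτ _ => hτ
  refine h.congr fun τ hτ => ?_
  simp [diagTheta, UpperHalfPlane.ofComplex_apply_of_im_pos hτ]

theorem isBoundedAtImInfty_diagTheta (hp : p ≠ 2) : IsBoundedAtImInfty (diagTheta C) := by
  rw [UpperHalfPlane.isBoundedAtImInfty_iff]
  refine ⟨∑' x : codeLattice C, Real.exp (-(2 * Real.pi * 1 * ∑ l, quadForm x.1 l)), 1,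
    fun τ hτ => ?_⟩
  exact tsum_of_norm_bounded (summable_exp_quadForm C hp (by positivity)).hasSum
    fun x => norm_thetaTerm_le (fun _ => hτ) x.1

/-- The theta function of a self-dual code, restricted to the diagonal, as a modular form. -/
def diagThetaForm (hp : p ≠ 2) (hC : IsSelfDual C) :
    ModularForm (Matrix.SpecialLinearGroup.mapGL ℝ : Matrix.SpecialLinearGroup (Fin 2) ℤ →* _).range
      ((n * ((p - 1) / 2) : ℕ) : ℤ) where
  toFun := diagTheta C
  slash_action_eq' A hA := by
    obtain ⟨A, rfl⟩ := hA
    exact SlashInvariantForm.slash_action_generators_SL2Z (diagTheta_slash_S hp hC)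
      (diagTheta_slash_T hp hC) A
  holo' := mdifferentiable_diagTheta hp
  bdd_at_cusps' {c} hc := by
    rw [Subgroup.IsArithmetic.isCusp_iff_isCusp_SL2Z] at hc
    rw [OnePoint.isBoundedAt_iff_forall_SL2Z hc]
    intro γ _
    rw [SlashInvariantForm.slash_action_generators_SL2Z (diagTheta_slash_S hp hC)
      (diagTheta_slash_T hp hC)]
    exact isBoundedAtImInfty_diagTheta hp

theorem diagThetaForm_apply (hp : p ≠ 2) (hC : IsSelfDual C) (τ : ℍ) :
    diagThetaForm hp hC τ = codeTheta C (fun _ => (τ : ℂ)) := rfl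

end

end Diagonal

/-! ### Generators of `SL₂` over a Euclidean ring -/

section Generators

variable {R : Type*} [CommRing R]

/-- The translation matrix `(1 b; 0 1)`. -/
def translation (b : R) : Matrix.SpecialLinearGroup (Fin 2) R :=
  ⟨!![1, b; 0, 1], by simp [Matrix.det_fin_two_of]⟩

/-- The inversion matrix `(0 -1; 1 0)`. -/
def inversion (R : Type*) [CommRing R] : Matrix.SpecialLinearGroup (Fin 2) R :=
  ⟨!![0, -1; 1, 0], by simp [Matrix.det_fin_two_of]⟩

theorem coe_translation (b : R) : (translation b).1 = !![1, b; 0, 1] := rfl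

theorem coe_inversion : (inversion R).1 = !![0, -1; 1, 0] := rfl

theorem translation_apply (b : R) (i j : Fin 2) :
    translation b i j = (!![1, b; 0, 1] : Matrix (Fin 2) (Fin 2) R) i j := rfl

theorem inversion_apply (i j : Fin 2) :
    inversion R i j = (!![0, -1; 1, 0] : Matrix (Fin 2) (Fin 2) R) i j := rfl

theorem inversion_mul_translation_mul {a b d : R} (h : a * d = 1)
    {X : Matrix (Fin 2) (Fin 2) R} (hX : X = !![a, b; 0, d]) :
    !![0, -1; 1, 0] * !![1, a; 0, 1] * !![0, -1; 1, 0] * !![1, d; 0, 1] * !![0, -1; 1, 0] *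
      X = !![0, -1; 1, 0] * !![0, -1; 1, 0] * !![1, d * b - d; 0, 1] := by
  simp only [hX, Matrix.mul_fin_two]
  ext i j
  fin_cases i <;> fin_cases j <;> simp
  · linear_combination h
  · ring
  · linear_combination a * h
  · linear_combination (b - 1) * h

/-- Over a ring with a Euclidean algorithm, `SL₂` is generated by inversion and translations: the
Euclidean algorithm on the first column reduces to upper triangular matrices. -/
theorem eq_top_of_euclidean (N : R → ℕ) (hN : ∀ a c : R, c ≠ 0 → ∃ q, N (a - q * c) < N c)
    (H : Subgroup (Matrix.SpecialLinearGroup (Fin 2) R)) (hS : inversion R ∈ H)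
    (hT : ∀ b, translation b ∈ H) : H = ⊤ := by
  suffices h : ∀ m : ℕ, ∀ A : Matrix.SpecialLinearGroup (Fin 2) R, N (A 1 0) = m → A ∈ H from
    eq_top_iff.2 fun A _ => h _ A rfl
  intro m
  induction m using Nat.strong_induction_on with
  | _ m ih =>
    intro A hA
    have hdet : A 0 0 * A 1 1 - A 0 1 * A 1 0 = 1 := by
      rw [← Matrix.det_fin_two]
      exact A.2
    by_cases hc : A 1 0 = 0
    · rw [hc, mul_zero, sub_zero] at hdet
      -- The product below is `-(1 x; 0 1)`, which also lies in `H`.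
      have key : inversion R * translation (A 0 0) * inversion R * translation (A 1 1) *
          inversion R * A = inversion R * inversion R *
            translation (A 1 1 * A 0 1 - A 1 1) := by
        have hA1 : A.1 = !![A 0 0, A 0 1; 0, A 1 1] := by
          rw [← hc]
          exact Matrix.eta_fin_two A.1
        refine Subtype.ext ?_
        simp only [Matrix.SpecialLinearGroup.coe_mul, coe_translation, coe_inversion]
        exact inversion_mul_translation_mul hdet hA1
      have h : inversion R * translation (A 0 0) * inversion R * translation (A 1 1) *
          inversion R * A ∈ H := by
        rw [key]
        exact H.mul_mem (H.mul_mem hS hS) (hT _)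
      exact (H.mul_mem_cancel_left (H.mul_mem (H.mul_mem (H.mul_mem (H.mul_mem hS (hT _)) hS)
        (hT _)) hS)).1 h
    · obtain ⟨q, hq⟩ := hN (A 0 0) (A 1 0) hc
      have h : inversion R * translation (-q) * A ∈ H := by
        refine ih _ (hA ▸ hq) _ (congrArg N ?_)
        simp only [Matrix.SpecialLinearGroup.coe_mul, coe_translation, coe_inversion]
        rw [Matrix.eta_fin_two A.1]
        simp only [Matrix.mul_fin_two]
        simp
        ring
      exact (H.mul_mem_cancel_left (H.mul_mem hS (hT _))).1 h

end Generators

/-! ### The action of `SL₂(𝒪_k)` -/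

section Action

set_option linter.unusedSectionVars false

variable {p : ℕ} [Fact p.Prime] {n : ℕ}

noncomputable section

theorem moebius_im_pos {a b c d z : ℂ} (ha : starRingEnd ℂ a = a) (hb : starRingEnd ℂ b = b)
    (hc : starRingEnd ℂ c = c) (hd : starRingEnd ℂ d = d) (h : a * d - b * c = 1)
    (hz : 0 < z.im) : c * z + d ≠ 0 ∧ 0 < ((a * z + b) / (c * z + d)).im := by
  obtain ⟨a, rfl⟩ := Complex.conj_eq_iff_real.1 ha
  obtain ⟨b, rfl⟩ := Complex.conj_eq_iff_real.1 hb
  obtain ⟨c, rfl⟩ := Complex.conj_eq_iff_real.1 hc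
  obtain ⟨d, rfl⟩ := Complex.conj_eq_iff_real.1 hd
  have hdet : a * d - b * c = 1 := by exact_mod_cast h
  have hne : (c : ℂ) * z + d ≠ 0 := by
    intro h0
    have him : c * z.im = 0 := by simpa using congrArg Complex.im h0
    have hc0 : c = 0 := (mul_eq_zero.1 him).resolve_right hz.ne'
    have hd0 : d = 0 := by simpa [hc0] using congrArg Complex.re h0
    simp [hc0, hd0] at hdet
  refine ⟨hne, ?_⟩
  rw [Complex.div_im, ← sub_div]
  refine div_pos ?_ (Complex.normSq_pos.2 hne)
  have : ((a : ℂ) * z + b).im * ((c : ℂ) * z + d).re - ((a : ℂ) * z + b).re * ((c : ℂ) * z + d).im =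
      z.im := by
    simp only [Complex.add_im, Complex.mul_im, Complex.add_re, Complex.mul_re, Complex.ofReal_re,
      Complex.ofReal_im]
    linear_combination z.im * hdet
  rw [this]
  exact hz

/-- The embedding of `𝒪_k` obtained by restricting `σ_l`. -/
def kEmb (l : Fin ((p - 1) / 2)) : Ok p →+* ℂ :=
  (sigmaHalf p l : F p →+* ℂ).comp
    ((algebraMap (k p) (F p)).comp (algebraMap (Ok p) (k p)))

theorem kEmb_apply (l : Fin ((p - 1) / 2)) (b : Ok p) :
    kEmb l b = sigmaHalf p l ((b : k p) : F p) := rfl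

/-- The factors `σ_l(c) z_l + σ_l(d)`. -/
def autFactor (A : Matrix.SpecialLinearGroup (Fin 2) (Ok p)) (z : Fin ((p - 1) / 2) → ℂ)
    (l : Fin ((p - 1) / 2)) : ℂ :=
  kEmb l (A 1 0) * z l + kEmb l (A 1 1)

theorem moeb_apply (A : Matrix.SpecialLinearGroup (Fin 2) (Ok p)) (z : Fin ((p - 1) / 2) → ℂ)
    (l : Fin ((p - 1) / 2)) :
    moeb A z l = (kEmb l (A 0 0) * z l + kEmb l (A 0 1)) / autFactor A z l := rfl

theorem kEmb_det (A : Matrix.SpecialLinearGroup (Fin 2) (Ok p)) (l : Fin ((p - 1) / 2)) :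
    kEmb l (A 0 0) * kEmb l (A 1 1) - kEmb l (A 0 1) * kEmb l (A 1 0) = 1 := by
  rw [← map_mul, ← map_mul, ← map_sub, ← Matrix.det_fin_two, A.2, map_one]

theorem autFactor_ne_zero (A : Matrix.SpecialLinearGroup (Fin 2) (Ok p))
    {z : Fin ((p - 1) / 2) → ℂ} (hz : z ∈ Hr p) (l : Fin ((p - 1) / 2)) : autFactor A z l ≠ 0 :=
  (moebius_im_pos (conj_sigmaHalf_k l _) (conj_sigmaHalf_k l _) (conj_sigmaHalf_k l _)
    (conj_sigmaHalf_k l _) (kEmb_det A l) (hz l)).1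

theorem moeb_mem_Hr (A : Matrix.SpecialLinearGroup (Fin 2) (Ok p))
    {z : Fin ((p - 1) / 2) → ℂ} (hz : z ∈ Hr p) : moeb A z ∈ Hr p := fun l =>
  (moebius_im_pos (conj_sigmaHalf_k l _) (conj_sigmaHalf_k l _) (conj_sigmaHalf_k l _)
    (conj_sigmaHalf_k l _) (kEmb_det A l) (hz l)).2

theorem coe_mul_apply (A B : Matrix.SpecialLinearGroup (Fin 2) (Ok p)) (i j : Fin 2) :
    (A * B) i j = A i 0 * B 0 j + A i 1 * B 1 j := by
  rw [Matrix.SpecialLinearGroup.coe_mul, Matrix.mul_apply, Fin.sum_univ_two]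

theorem autFactor_mul (A B : Matrix.SpecialLinearGroup (Fin 2) (Ok p))
    {z : Fin ((p - 1) / 2) → ℂ} (hz : z ∈ Hr p) (l : Fin ((p - 1) / 2)) :
    autFactor (A * B) z l = autFactor A (moeb B z) l * autFactor B z l := by
  have h := autFactor_ne_zero B hz l
  rw [autFactor, autFactor, moeb_apply, add_mul, mul_assoc, div_mul_cancel₀ _ h, autFactor,
    coe_mul_apply, coe_mul_apply]
  simp only [map_add, map_mul]
  ring

theorem moeb_mul (A B : Matrix.SpecialLinearGroup (Fin 2) (Ok p))
    {z : Fin ((p - 1) / 2) → ℂ} (hz : z ∈ Hr p) : moeb (A * B) z = moeb A (moeb B z) := by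
  funext l
  have hB := autFactor_ne_zero B hz l
  have key : (kEmb l (A 0 0) * moeb B z l + kEmb l (A 0 1)) * autFactor B z l =
      kEmb l ((A * B) 0 0) * z l + kEmb l ((A * B) 0 1) := by
    rw [moeb_apply, add_mul, mul_assoc, div_mul_cancel₀ _ hB, autFactor, coe_mul_apply,
      coe_mul_apply]
    simp only [map_add, map_mul]
    ring
  rw [moeb_apply, moeb_apply A, autFactor_mul A B hz, ← key, mul_div_mul_right _ _ hB]

theorem moeb_one (z : Fin ((p - 1) / 2) → ℂ) :
    moeb (1 : Matrix.SpecialLinearGroup (Fin 2) (Ok p)) z = z := by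
  funext l
  simp [moeb_apply, autFactor]

theorem autFactor_one (z : Fin ((p - 1) / 2) → ℂ) (l : Fin ((p - 1) / 2)) :
    autFactor (1 : Matrix.SpecialLinearGroup (Fin 2) (Ok p)) z l = 1 := by
  simp [autFactor]

/-- The matrices in `SL₂(𝒪_k)` for which `f` transforms as a Hilbert modular form of parallel
weight `m`. -/
def modularitySubgroup (m : ℕ) (f : (Fin ((p - 1) / 2) → ℂ) → ℂ) :
    Subgroup (Matrix.SpecialLinearGroup (Fin 2) (Ok p)) where
  carrier := {A | ∀ z ∈ Hr p, f (moeb A z) = f z * ∏ l, autFactor A z l ^ m}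
  one_mem' z _ := by simp [moeb_one, autFactor_one]
  mul_mem' {A B} hA hB z hz := by
    rw [moeb_mul A B hz, hA _ (moeb_mem_Hr B hz), hB z hz, mul_assoc, ← Finset.prod_mul_distrib]
    simp only [autFactor_mul A B hz, mul_pow, mul_comm]
  inv_mem' {A} hA z hz := by
    have h := hA _ (moeb_mem_Hr A⁻¹ hz)
    rw [← moeb_mul A A⁻¹ hz, mul_inv_cancel, moeb_one] at h
    rw [h, mul_assoc, ← Finset.prod_mul_distrib]
    simp only [← mul_pow, ← autFactor_mul A A⁻¹ hz, mul_inv_cancel, autFactor_one, one_pow,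
      Finset.prod_const_one, mul_one]

theorem translation_mem_modularitySubgroup {C : Submodule (ZMod p) (Fin n → ZMod p)} (hp : p ≠ 2)
    (hC : IsSelfDual C) (b : Ok p) (m : ℕ) :
    translation b ∈ modularitySubgroup m (codeTheta C) := by
  intro z _
  have h1 : moeb (translation b) z = fun l => z l + sigmaHalf p l ((b : k p) : F p) := by
    funext l
    simp [moeb_apply, autFactor, translation_apply, kEmb_apply]
  have h2 : ∀ l, autFactor (translation b) z l = 1 := fun l => by
    simp [autFactor, translation_apply]
  rw [h1, codeTheta_add hp hC]
  simp [h2]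

theorem inversion_mem_modularitySubgroup {C : Submodule (ZMod p) (Fin n → ZMod p)} (hp : p ≠ 2)
    (hC : IsSelfDual C) : inversion (Ok p) ∈ modularitySubgroup n (codeTheta C) := by
  intro z hz
  have h1 : moeb (inversion (Ok p)) z = fun l => -1 / z l := by
    funext l
    simp [moeb_apply, autFactor, inversion_apply]
  have h2 : ∀ l, autFactor (inversion (Ok p)) z l = z l := fun l => by
    simp [autFactor, inversion_apply]
  rw [h1, codeTheta_inv hp hC hz, mul_comm]
  simp only [h2, mul_pow, Finset.prod_mul_distrib, Finset.prod_const, Finset.card_univ,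
    Fintype.card_fin]
  rw [← pow_mul, neg_I_pow_eq_one hp hC, one_mul]

end

end Action

/-! ### The field `ℚ(√5)` and the symmetry of the theta function for `p = 5` -/

section Five

set_option linter.unusedSectionVars false

variable [Fact (Nat.Prime 5)] {n : ℕ}

noncomputable section

/-- The index of the embedding `σ_1`. -/
def idx0 : Fin ((5 - 1) / 2) := ⟨0, by norm_num⟩

/-- The index of the embedding `σ_2`. -/
def idx1 : Fin ((5 - 1) / 2) := ⟨1, by norm_num⟩

theorem eq_idx0_or_idx1 (l : Fin ((5 - 1) / 2)) : l = idx0 ∨ l = idx1 := by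
  have h : (l : ℕ) < 2 := l.2
  rcases (by omega : (l : ℕ) = 0 ∨ (l : ℕ) = 1) with h | h
  · exact Or.inl (Fin.ext h)
  · exact Or.inr (Fin.ext h)

theorem sum_idx {R : Type*} [AddCommMonoid R] (g : Fin ((5 - 1) / 2) → R) :
    ∑ l, g l = g idx0 + g idx1 := Fin.sum_univ_two g

theorem sigmaHalf_idx1_zeta : sigmaHalf 5 idx1 (zeta 5) = sigmaHalf 5 idx0 (zeta 5) ^ 2 := by
  rw [sigmaHalf, sigmaHalf, sigma_zeta, sigma_zeta, ← Complex.exp_nat_mul]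
  congr 1
  simp only [idx0, idx1, Fin.val_castLE]
  push_cast
  ring

theorem zeta_five_sum : 1 + zeta 5 + zeta 5 ^ 2 + zeta 5 ^ 3 + zeta 5 ^ 4 = 0 := by
  have h := (zeta_spec 5).geom_sum_eq_zero (by norm_num)
  simpa [Finset.sum_range_succ] using h

theorem zeta_five_pow : zeta 5 ^ 5 = 1 := (zeta_spec 5).pow_eq_one

theorem zeta_five_inv : (zeta 5)⁻¹ = zeta 5 ^ 4 :=
  inv_eq_of_mul_eq_one_right (by rw [← pow_succ', zeta_five_pow])

/-- The generator `ζ + ζ⁻¹ = (-1 + √5) / 2` of `ℚ(√5)`. -/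
def eta5 : k 5 := ⟨zeta 5 + (zeta 5)⁻¹, IntermediateField.mem_adjoin_simple_self ℚ _⟩

theorem coe_eta5 : (eta5 : F 5) = zeta 5 + zeta 5 ^ 4 := by
  rw [← zeta_five_inv]
  rfl

theorem coe_eta5_sq : (eta5 : F 5) ^ 2 = 1 - (eta5 : F 5) := by
  rw [coe_eta5]
  linear_combination zeta_five_sum + (zeta 5 ^ 3 + 2) * zeta_five_pow

theorem isIntegral_eta5 : IsIntegral ℤ eta5 := by
  refine (isIntegral_algebraMap_iff (algebraMap (k 5) (F 5)).injective).1 ?_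
  change IsIntegral ℤ (eta5 : F 5)
  have h : IsIntegral ℤ (zeta 5) := (zeta_spec 5).isIntegral (by norm_num)
  rw [coe_eta5]
  exact h.add (h.pow 4)

/-- The generator `ζ + ζ⁻¹` as an element of `𝒪_k`. -/
def etaInt5 : Ok 5 := ⟨eta5, isIntegral_eta5⟩

theorem exists_eq_add_mul_eta5 (x : k 5) : ∃ s t : ℚ, (x : F 5) = s + t * (eta5 : F 5) := by
  have hx : (x : F 5) ∈ Algebra.adjoin ℚ {zeta 5 + (zeta 5)⁻¹} := by
    rw [← IntermediateField.adjoin_simple_toSubalgebra_of_isAlgebraic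
      (Algebra.IsAlgebraic.isAlgebraic (R := ℚ) (zeta 5 + (zeta 5)⁻¹))]
    exact x.2
  generalize (x : F 5) = y at hx ⊢
  induction hx using Algebra.adjoin_induction with
  | mem y hy =>
    rw [Set.mem_singleton_iff] at hy
    exact ⟨0, 1, by rw [hy]; simp [eta5]⟩
  | algebraMap r => exact ⟨r, 0, by simp⟩
  | add y y' _ _ h h' =>
    obtain ⟨s, t, rfl⟩ := h
    obtain ⟨s', t', rfl⟩ := h'
    exact ⟨s + s', t + t', by push_cast; ring⟩
  | mul y y' _ _ h h' =>
    obtain ⟨s, t, rfl⟩ := h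
    obtain ⟨s', t', rfl⟩ := h'
    refine ⟨s * s' + t * t', s * t' + t * s' - t * t', ?_⟩
    push_cast
    linear_combination ((t : F 5) * t') * coe_eta5_sq

/-- The norm from `ℚ(√5)` to `ℚ`, as the product of the two real embeddings, with values in `ℂ`. -/
def norm5 (x : k 5) : ℂ := sigmaHalf 5 idx0 (x : F 5) * sigmaHalf 5 idx1 (x : F 5)

theorem norm5_mul (x y : k 5) : norm5 (x * y) = norm5 x * norm5 y := by
  simp only [norm5, MulMemClass.coe_mul, map_mul]
  ring

/-- The norm form of `ℤ[(-1 + √5) / 2]`. -/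
theorem norm5_eq {x : k 5} {s t : ℚ} (h : (x : F 5) = s + t * (eta5 : F 5)) :
    norm5 x = ((s ^ 2 - s * t - t ^ 2 : ℚ) : ℂ) := by
  have h0 := congrArg (sigmaHalf 5 idx0) coe_eta5_sq
  have h1 : sigmaHalf 5 idx1 (eta5 : F 5) = sigmaHalf 5 idx0 (eta5 : F 5) ^ 2 - 2 := by
    have h5 := congrArg (sigmaHalf 5 idx0) zeta_five_pow
    simp only [coe_eta5, map_add, map_pow, sigmaHalf_idx1_zeta, map_one] at h5 ⊢
    linear_combination -2 * h5
  simp only [map_pow, map_sub, map_one] at h0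
  have h2 : sigmaHalf 5 idx1 (eta5 : F 5) = -1 - sigmaHalf 5 idx0 (eta5 : F 5) := by
    rw [h1, h0]
    ring
  rw [norm5, h]
  simp only [map_add, map_mul, map_ratCast, h2]
  push_cast
  linear_combination (-(t : ℂ) ^ 2) * h0

theorem exists_int_norm5 (x : Ok 5) : ∃ m : ℤ, norm5 (x : k 5) = m := by
  obtain ⟨s, t, h⟩ := exists_eq_add_mul_eta5 (x : k 5)
  have hint : IsIntegral ℤ (norm5 (x : k 5)) := by
    have hF : IsIntegral ℤ ((x : k 5) : F 5) := x.isIntegral_coe.map (k 5).val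
    exact (hF.map (sigmaHalf 5 idx0)).mul (hF.map (sigmaHalf 5 idx1))
  rw [norm5_eq h] at hint ⊢
  have hQ : IsIntegral ℤ (s ^ 2 - s * t - t ^ 2) :=
    (isIntegral_algebraMap_iff (algebraMap ℚ ℂ).injective).1 hint
  obtain ⟨m, hm⟩ := IsIntegrallyClosed.isIntegral_iff.1 hQ
  exact ⟨m, by rw [← hm]; simp⟩

theorem norm5_ne_zero {x : k 5} (hx : x ≠ 0) : norm5 x ≠ 0 := by
  have h : (x : F 5) ≠ 0 := by simpa using hx
  exact mul_ne_zero ((map_ne_zero _).2 h) ((map_ne_zero _).2 h)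

/-- The absolute value of the norm of an element of `𝒪_k`. The norm is an integer, so that the
rounding is exact (`coe_absNorm5`). -/
def absNorm5 (x : Ok 5) : ℕ := ⌊‖norm5 (x : k 5)‖⌋₊

theorem coe_absNorm5 (x : Ok 5) : (absNorm5 x : ℝ) = ‖norm5 (x : k 5)‖ := by
  obtain ⟨m, hm⟩ := exists_int_norm5 x
  rw [absNorm5, hm, Complex.norm_intCast, ← Int.cast_abs, ← Int.natCast_natAbs, Int.cast_natCast,
    Nat.floor_natCast]

theorem absNorm5_euclidean (a c : Ok 5) (hc : c ≠ 0) :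
    ∃ q, absNorm5 (a - q * c) < absNorm5 c := by
  have hc' : (c : k 5) ≠ 0 := by simpa using hc
  obtain ⟨s, t, h⟩ := exists_eq_add_mul_eta5 ((a : k 5) / c)
  -- The coordinates of `a / c` are rounded to integers; the remainder has norm less than `1`.
  refine ⟨round s + round t * etaInt5, ?_⟩
  set q : Ok 5 := round s + round t * etaInt5 with hq
  have hqF : ((q : k 5) : F 5) = round s + round t * (eta5 : F 5) := by
    rw [hq]
    push_cast
    rfl
  have hfac : ((a - q * c : Ok 5) : k 5) = ((a : k 5) / c - q) * c := by
    push_cast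
    field_simp
  have hrem : ((((a : k 5) / c - q : k 5)) : F 5) =
      ((s - round s : ℚ) : F 5) + ((t - round t : ℚ) : F 5) * (eta5 : F 5) := by
    rw [AddSubgroupClass.coe_sub, hqF, h]
    push_cast
    ring
  have hs := abs_le.1 (abs_sub_round s)
  have ht := abs_le.1 (abs_sub_round t)
  have hlt : ‖norm5 ((a : k 5) / c - q)‖ < 1 := by
    rw [norm5_eq hrem, Complex.norm_ratCast]
    have : |(s - round s) ^ 2 - (s - round s) * (t - round t) - (t - round t) ^ 2| < (1 : ℚ) := by
      rw [abs_lt]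
      constructor <;> nlinarith
    exact_mod_cast this
  have : (absNorm5 (a - q * c) : ℝ) < absNorm5 c := by
    rw [coe_absNorm5, coe_absNorm5, hfac, norm5_mul, norm_mul]
    exact mul_lt_of_lt_one_left (norm_pos_iff.2 (norm5_ne_zero hc')) hlt
  exact_mod_cast this

/-- The theta function of a self-dual code over `𝔽₅` is a Hilbert modular form for `ℚ(√5)`. -/
theorem codeTheta_moeb {C : Submodule (ZMod 5) (Fin n → ZMod 5)} (hC : IsSelfDual C)
    (A : Matrix.SpecialLinearGroup (Fin 2) (Ok 5)) {z : Fin ((5 - 1) / 2) → ℂ} (hz : z ∈ Hr 5) :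
    codeTheta C (moeb A z) = codeTheta C z * ∏ l, autFactor A z l ^ n := by
  have htop := eq_top_of_euclidean absNorm5 absNorm5_euclidean
    (modularitySubgroup n (codeTheta C)) (inversion_mem_modularitySubgroup (by norm_num) hC)
    fun b => translation_mem_modularitySubgroup (by norm_num) hC b n
  have h : A ∈ modularitySubgroup n (codeTheta C) := htop ▸ Subgroup.mem_top A
  exact h z hz

/-- The automorphism `ζ ↦ ζ²` of `F`. -/
def frob : F 5 ≃ₐ[ℚ] F 5 :=
  IsCyclotomicExtension.fromZetaAut
    ((zeta_spec 5).pow_of_coprime 2 (by norm_num))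
    (Polynomial.cyclotomic.irreducible_rat (by norm_num))

theorem frob_zeta : frob (zeta 5) = zeta 5 ^ 2 :=
  IsCyclotomicExtension.fromZetaAut_spec _ _

/-- The automorphism `ζ ↦ ζ²` of `𝕆`. -/
def frobInt : O 5 ≃+* O 5 := NumberField.RingOfIntegers.mapRingEquiv frob

theorem coe_frobInt (x : O 5) : ((frobInt x : O 5) : F 5) = frob (x : F 5) := rfl

theorem frobInt_zetaInt : frobInt (zetaInt 5) = zetaInt 5 ^ 2 :=
  NumberField.RingOfIntegers.ext frob_zeta

theorem rho_frobInt (x : O 5) : rho 5 (frobInt x) = rho 5 x := by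
  have h : ((rho 5).comp (frobInt : O 5 →+* O 5)).toIntAlgHom = (rho 5).toIntAlgHom := by
    refine (zeta_spec 5).integralPowerBasis.algHom_ext ?_
    rw [IsPrimitiveRoot.integralPowerBasis_gen]
    change rho 5 (frobInt (zetaInt 5)) = rho 5 (zetaInt 5)
    rw [frobInt_zetaInt, map_pow, rho_zeta, one_pow]
  exact DFunLike.congr_fun h x

theorem sigmaHalf_idx0_frob (x : F 5) : sigmaHalf 5 idx0 (frob x) = sigmaHalf 5 idx1 x := by
  have h : (sigmaHalf 5 idx0).comp (frob : F 5 →ₐ[ℚ] F 5) = sigmaHalf 5 idx1 := by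
    refine ((zeta_spec 5).powerBasis ℚ).algHom_ext ?_
    rw [IsPrimitiveRoot.powerBasis_gen]
    change sigmaHalf 5 idx0 (frob (zeta 5)) = sigmaHalf 5 idx1 (zeta 5)
    rw [frob_zeta, map_pow, sigmaHalf_idx1_zeta]
  exact DFunLike.congr_fun h x

theorem sigmaHalf_idx1_frob (x : F 5) :
    sigmaHalf 5 idx1 (frob x) = (starRingEnd ℂ) (sigmaHalf 5 idx0 x) := by
  have h : (sigmaHalf 5 idx1).comp (frob : F 5 →ₐ[ℚ] F 5) =
      (Complex.conjAe.toAlgHom.restrictScalars ℚ).comp (sigmaHalf 5 idx0) := by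
    refine ((zeta_spec 5).powerBasis ℚ).algHom_ext ?_
    rw [IsPrimitiveRoot.powerBasis_gen]
    change sigmaHalf 5 idx1 (frob (zeta 5)) = (starRingEnd ℂ) (sigmaHalf 5 idx0 (zeta 5))
    have h1 : (starRingEnd ℂ) (sigmaHalf 5 idx0 (zeta 5)) = (sigmaHalf 5 idx0 (zeta 5))⁻¹ := by
      rw [← Complex.inv_eq_conj]
      exact ((zeta_spec 5).map_of_injective (sigmaHalf 5 idx0).injective).norm'_eq_one
        (by norm_num)
    rw [frob_zeta, map_pow, sigmaHalf_idx1_zeta, h1, ← map_inv₀, zeta_five_inv, map_pow]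
    ring
  exact DFunLike.congr_fun h x

theorem quadForm_frobInt (x : Fin n → O 5) :
    quadForm (fun i => frobInt (x i)) idx0 = quadForm x idx1 ∧
      quadForm (fun i => frobInt (x i)) idx1 = quadForm x idx0 := by
  simp only [quadForm, coe_frobInt, sigmaHalf_idx0_frob, sigmaHalf_idx1_frob,
    RCLike.norm_conj, and_self]

/-- The automorphism `ζ ↦ ζ²` acts on `ρ⁻¹(C)`, because `ρ` is invariant under it. -/
def frobLattice (C : Submodule (ZMod 5) (Fin n → ZMod 5)) : codeLattice C ≃ codeLattice C :=
  (Equiv.piCongrRight fun _ => frobInt.toEquiv).subtypeEquiv fun x => by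
    change x ∈ codeLattice C ↔ (fun i => frobInt (x i)) ∈ codeLattice C
    simp only [mem_codeLattice, rho_frobInt]

theorem coe_frobLattice (C : Submodule (ZMod 5) (Fin n → ZMod 5)) (x : codeLattice C) :
    (frobLattice C x).1 = fun i => frobInt (x.1 i) := rfl

theorem codeTheta_swap (C : Submodule (ZMod 5) (Fin n → ZMod 5)) (z : Fin ((5 - 1) / 2) → ℂ) :
    codeTheta C (z ∘ Equiv.swap idx0 idx1) = codeTheta C z := by
  rw [codeTheta, codeTheta, ← (frobLattice C).tsum_eq fun x : codeLattice C => thetaTerm z x.1]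
  refine tsum_congr fun x => ?_
  rw [coe_frobLattice, thetaTerm_eq_exp, thetaTerm_eq_exp, sum_idx, sum_idx,
    (quadForm_frobInt x.1).1, (quadForm_frobInt x.1).2]
  simp only [Function.comp_apply, Equiv.swap_apply_left, Equiv.swap_apply_right]
  rw [add_comm]

theorem codeTheta_perm (C : Submodule (ZMod 5) (Fin n → ZMod 5))
    (π : Equiv.Perm (Fin ((5 - 1) / 2))) (z : Fin ((5 - 1) / 2) → ℂ) :
    codeTheta C (z ∘ π) = codeTheta C z := by
  have hne : (idx0 : Fin ((5 - 1) / 2)) ≠ idx1 := by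
    simp [idx0, idx1]
  rcases eq_idx0_or_idx1 (π idx0) with h0 | h0 <;> rcases eq_idx0_or_idx1 (π idx1) with h1 | h1
  · exact absurd (π.injective (h0.trans h1.symm)) hne
  · congr 1
    funext l
    rcases eq_idx0_or_idx1 l with rfl | rfl <;> simp [h0, h1]
  · rw [← codeTheta_swap]
    congr 1
    funext l
    rcases eq_idx0_or_idx1 l with rfl | rfl <;> simp [h0, h1]
  · exact absurd (π.injective (h0.trans h1.symm)) hne

end

end Five

end EisensteinVOA

open EisensteinVOA in
theorem mainTheorem7 (p : ℕ) [Fact p.Prime] (hp : p ≠ 2) (n : ℕ)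
    (C : Submodule (ZMod p) (Fin n → ZMod p)) (hC : IsSelfDual C) :
    (HasPartitionFunction (M C) (L0 C) ∧
      ∃ f : ModularForm (Matrix.SpecialLinearGroup.mapGL ℝ : Matrix.SpecialLinearGroup (Fin 2) ℤ →* _).range
          ((n * ((p - 1) / 2) : ℕ) : ℤ),
        ∀ τ : UpperHalfPlane, f τ = Z C τ) ∧
    (p = 5 →
      (∀ z ∈ Hr p, ∀ w ∈ C, Summable fun x : Coset w => thetaTerm z x.1) ∧
      IsHilbertModularForm p n (refinedZ (classM C)) ∧
      IsSymmetric p (refinedZ (classM C))) := by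
  obtain ⟨hpart, hZ⟩ := hasPartitionFunction_and_Z C hp
  refine ⟨⟨hpart, diagThetaForm hp hC, fun τ => ?_⟩, ?_⟩
  · rw [hZ, diagThetaForm_apply]
  · rintro rfl
    refine ⟨fun z hz w hw => summable_thetaTerm_coset C hp hz hw, ⟨?_, fun A z hz => ?_⟩,
      fun _ π _ z hz => ?_⟩
    · exact (differentiableOn_codeTheta C hp).congr fun z hz => refinedZ_classM C hp hz
    · rw [refinedZ_classM C hp hz, refinedZ_classM C hp (moeb_mem_Hr A hz)]
      exact codeTheta_moeb hC A hz
    · rw [refinedZ_classM C hp hz, refinedZ_classM C hp (z := z ∘ π) fun l => hz (π l),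
        codeTheta_perm]
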